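/- Let $a,b,c>0$ be such that $1/a^2,1/b^2,1/c^2$ are linearly independent over $\mathbb{Q}$ and such that at least one of $b^2/a^2$, $c^2/a^2$, $c^2/b^2$ is an irrational of finite type. Here an irrational $\alpha$ is of finite type if the set of all real $\gamma$ with $\liminf_{q\to\infty}q^{\gamma}\|q\alpha\|=0$ ($q$ running through the positive integers, $\|t\|=\min_{n\in\mathbb{Z}}|t-n|$) has a finite supremum. Let $\mathbb{T}^3=\mathbb{R}^3/2\pi\mathcal{L}_0$ with $\mathcal{L}_0=\mathbb{Z}(a,0,0)\oplus\mathbb{Z}(0,b,0)\oplus\mathbb{Z}(0,0,c)$, and let $x_0\in\mathbb{T}^3$ and $\phi\in(-\pi,\pi)$. The point scatterer $-\Delta_{\phi,x_0}$ is the operator in $L^2(\mathbb{T}^3)$ whose domain consists of those $f\in L^2(\mathbb{T}^3)$ for which there is $s\in\mathbb{C}$ with $$f(x)=s\Big(\cos\tfrac{\phi}{2}\cdot\frac{-1}{4\pi|x-x_0|}+\sin\tfrac{\phi}{2}\Big)+o(1)\qquad(x\to x_0)$$ and $-\Delta f+s\cos\frac{\phi}{2}\,\delta_{x_0}\in L^2(\mathbb{T}^3)$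 (in the sense of distributions), with action $-\Delta_{\phi,x_0}f=-\Delta f+s\cos\frac{\phi}{2}\,\delta_{x_0}$. Its perturbed eigenfunctions are the eigenfunctions with $s\neq0$ (those with $s=0$ are the eigenfunctions of the Laplacian that vanish at $x_0$). Let $\Lambda_\phi\subset\mathbb{R}$ be the set of eigenvalues of the perturbed eigenfunctions, and for $\lambda\in\Lambda_\phi$ let $g_\lambda$ be an $L^2$-normalized perturbed eigenfunction with eigenvalue $\lambda$. (i) There is a subset $\Lambda_{\phi,\infty}\subseteq\Lambda_\phi$ of density one, i.e. with $\#\{\lambda\in\Lambda_{\phi,\infty}:\lambda\le X\}/\#\{\lambda\in\Lambda_\phi:\lambda\le X\}\to1$ as $X\to\infty$, such that for all $u\in C^\infty(\mathbb{T}^3)$ $$\int_{\mathbb{T}^3}u(x)|g_\lambda(x)|^2\,dx\to\frac{1}{\operatorname{area}(\mathbb{T}^3)}\int_{\mathbb{T}^3}u(x)\,dx$$ as $\lambda\to\infty$ along $\Lambda_{\phi,\infty}$; the set $\Lambda_{\phi,\infty}$ does not depend on $u$ or on the choice of the $g_\lambda$. (ii) The same holds when $\Lambda_\phi$ is replaced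 by the set of those real $\lambda\notin\{|\xi|^2:\xi\in\mathcal{L}\}$ that solve $$\sum_{\xi\in\mathcal{L}}\Big\{\frac{1}{|\xi|^2-\lambda}-\frac{|\xi|^2}{|\xi|^4+1}\Big\}=c_0\tan\frac{\phi}{2},\qquad c_0=\sum_{\xi\in\mathcal{L}}\frac{1}{|\xi|^4+1},$$ where $\mathcal{L}=\mathbb{Z}(1/a,0,0)\oplus\mathbb{Z}(0,1/b,0)\oplus\mathbb{Z}(0,0,1/c)$, and $g_\lambda=G_\lambda/\|G_\lambda\|_2$ with the Green's function $G_\lambda=(\Delta+\lambda)^{-1}\delta_{x_0}$. -/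

import Mathlib

open Set Filter Topology MeasureTheory
open scoped ContDiff

noncomputable section

/-- The distance `‖t‖ = min_{n ∈ ℤ} |t - n|` from a real number to the nearest integer. -/
def distNearestInt (t : ℝ) : ℝ := |t - round t|

/-- `α` is an irrational of finite type `τ`: `τ` is the supremum of all real `γ` for which
`liminf_{q → ∞} q ^ γ * ‖q α‖ = 0`, where `q` runs through the positive integers.
(The terms are nonnegative; the lower limit is taken in `[0, ∞]`.) -/
def IsIrrationalOfType (α τ : ℝ) : Prop :=
  Irrational α ∧
    IsLUB {γ : ℝ | liminf (fun q : ℕ => ENNReal.ofReal ((q : ℝ) ^ γ * distNearestInt (q * α)))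
      atTop = 0} τ

/-- `α` is an irrational of finite type. -/
def IsIrrationalOfFiniteType (α : ℝ) : Prop := ∃ τ : ℝ, IsIrrationalOfType α τ

namespace PointScatterer

/-- The Euclidean space `ℝ³`. -/
abbrev E3 : Type := EuclideanSpace ℝ (Fin 3)

/-- The rectangular lattice `L₀ = ℤ(a,0,0) ⊕ ℤ(0,b,0) ⊕ ℤ(0,0,c)`. -/
def lattice (a b c : ℝ) : Set E3 :=
  {l | ∃ m n k : ℤ, l = !₂[(m : ℝ) * a, (n : ℝ) * b, (k : ℝ) * c]}

/-- The fundamental cell `[0,2πa) × [0,2πb) × [0,2πc)` of `2πL₀` (for `a, b, c > 0`);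
integrals over the torus `ℝ³/2πL₀` are integrals over this cell. -/
def cell (a b c : ℝ) : Set E3 :=
  {x | x 0 ∈ Ico 0 (2 * Real.pi * a) ∧ x 1 ∈ Ico 0 (2 * Real.pi * b) ∧
    x 2 ∈ Ico 0 (2 * Real.pi * c)}

/-- Functions on the torus `ℝ³/2πL₀` are the `2πL₀`-periodic functions on `ℝ³`. -/
def IsTorusFunction (a b c : ℝ) (f : E3 → ℂ) : Prop :=
  ∀ l ∈ lattice a b c, ∀ x, f (x + (2 * Real.pi) • l) = f x

/-- `f ∈ C^∞(ℝ³/2πL₀)`. -/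
def IsSmoothOnTorus (a b c : ℝ) (f : E3 → ℂ) : Prop :=
  IsTorusFunction a b c f ∧ ContDiff ℝ ∞ f

/-- `f` represents an element of `L²(ℝ³/2πL₀)`. -/
def IsL2OnTorus (a b c : ℝ) (f : E3 → ℂ) : Prop :=
  IsTorusFunction a b c f ∧ MemLp f 2 (volume.restrict (cell a b c))

/-- `-Δ f + A δ_{x₀} = h` in the sense of distributions on the torus `ℝ³/2πL₀`. -/
def DistributionalEq (a b c : ℝ) (x₀ : E3) (A : ℂ) (f h : E3 → ℂ) : Prop :=
  ∀ ψ : E3 → ℂ, IsSmoothOnTorus a b c ψ →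
    (∫ x in cell a b c, f x * (-Laplacian.laplacian ψ x)) + A * ψ x₀ =
      ∫ x in cell a b c, h x * ψ x

/-- The boundary condition of the point scatterer at `x₀` with phase `φ` and coefficient `s`:
`f(x) = s (cos(φ/2) · (-1/(4π|x-x₀|)) + sin(φ/2)) + o(1)` as `x → x₀`.
Since `f` represents an element of `L²`, null sets are disregarded in the limit. -/
def BoundaryCondition (x₀ : E3) (φ : ℝ) (s : ℂ) (f : E3 → ℂ) : Prop :=
  Tendsto (fun x : E3 => f x - s *
      ((Real.cos (φ / 2) * (-1 / (4 * Real.pi * ‖x - x₀‖)) + Real.sin (φ / 2) : ℝ) : ℂ))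
    (𝓝[≠] x₀ ⊓ ae volume) (𝓝 0)

/-- `f` lies in the domain of the self-adjoint extension `-Δ_{φ,x₀}` with coefficient `s` in its
boundary condition at `x₀`, and `-Δ_{φ,x₀} f = -Δ f + s cos(φ/2) δ_{x₀} = h`. -/
structure ScattererGraph (a b c : ℝ) (x₀ : E3) (φ : ℝ) (s : ℂ) (f h : E3 → ℂ) : Prop where
  memL2 : IsL2OnTorus a b c f
  image_memL2 : IsL2OnTorus a b c h
  boundary : BoundaryCondition x₀ φ s f
  equation : DistributionalEq a b c x₀ (s * (Real.cos (φ / 2) : ℂ)) f h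

/-- `f` is a perturbed (new) eigenfunction of `-Δ_{φ,x₀}` with eigenvalue `μ`: it solves
`-Δ_{φ,x₀} f = μ f` with a nonvanishing coefficient in its boundary condition at `x₀`. In
particular `f ≠ 0`. For a phase in `(-π, π)`, the eigenfunctions with vanishing coefficient are
those of the unperturbed Laplacian that vanish at `x₀`. -/
def IsPerturbedEigenfunction (a b c : ℝ) (x₀ : E3) (φ μ : ℝ) (f : E3 → ℂ) : Prop :=
  ∃ s : ℂ, s ≠ 0 ∧ ScattererGraph a b c x₀ φ s f (fun x => (μ : ℂ) * f x)

/-- The set `Λ_φ` of perturbed eigenvalues of `-Δ_{φ,x₀}`. -/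
def perturbedEigenvalues (a b c : ℝ) (x₀ : E3) (φ : ℝ) : Set ℝ :=
  {μ | ∃ f : E3 → ℂ, IsPerturbedEigenfunction a b c x₀ φ μ f}

/-- `g` is an `L²`-normalized perturbed eigenfunction with eigenvalue `μ`. -/
def IsNormalizedPerturbedEigenfunction (a b c : ℝ) (x₀ : E3) (φ μ : ℝ) (g : E3 → ℂ) : Prop :=
  IsPerturbedEigenfunction a b c x₀ φ μ g ∧ ∫ x in cell a b c, ‖g x‖ ^ 2 = 1

/-- The set `S` has density `d` in `Λ`:
`#{μ ∈ S : μ ≤ X} / #{μ ∈ Λ : μ ≤ X} → d` as `X → ∞`. -/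
def HasDensityIn (S Λ : Set ℝ) (d : ℝ) : Prop :=
  Tendsto (fun X : ℝ => ((S ∩ Iic X).ncard : ℝ) / ((Λ ∩ Iic X).ncard : ℝ)) atTop (𝓝 d)

/-- Almost all equidistribution on the torus `ℝ³/2πL₀`. Given a set `Λ` of eigenvalues and, for
each `μ ∈ Λ`, the normalized functions `g` with `IsEigenfunction μ g`, there is a subset of `Λ` of
density one along which `∫ u |g_μ|² → (1/area) ∫ u` for every smooth observable `u`, for every
choice `μ ↦ g_μ` of these functions. -/
def AlmostAllEquidistribute (a b c : ℝ) (Λ : Set ℝ)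
    (IsEigenfunction : ℝ → (E3 → ℂ) → Prop) : Prop :=
  ∃ Λinf : Set ℝ, Λinf ⊆ Λ ∧ HasDensityIn Λinf Λ 1 ∧
    ∀ g : ℝ → E3 → ℂ, (∀ μ ∈ Λ, IsEigenfunction μ (g μ)) →
      ∀ u : E3 → ℂ, IsSmoothOnTorus a b c u →
        Tendsto (fun μ : ℝ => ∫ x in cell a b c, u x * ((‖g μ x‖ ^ 2 : ℝ) : ℂ))
          (atTop ⊓ 𝓟 Λinf)
          (𝓝 (((volume (cell a b c)).toReal : ℂ)⁻¹ * ∫ x in cell a b c, u x))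

/-- The squared length `|ξ|²` of the vector `ξ = (k₁/a, k₂/b, k₃/c)` of the dual lattice. -/
def dualNormSq (a b c : ℝ) (k : Fin 3 → ℤ) : ℝ :=
  ((k 0 : ℝ) / a) ^ 2 + ((k 1 : ℝ) / b) ^ 2 + ((k 2 : ℝ) / c) ^ 2

/-- The real solutions `μ`, not among the norms `|ξ|²`, of the eigenvalue equation
`∑_ξ (1/(|ξ|²-μ) - |ξ|²/(|ξ|⁴+1)) = c₀ tan(φ/2)`, `c₀ = ∑_ξ 1/(|ξ|⁴+1)`,
the (absolutely convergent) sums being over the dual lattice. -/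
def secularEigenvalues (a b c φ : ℝ) : Set ℝ :=
  {μ | μ ∉ range (dualNormSq a b c) ∧
    ∑' k, (1 / (dualNormSq a b c k - μ) -
        dualNormSq a b c k / (dualNormSq a b c k ^ 2 + 1)) =
      (∑' k, 1 / (dualNormSq a b c k ^ 2 + 1)) * Real.tan (φ / 2)}

/-- `G` represents the Green's function `G_μ(·, x₀) = (Δ + μ)⁻¹ δ_{x₀}`: it lies in `L²` and
`-Δ G + δ_{x₀} = μ G`. -/
def IsGreenFunction (a b c : ℝ) (x₀ : E3) (μ : ℝ) (G : E3 → ℂ) : Prop :=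
  IsL2OnTorus a b c G ∧ DistributionalEq a b c x₀ 1 G (fun x => (μ : ℂ) * G x)

/-- `g = G_μ / ‖G_μ‖₂` is the `L²`-normalized Green's function. -/
def IsNormalizedGreenFunction (a b c : ℝ) (x₀ : E3) (μ : ℝ) (g : E3 → ℂ) : Prop :=
  ∃ G : E3 → ℂ, IsGreenFunction a b c x₀ μ G ∧
    ∀ x, g x = G x / (Real.sqrt (∫ y in cell a b c, ‖G y‖ ^ 2) : ℂ)

end PointScatterer

end

/-! Write `n_k` for `dualNormSq a b c k`. Testing `-Δf + Aδ = μf` against plane waves shows that the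
`k`-th Fourier coefficient of `f` is a unimodular multiple of `A / (n_k - μ)`. Perturbed
eigenfunctions and Green's functions therefore agree up to scalars, and the phase only decides which
`μ` occur. In both parts these `μ` form a level set of `resolventSum` off the norms `n_k`
(`perturbedEigenvalues_eq`, `secularEigenvalues_eq`). That sum increases from `-∞` to `∞` between
consecutive norms, so the level set interlaces with the norms (`interlaces_resolventSum`).

Expanding `u` in its absolutely convergent Fourier series reduces equidistribution to the decay, for
each `ζ ≠ 0`, of the integral of the `ζ`-th wave against `|g_μ|²`. This is bounded by `overlap`, the
quotient of `∑ |A_k A_{k+ζ}|` by `∑ A_k²` with `A_k = 1 / (n_k - μ)`. A norm just above `μ` makes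
the denominator large. If moreover few lattice points have norm near `μ`, and never both `k` and `k
+ ζ` have norm very near `μ`, Cauchy-Schwarz makes the numerator comparatively small (`overlap_le`).

The exceptional `μ` are counted through lattice points. Interlacing injects eigenvalues into lattice
points by `next`, and many points near many `μ` produce many pairs with close norms. The difference
of two norms is a linear form `∑ wᵢ Aᵢ` in differences of squares `Aᵢ`. A nonzero `Aᵢ` has few
representations by the divisor bound, and the finite type of a ratio of weights spaces out the
solutions of `|∑ wᵢ Aᵢ| ≤ L`, which saves a power of `L` (`exists_card_closePairs_le`). The `k` for
which `k` and `k + ζ` have close norms lie in a slab with only `O(X)` points. Altogether `O(X^(3/2 -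
δ))` eigenvalues in `(X, 2X]` are exceptional (`exists_card_overlap_le`), whereas linear
independence provides at least a constant times `X^(3/2)` eigenvalues up to `X`
(`Interlaces.exists_card_ge`). A diagonal argument over the countably many `ζ` gives one set of
density one.

For the boundary condition the Green's function is split into a periodized Yukawa potential, which
carries the Coulomb singularity, and a continuous trigonometric series whose value at `x₀` is a
multiple of `resolventSum`. Comparing constant terms gives the level. -/

/-! ### Divisor bound and Diophantine input -/

/-- The quotient of the divisor function by `n ^ ε` is a product over primes of `(e + 1) / p ^ (e
ε)`. For `p ≥ 2 ^ (1/ε)` the factor is at most `(e + 1) / 2 ^ e ≤ 1`; at each smaller prime it is at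
most `B`, because `2 ^ (e ε) ≥ 1 + e ε log 2`. -/
theorem card_divisors_le_rpow {ε : ℝ} (hε : 0 < ε) :
    ∃ C : ℝ, 0 < C ∧ ∀ n : ℕ, n ≠ 0 → (n.divisors.card : ℝ) ≤ C * (n : ℝ) ^ ε := by
  -- the local factor `B` is only needed at the primes below `P`
  obtain ⟨P, hP⟩ := exists_nat_gt ((2 : ℝ) ^ (1 / ε))
  set B : ℝ := 1 + 1 / (ε * Real.log 2) with hB
  have hlog : 0 < Real.log 2 := Real.log_pos (by norm_num)
  have hB1 : 1 ≤ B := by rw [hB]; have : 0 < 1 / (ε * Real.log 2) := by positivity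
                         linarith
  refine ⟨B ^ P, by positivity, fun n hn => ?_⟩
  have hlocal : ∀ p ∈ n.primeFactors, ((n.factorization p + 1 : ℕ) : ℝ) ≤
      (if p < P then B else 1) * ((p : ℝ) ^ (n.factorization p : ℝ)) ^ ε := by
    intro p hp
    have hpp := Nat.prime_of_mem_primeFactors hp
    have h2p : (2 : ℝ) ≤ p := by exact_mod_cast hpp.two_le
    set e := n.factorization p
    rw [← Real.rpow_mul (by positivity)]
    split_ifs with h
    · have h1 : (2 : ℝ) ^ (e * ε) ≤ (p : ℝ) ^ (e * ε) :=
        Real.rpow_le_rpow (by norm_num) h2p (by positivity)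
      have h2 : 1 + Real.log 2 * (e * ε) ≤ (2 : ℝ) ^ (e * ε) := by
        rw [Real.rpow_def_of_pos (by norm_num)]
        linarith [Real.add_one_le_exp (Real.log 2 * (e * ε))]
      have h3 : ((e + 1 : ℕ) : ℝ) ≤ B * (1 + Real.log 2 * (e * ε)) := by
        have : B * (1 + Real.log 2 * (e * ε)) =
            1 + e + 1 / (ε * Real.log 2) + Real.log 2 * (e * ε) := by
          rw [hB]; field_simp; ring
        rw [this]; push_cast
        have : 0 < 1 / (ε * Real.log 2) := by positivity
        have : 0 ≤ Real.log 2 * (e * ε) := by positivity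
        linarith
      exact h3.trans (mul_le_mul_of_nonneg_left (h2.trans h1) (by linarith))
    · have hpP : (2 : ℝ) ^ (1 / ε) ≤ p := hP.le.trans (by exact_mod_cast not_lt.mp h)
      have h1 : (2 : ℝ) ≤ (p : ℝ) ^ ε := by
        have := Real.rpow_le_rpow (by positivity) hpP hε.le
        rwa [← Real.rpow_mul (by norm_num), one_div_mul_cancel hε.ne', Real.rpow_one] at this
      rw [one_mul, mul_comm, Real.rpow_mul (by positivity), Real.rpow_natCast]
      calc ((e + 1 : ℕ) : ℝ) ≤ 2 ^ e := by exact_mod_cast Nat.lt_two_pow_self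
        _ ≤ _ := pow_le_pow_left₀ (by norm_num) h1 e
  rw [Nat.card_divisors hn]
  push_cast
  have hprod : ∏ p ∈ n.primeFactors, ((p : ℝ) ^ (n.factorization p : ℝ)) ^ ε = (n : ℝ) ^ ε := by
    rw [Real.finsetProd_rpow _ _ (fun i _ => by positivity)]
    congr 1
    conv_rhs => rw [← Nat.prod_factorization_pow_eq_self hn]
    rw [Finsupp.prod, Nat.support_factorization]
    push_cast
    exact Finset.prod_congr rfl fun p _ => Real.rpow_natCast _ _
  calc ∏ p ∈ n.primeFactors, ((n.factorization p : ℝ) + 1)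
      ≤ ∏ p ∈ n.primeFactors, (if p < P then B else 1) *
          ((p : ℝ) ^ (n.factorization p : ℝ)) ^ ε :=
        Finset.prod_le_prod (fun _ _ => by positivity) fun p hp => by
          simpa using hlocal p hp
    _ = (∏ p ∈ n.primeFactors, if p < P then B else 1) * (n : ℝ) ^ ε := by
        rw [Finset.prod_mul_distrib, hprod]
    _ ≤ B ^ P * (n : ℝ) ^ ε := by
        refine mul_le_mul_of_nonneg_right ?_ (by positivity)
        rw [Finset.prod_ite, Finset.prod_const, Finset.prod_const_one, mul_one]
        refine pow_le_pow_right₀ hB1 ?_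
        calc _ ≤ (Finset.range P).card := Finset.card_le_card fun p hp => by
              simpa using (Finset.mem_filter.mp hp).2
          _ = P := Finset.card_range P

theorem distNearestInt_le (t : ℝ) (n : ℤ) : distNearestInt t ≤ |t - n| := round_le t n

/-- An exponent above the supremum has positive lower limit, which bounds all large `q`; the
finitely many others have positive terms by irrationality. Taking `γ ≥ 1` keeps the later exponent
`1 / γ` at most one. -/
theorem IsIrrationalOfFiniteType.exists_lower_bound {α : ℝ} (h : IsIrrationalOfFiniteType α) :
    ∃ γ c : ℝ, 1 ≤ γ ∧ 0 < c ∧ ∀ q : ℕ, q ≠ 0 → c ≤ (q : ℝ) ^ γ * distNearestInt (q * α) := by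
  obtain ⟨τ, hirr, hlub⟩ := h
  set γ := max 1 (τ + 1)
  have hpos : ∀ q : ℕ, q ≠ 0 → 0 < (q : ℝ) ^ γ * distNearestInt (q * α) := by
    intro q hq
    have h1 : Irrational ((q : ℝ) * α) := hirr.natCast_mul hq
    have h2 : (q : ℝ) * α - round ((q : ℝ) * α) ≠ 0 := sub_ne_zero.mpr (h1.ne_int _)
    have h3 : (0 : ℝ) < q := by positivity
    exact mul_pos (Real.rpow_pos_of_pos h3 _) (abs_pos.mpr h2)
  have hnot : γ ∉ {γ : ℝ | liminf (fun q : ℕ =>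
      ENNReal.ofReal ((q : ℝ) ^ γ * distNearestInt (q * α))) atTop = 0} := fun hmem => by
    have := hlub.1 hmem
    have : τ + 1 ≤ γ := le_max_right _ _
    linarith
  obtain ⟨c, hc0, hc⟩ := exists_between (pos_iff_ne_zero.mpr hnot)
  have hev := eventually_lt_of_lt_liminf hc
  obtain ⟨N, hN⟩ := eventually_atTop.mp hev
  have hctop : c ≠ ⊤ := ne_top_of_lt hc
  have hfin : ∃ c' : ℝ, 0 < c' ∧ ∀ q ∈ Finset.range N, q ≠ 0 →
      c' ≤ (q : ℝ) ^ γ * distNearestInt (q * α) := by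
    clear hN
    induction N with
    | zero => exact ⟨1, one_pos, by simp⟩
    | succ N ih =>
      obtain ⟨c', hc', h⟩ := ih
      by_cases hN0 : N = 0
      · subst hN0
        refine ⟨c', hc', fun q hq hq0 => ?_⟩
        simp at hq; omega
      · refine ⟨min c' ((N : ℝ) ^ γ * distNearestInt (N * α)), lt_min hc' (hpos N hN0),
          fun q hq hq0 => ?_⟩
        rcases Finset.mem_insert.mp (Finset.range_add_one ▸ hq) with rfl | hq
        · exact min_le_right _ _
        · exact (min_le_left _ _).trans (h q hq hq0)
  obtain ⟨c', hc', h⟩ := hfin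
  refine ⟨γ, min c' c.toReal, le_max_left _ _, lt_min hc' (ENNReal.toReal_pos hc0.ne' hctop),
    fun q hq => ?_⟩
  by_cases hqN : q < N
  · exact (min_le_left _ _).trans (h q (Finset.mem_range.mpr hqN) hq)
  · refine (min_le_right _ _).trans ?_
    have := (hN q (not_lt.mp hqN)).le
    exact (ENNReal.le_ofReal_iff_toReal_le hctop (hpos q hq).le).mp this

/-! ### Counting solutions of a diagonal quadratic inequality -/

namespace QuadraticCount

/-- The pairs of integers of absolute value at most `M`. -/
noncomputable def pairs (M : ℕ) : Finset (ℤ × ℤ) := Finset.Icc (-M : ℤ) M ×ˢ Finset.Icc (-M : ℤ) M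

/-- The difference of squares. -/
def sqDiff (p : ℤ × ℤ) : ℤ := p.1 ^ 2 - p.2 ^ 2

theorem mem_pairs {M : ℕ} {p : ℤ × ℤ} : p ∈ pairs M ↔ |p.1| ≤ M ∧ |p.2| ≤ M := by
  simp [pairs, abs_le]

theorem card_pairs_le {M : ℕ} (hM : 1 ≤ M) : (pairs M).card ≤ 9 * M ^ 2 := by
  have : (pairs M).card = (2 * M + 1) * (2 * M + 1) := by
    simp only [pairs, Finset.card_product, Int.card_Icc]
    congr 1 <;> omega
  rw [this]; nlinarith

theorem abs_sqDiff_le {M : ℕ} {p : ℤ × ℤ} (hp : p ∈ pairs M) : |sqDiff p| ≤ (M : ℤ) ^ 2 := by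
  obtain ⟨h1, h2⟩ := mem_pairs.mp hp
  have h1 := sq_le_sq' (abs_le.mp h1).1 (abs_le.mp h1).2
  have h2 := sq_le_sq' (abs_le.mp h2).1 (abs_le.mp h2).2
  rw [sqDiff, abs_le]
  constructor <;> nlinarith [sq_nonneg p.1, sq_nonneg p.2]

/-- Each first coordinate admits at most two second coordinates, opposite to each other. This serves
`A = 0`, where the order of magnitude `M` is attained and no divisor bound is available. -/
theorem card_fiber_le_linear {M : ℕ} (hM : 1 ≤ M) (A : ℤ) :
    ((pairs M).filter (fun p => sqDiff p = A)).card ≤ 6 * M := by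
  have h := Finset.card_le_mul_card_image_of_maps_to (s := (pairs M).filter (fun p => sqDiff p = A))
    (t := Finset.Icc (-M : ℤ) M) (f := Prod.fst) (fun p hp => by
      simp only [pairs, Finset.mem_filter, Finset.mem_product] at hp; exact hp.1.1) 2 (fun k _ => ?_)
  · refine h.trans ?_
    rw [Int.card_Icc]; omega
  · by_cases he : (((pairs M).filter (fun p => sqDiff p = A)).filter (fun p => p.1 = k)) = ∅
    · simp [he]
    · obtain ⟨q, hq⟩ := Finset.nonempty_iff_ne_empty.mpr he
      simp only [Finset.mem_filter] at hq
      refine (Finset.card_le_card (t := {(k, q.2), (k, -q.2)}) fun p hp => ?_).trans Finset.card_le_two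
      simp only [Finset.mem_filter] at hp
      have : p.2 ^ 2 = q.2 ^ 2 := by
        have h1 := hp.1.2; have h2 := hq.1.2
        simp only [sqDiff] at h1 h2
        rw [hp.2] at h1; rw [hq.2] at h2; linarith
      rcases sq_eq_sq_iff_eq_or_eq_neg.mp this with h | h
      · simp [← h, ← hp.2]
      · simp [← hp.2, Prod.ext_iff, h]

/-- In `A = (x - y)(x + y)` the factor `x - y`, a divisor of either sign, determines the other
factor and hence the pair. -/
theorem card_fiber_le_divisors (M : ℕ) {A : ℤ} (hA : A ≠ 0) :
    ((pairs M).filter (fun p => sqDiff p = A)).card ≤ 2 * A.natAbs.divisors.card := by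
  have hinj : Set.InjOn (fun p : ℤ × ℤ => p.1 - p.2)
      ((pairs M).filter (fun p => sqDiff p = A) : Finset (ℤ × ℤ)) := by
    intro p hp q hq h
    simp only [Finset.mem_coe, Finset.mem_filter] at hp hq
    unfold sqDiff at hp hq
    have h : p.1 - p.2 = q.1 - q.2 := h
    have h1 : (p.1 - p.2) * (p.1 + p.2) = A := by linarith [hp.2]
    have h2 : (q.1 - q.2) * (q.1 + q.2) = A := by linarith [hq.2]
    have h0 : p.1 - p.2 ≠ 0 := fun h0 => hA (by rw [← h1, h0, zero_mul])
    have h3 : p.1 + p.2 = q.1 + q.2 := mul_left_cancel₀ h0 (by rw [h1, ← h2, h])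
    ext <;> linarith
  have hcard := Finset.card_le_card_of_injOn (s := (pairs M).filter (fun p => sqDiff p = A))
    (t := A.natAbs.divisors.image (fun d : ℕ => (d : ℤ)) ∪
      A.natAbs.divisors.image (fun d : ℕ => -(d : ℤ))) _ (fun p hp => ?_) hinj
  · refine hcard.trans ((Finset.card_union_le _ _).trans ?_)
    rw [two_mul]
    exact add_le_add Finset.card_image_le Finset.card_image_le
  · simp only [Finset.mem_filter, Finset.mem_coe] at hp
    unfold sqDiff at hp
    have hd : (p.1 - p.2) ∣ A := ⟨p.1 + p.2, by linarith [hp.2]⟩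
    have hd' : (p.1 - p.2).natAbs ∈ A.natAbs.divisors :=
      Nat.mem_divisors.mpr ⟨Int.natAbs_dvd_natAbs.mpr hd, Int.natAbs_ne_zero.mpr hA⟩
    simp only [Finset.coe_union, Finset.coe_image, Set.mem_union, Set.mem_image, Finset.mem_coe]
    rcases Int.natAbs_eq (p.1 - p.2) with h | h
    · exact Or.inl ⟨_, hd', h.symm⟩
    · exact Or.inr ⟨_, hd', h.symm⟩

theorem card_fiber_le_rpow {ε : ℝ} (hε : 0 < ε) :
    ∃ C : ℝ, 0 < C ∧ ∀ M : ℕ, 1 ≤ M → ∀ A : ℤ, A ≠ 0 →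
      (((pairs M).filter (fun p => sqDiff p = A)).card : ℝ) ≤ C * (M : ℝ) ^ ε := by
  obtain ⟨C, hC, h⟩ := card_divisors_le_rpow (half_pos hε)
  refine ⟨2 * C, by positivity, fun M hM A hA => ?_⟩
  by_cases he : ((pairs M).filter (fun p => sqDiff p = A)) = ∅
  · rw [he]; simp; positivity
  · obtain ⟨q, hq⟩ := Finset.nonempty_iff_ne_empty.mpr he
    simp only [Finset.mem_filter] at hq
    have hAM : (A.natAbs : ℝ) ≤ (M : ℝ) ^ 2 := by
      have := abs_sqDiff_le hq.1
      rw [hq.2, Int.abs_eq_natAbs] at this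
      exact_mod_cast this
    calc (((pairs M).filter (fun p => sqDiff p = A)).card : ℝ)
        ≤ 2 * A.natAbs.divisors.card := by exact_mod_cast card_fiber_le_divisors M hA
      _ ≤ 2 * (C * (A.natAbs : ℝ) ^ (ε / 2)) := by
          gcongr; exact h _ (Int.natAbs_ne_zero.mpr hA)
      _ ≤ 2 * (C * ((M : ℝ) ^ 2) ^ (ε / 2)) := by gcongr
      _ = 2 * C * (M : ℝ) ^ ε := by
          rw [← Real.rpow_natCast, ← Real.rpow_mul (by positivity)]
          push_cast; ring_nf

/-- The integers `A` with `|t + w A| ≤ D`. -/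
noncomputable def window (w t D : ℝ) : Finset ℤ := Finset.Icc ⌈(-D - t) / w⌉ ⌊(D - t) / w⌋

theorem mem_window {w t D : ℝ} (hw : 0 < w) {A : ℤ} : A ∈ window w t D ↔ |t + w * A| ≤ D := by
  rw [window, Finset.mem_Icc, Int.ceil_le, Int.le_floor, div_le_iff₀ hw, le_div_iff₀ hw, abs_le]
  constructor <;> rintro ⟨h1, h2⟩ <;> constructor <;> linarith

theorem card_window_le {w t D : ℝ} (hw : 0 < w) (hD : 0 ≤ D) :
    ((window w t D).card : ℝ) ≤ 2 * D / w + 1 := by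
  rw [window, Int.card_Icc]
  have h1 := Int.floor_le ((D - t) / w)
  have h2 := Int.le_ceil ((-D - t) / w)
  have h3 : (D - t) / w - (-D - t) / w = 2 * D / w := by ring
  by_cases h : 0 ≤ ⌊(D - t) / w⌋ + 1 - ⌈(-D - t) / w⌉
  · have : (((⌊(D - t) / w⌋ + 1 - ⌈(-D - t) / w⌉).toNat : ℤ) : ℝ) =
        ⌊(D - t) / w⌋ + 1 - ⌈(-D - t) / w⌉ := by
      rw [Int.toNat_of_nonneg h]; push_cast; ring
    rw [Int.cast_natCast] at this
    rw [this]; linarith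
  · rw [Int.toNat_of_nonpos (by omega)]
    have : 0 ≤ 2 * D / w := by positivity
    simp; linarith

/-- The pairs in `pairs M` whose difference of squares lies in a given window and satisfies `Q`
are at most `(2 D / w + 1) K` in number if each fibre of `sqDiff` in `Q` has at most `K`
elements. -/
theorem card_filter_window_le {M : ℕ} {w D K : ℝ} (hw : 0 < w) (hD : 0 ≤ D)
    (Q : ℤ → Prop) [DecidablePred Q]
    (hK : ∀ A, Q A → (((pairs M).filter (fun p => sqDiff p = A)).card : ℝ) ≤ K) (hK0 : 0 ≤ K)
    (t : ℝ) :
    (((pairs M).filter (fun p => Q (sqDiff p) ∧ |t + w * sqDiff p| ≤ D)).card : ℝ) ≤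
      (2 * D / w + 1) * K := by
  have h := Finset.card_eq_sum_card_fiberwise
    (s := (pairs M).filter (fun p => Q (sqDiff p) ∧ |t + w * sqDiff p| ≤ D))
    (t := window w t D) (f := sqDiff) (fun p hp => by
      simp only [Finset.mem_coe, Finset.mem_filter] at hp
      exact Finset.mem_coe.mpr ((mem_window hw).mpr hp.2.2))
  rw [h]
  push_cast
  calc _ ≤ ∑ A ∈ window w t D, K := Finset.sum_le_sum fun A _ => ?_
    _ = ((window w t D).card : ℝ) * K := by rw [Finset.sum_const, nsmul_eq_mul]
    _ ≤ _ := mul_le_mul_of_nonneg_right (card_window_le hw hD) hK0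
  by_cases hQ : Q A
  · refine le_trans ?_ (hK A hQ)
    exact_mod_cast Finset.card_le_card fun p hp => by
      simp only [Finset.mem_filter] at hp ⊢
      exact ⟨hp.1.1, hp.2⟩
  · have : (((pairs M).filter (fun p => Q (sqDiff p) ∧ |t + w * sqDiff p| ≤ D)).filter
        (fun p => sqDiff p = A)) = ∅ := by
      refine Finset.filter_eq_empty_iff.mpr fun p hp hpA => hQ ?_
      simp only [Finset.mem_filter] at hp
      rw [← hpA]; exact hp.2.1
    rw [this]; simpa using hK0

end QuadraticCount

theorem Finset.card_le_mul_card_of_fiber_le {α β : Type*} [DecidableEq β] {s : Finset α}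
    {t : Finset β} {f : α → β} {K : ℝ} (hf : ∀ x ∈ s, f x ∈ t)
    (hK : ∀ y ∈ t, ((s.filter (fun x => f x = y)).card : ℝ) ≤ K) :
    (s.card : ℝ) ≤ K * t.card := by
  rw [Finset.card_eq_sum_card_fiberwise (f := f) (t := t) hf]
  push_cast
  refine (Finset.sum_le_sum hK).trans ?_
  rw [Finset.sum_const, nsmul_eq_mul, mul_comm]

namespace QuadraticCount

/-- The triples of pairs on which the quadratic form `∑ wᵢ (kᵢ² - lᵢ²)` is at most `D` in absolute
value. -/
noncomputable def triples (M : ℕ) (w₁ w₂ w₃ D : ℝ) : Finset ((ℤ × ℤ) × (ℤ × ℤ) × (ℤ × ℤ)) :=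
  (pairs M ×ˢ pairs M ×ˢ pairs M).filter (fun p =>
    |w₁ * sqDiff p.1 + w₂ * sqDiff p.2.1 + w₃ * sqDiff p.2.2| ≤ D)

theorem mem_triples {M : ℕ} {w₁ w₂ w₃ D : ℝ} {p : (ℤ × ℤ) × (ℤ × ℤ) × (ℤ × ℤ)} :
    p ∈ triples M w₁ w₂ w₃ D ↔ (p.1 ∈ pairs M ∧ p.2.1 ∈ pairs M ∧ p.2.2 ∈ pairs M) ∧
      |w₁ * sqDiff p.1 + w₂ * sqDiff p.2.1 + w₃ * sqDiff p.2.2| ≤ D := by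
  simp [triples]

theorem card_triples_cond_le {M : ℕ} (hM : 1 ≤ M) {w₁ w₂ w₃ D K : ℝ} (hw : 0 < w₃) (hD : 0 ≤ D)
    (hK0 : 0 ≤ K) (Q : ℤ → Prop) [DecidablePred Q]
    (hK : ∀ A, Q A → (((pairs M).filter (fun p => sqDiff p = A)).card : ℝ) ≤ K) :
    (((triples M w₁ w₂ w₃ D).filter (fun p => Q (sqDiff p.2.2))).card : ℝ) ≤
      (2 * D / w₃ + 1) * K * (81 * (M : ℝ) ^ 4) := by
  refine (Finset.card_le_mul_card_of_fiber_le (t := pairs M ×ˢ pairs M)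
    (f := fun p => (p.1, p.2.1)) (K := (2 * D / w₃ + 1) * K) ?_ ?_).trans ?_
  · intro p hp
    have := (mem_triples.mp (Finset.mem_filter.mp hp).1).1
    exact Finset.mem_product.mpr ⟨this.1, this.2.1⟩
  · intro y _
    refine le_trans ?_ (card_filter_window_le hw hD Q hK hK0 (w₁ * sqDiff y.1 + w₂ * sqDiff y.2))
    refine Nat.cast_le.mpr (Finset.card_le_card_of_injOn (fun p => p.2.2) ?_ ?_)
    · intro p hp
      simp only [Finset.mem_coe, Finset.mem_filter, mem_triples] at hp ⊢
      obtain ⟨⟨⟨⟨h1, h2, h3⟩, h4⟩, h5⟩, rfl⟩ := hp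
      exact ⟨h3, h5, h4⟩
    · intro p hp p' hp' h
      simp only [Finset.mem_coe, Finset.mem_filter] at hp hp'
      have h1 := hp.2.trans hp'.2.symm
      simp only [Prod.mk.injEq] at h1
      exact Prod.ext h1.1 (Prod.ext h1.2 h)
  · refine mul_le_mul_of_nonneg_left ?_ (by positivity)
    rw [Finset.card_product]
    have := card_pairs_le hM
    have : ((pairs M).card : ℝ) ≤ 9 * M ^ 2 := by exact_mod_cast this
    push_cast
    calc ((pairs M).card : ℝ) * (pairs M).card ≤ (9 * M ^ 2) * (9 * M ^ 2) := by gcongr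
      _ = _ := by ring

/-- The same window argument; the vanishing of the first difference leaves only `6M` choices for the
first pair, hence a factor `6M · 9M²` in place of `81 M⁴`. -/
theorem card_triples_zero_cond_le {M : ℕ} (hM : 1 ≤ M) {w₁ w₂ w₃ D K : ℝ} (hw : 0 < w₃)
    (hD : 0 ≤ D) (hK0 : 0 ≤ K) (Q : ℤ → Prop) [DecidablePred Q]
    (hK : ∀ A, Q A → (((pairs M).filter (fun p => sqDiff p = A)).card : ℝ) ≤ K) :
    (((triples M w₁ w₂ w₃ D).filter (fun p => sqDiff p.1 = 0 ∧ Q (sqDiff p.2.2))).card : ℝ) ≤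
      (2 * D / w₃ + 1) * K * (54 * (M : ℝ) ^ 3) := by
  refine (Finset.card_le_mul_card_of_fiber_le
    (t := ((pairs M).filter (fun p => sqDiff p = 0)) ×ˢ pairs M)
    (f := fun p => (p.1, p.2.1)) (K := (2 * D / w₃ + 1) * K) ?_ ?_).trans ?_
  · intro p hp
    have hp := Finset.mem_filter.mp hp
    have := (mem_triples.mp hp.1).1
    exact Finset.mem_product.mpr ⟨Finset.mem_filter.mpr ⟨this.1, hp.2.1⟩, this.2.1⟩
  · intro y _
    refine le_trans ?_ (card_filter_window_le hw hD Q hK hK0 (w₁ * sqDiff y.1 + w₂ * sqDiff y.2))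
    refine Nat.cast_le.mpr (Finset.card_le_card_of_injOn (fun p => p.2.2) ?_ ?_)
    · intro p hp
      simp only [Finset.mem_coe, Finset.mem_filter, mem_triples] at hp ⊢
      obtain ⟨⟨⟨⟨h1, h2, h3⟩, h4⟩, _, h5⟩, rfl⟩ := hp
      exact ⟨h3, h5, h4⟩
    · intro p hp p' hp' h
      simp only [Finset.mem_coe, Finset.mem_filter] at hp hp'
      have h1 := hp.2.trans hp'.2.symm
      simp only [Prod.mk.injEq] at h1
      exact Prod.ext h1.1 (Prod.ext h1.2 h)
  · refine mul_le_mul_of_nonneg_left ?_ (by positivity)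
    rw [Finset.card_product]
    have h1 : ((pairs M).card : ℝ) ≤ 9 * M ^ 2 := by exact_mod_cast card_pairs_le hM
    have h2 : (((pairs M).filter (fun p => sqDiff p = 0)).card : ℝ) ≤ 6 * M := by
      exact_mod_cast card_fiber_le_linear hM 0
    push_cast
    calc (((pairs M).filter (fun p => sqDiff p = 0)).card : ℝ) * (pairs M).card
        ≤ (6 * M) * (9 * M ^ 2) := by gcongr
      _ = _ := by ring

/-- The triples with prescribed zero set are preserved by permuting the factors. -/
theorem card_triples_rotate (M : ℕ) (w₁ w₂ w₃ D : ℝ) (R : ℤ → ℤ → ℤ → Prop)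
    [∀ A B C, Decidable (R A B C)] :
    ((triples M w₁ w₂ w₃ D).filter
        (fun p => R (sqDiff p.1) (sqDiff p.2.1) (sqDiff p.2.2))).card ≤
      ((triples M w₃ w₁ w₂ D).filter
        (fun p => R (sqDiff p.2.1) (sqDiff p.2.2) (sqDiff p.1))).card := by
  refine Finset.card_le_card_of_injOn (fun p => (p.2.2, p.1, p.2.1)) ?_ ?_
  · intro p hp
    simp only [Finset.mem_coe, Finset.mem_filter, mem_triples] at hp ⊢
    obtain ⟨⟨⟨h1, h2, h3⟩, h4⟩, h5⟩ := hp
    refine ⟨⟨⟨h3, h1, h2⟩, ?_⟩, h5⟩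
    convert! h4 using 2; ring
  · intro p _ p' _ h
    simp only [Prod.mk.injEq] at h
    exact Prod.ext h.2.1 (Prod.ext h.2.2 h.1)

theorem card_triples_swap (M : ℕ) (w₁ w₂ w₃ D : ℝ) (R : ℤ → ℤ → ℤ → Prop)
    [∀ A B C, Decidable (R A B C)] :
    ((triples M w₁ w₂ w₃ D).filter
        (fun p => R (sqDiff p.1) (sqDiff p.2.1) (sqDiff p.2.2))).card ≤
      ((triples M w₂ w₁ w₃ D).filter
        (fun p => R (sqDiff p.2.1) (sqDiff p.1) (sqDiff p.2.2))).card := by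
  refine Finset.card_le_card_of_injOn (fun p => (p.2.1, p.1, p.2.2)) ?_ ?_
  · intro p hp
    simp only [Finset.mem_coe, Finset.mem_filter, mem_triples] at hp ⊢
    obtain ⟨⟨⟨h1, h2, h3⟩, h4⟩, h5⟩ := hp
    refine ⟨⟨⟨h2, h1, h3⟩, ?_⟩, h5⟩
    convert! h4 using 2; ring
  · intro p _ p' _ h
    simp only [Prod.mk.injEq] at h
    exact Prod.ext h.2.1 (Prod.ext h.1 h.2.2)

/-- The essentially trivial bound, with no Diophantine input. If the third difference is nonzero,
its fibres obey the divisor bound; if it vanishes, the loss of a factor `M` in the fibres of the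
second difference is made up by the scarcity of third pairs. -/
theorem card_triples_le {w₁ w₂ w₃ ε : ℝ} (h₂ : 0 < w₂) (h₃ : 0 < w₃) (hε : 0 < ε) :
    ∃ C : ℝ, 0 < C ∧ ∀ M : ℕ, 1 ≤ M → ∀ D : ℝ, 1 ≤ D →
      ((triples M w₁ w₂ w₃ D).card : ℝ) ≤ C * (M : ℝ) ^ ε * M ^ 4 * D := by
  obtain ⟨C, hC, hfib⟩ := card_fiber_le_rpow hε
  refine ⟨(2 / w₃ + 1) * (81 * C) + (2 / w₂ + 1) * 324, by positivity, fun M hM D hD => ?_⟩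
  have hM1 : (1 : ℝ) ≤ M := by exact_mod_cast hM
  have hMε : 1 ≤ (M : ℝ) ^ ε := Real.one_le_rpow hM1 hε.le
  have hsplit : triples M w₁ w₂ w₃ D =
      (triples M w₁ w₂ w₃ D).filter (fun p => sqDiff p.2.2 ≠ 0) ∪
        (triples M w₁ w₂ w₃ D).filter (fun p => sqDiff p.2.2 = 0) := by
    ext p; simp only [Finset.mem_union, Finset.mem_filter]; tauto
  have hDw : ∀ w : ℝ, 2 * D / w + 1 ≤ (2 / w + 1) * D := by
    intro w
    have : 2 * D / w = 2 / w * D := by ring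
    rw [this]; linarith
  have hA := card_triples_cond_le hM (w₁ := w₁) (w₂ := w₂) h₃ (zero_le_one.trans hD)
    (K := C * (M : ℝ) ^ ε) (by positivity) (fun A => A ≠ 0) (fun A hA => hfib M hM A hA)
  -- Rotation puts the vanishing difference first and the second weight last, where the window is
  -- taken.
  have hB : (((triples M w₁ w₂ w₃ D).filter (fun p => sqDiff p.2.2 = 0)).card : ℝ) ≤
      (2 * D / w₂ + 1) * (6 * M) * (54 * (M : ℝ) ^ 3) := by
    refine le_trans ?_ (card_triples_zero_cond_le hM (w₁ := w₃) (w₂ := w₁) h₂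
      (zero_le_one.trans hD) (K := 6 * M) (by positivity) (fun _ => True)
      (fun A _ => by exact_mod_cast card_fiber_le_linear hM A))
    have := card_triples_rotate M w₁ w₂ w₃ D (fun _ _ C => C = 0)
    simp only [and_true]
    exact_mod_cast this
  have hcard : ((triples M w₁ w₂ w₃ D).card : ℝ) ≤
      (2 * D / w₃ + 1) * (C * (M : ℝ) ^ ε) * (81 * (M : ℝ) ^ 4) +
        (2 * D / w₂ + 1) * (6 * M) * (54 * (M : ℝ) ^ 3) := by
    refine le_trans ?_ (add_le_add hA hB)
    conv_lhs => rw [hsplit]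
    exact_mod_cast Finset.card_union_le _ _
  refine hcard.trans ?_
  have h1 : (2 * D / w₃ + 1) * (C * (M : ℝ) ^ ε) * (81 * (M : ℝ) ^ 4) ≤
      (2 / w₃ + 1) * D * (C * (M : ℝ) ^ ε) * (81 * (M : ℝ) ^ 4) := by
    gcongr; exact hDw w₃
  have h2 : (2 * D / w₂ + 1) * (6 * M) * (54 * (M : ℝ) ^ 3) ≤
      (2 / w₂ + 1) * D * (6 * M) * (54 * (M : ℝ) ^ 3) * (M : ℝ) ^ ε := by
    refine le_trans ?_ (le_mul_of_one_le_right (by positivity) hMε)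
    gcongr; exact hDw w₂
  calc _ ≤ _ := add_le_add h1 h2
    _ = _ := by ring

/-- The integer points of the cube of half side `N` at which the linear form `∑ wᵢ Aᵢ` is at most
`L` in absolute value. -/
noncomputable def linearTriples (N : ℕ) (w₁ w₂ w₃ L : ℝ) : Finset (ℤ × ℤ × ℤ) :=
  (Finset.Icc (-N : ℤ) N ×ˢ Finset.Icc (-N : ℤ) N ×ˢ Finset.Icc (-N : ℤ) N).filter
    (fun A => |w₁ * A.1 + w₂ * A.2.1 + w₃ * A.2.2| ≤ L)

theorem card_le_of_separated {s : Finset ℤ} {N : ℕ} {G : ℝ} (hG : 0 < G)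
    (hs : s ⊆ Finset.Icc (-N : ℤ) N)
    (hsep : ∀ x ∈ s, ∀ y ∈ s, x ≠ y → G ≤ |(x : ℝ) - y|) :
    (s.card : ℝ) ≤ 2 * N / G + 2 := by
  have hmaps : ∀ x ∈ s, ⌊(x : ℝ) / G⌋ ∈ Finset.Icc ⌊-(N : ℝ) / G⌋ ⌊(N : ℝ) / G⌋ := by
    intro x hx
    have := Finset.mem_Icc.mp (hs hx)
    have h1 : -(N : ℝ) ≤ x := by exact_mod_cast this.1
    have h2 : (x : ℝ) ≤ N := by exact_mod_cast this.2
    exact Finset.mem_Icc.mpr ⟨Int.floor_le_floor (by gcongr), Int.floor_le_floor (by gcongr)⟩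
  have hinj : Set.InjOn (fun x : ℤ => ⌊(x : ℝ) / G⌋) s := by
    intro x hx y hy h
    by_contra hne
    have h1 := hsep x hx y hy hne
    have h2 := Int.abs_sub_lt_one_of_floor_eq_floor h
    rw [← sub_div, abs_div, abs_of_pos hG, div_lt_one hG] at h2
    linarith
  have hcard := Finset.card_le_card_of_injOn _ hmaps hinj
  rw [Int.card_Icc] at hcard
  have h1 : ((s.card : ℤ) : ℝ) ≤ ⌊(N : ℝ) / G⌋ + 1 - ⌊-(N : ℝ) / G⌋ := by
    have hle : ⌊-(N : ℝ) / G⌋ ≤ ⌊(N : ℝ) / G⌋ := Int.floor_le_floor (by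
      gcongr; exact (neg_nonpos.mpr (Nat.cast_nonneg N)).trans (Nat.cast_nonneg N))
    have : (s.card : ℤ) ≤ ⌊(N : ℝ) / G⌋ + 1 - ⌊-(N : ℝ) / G⌋ := by omega
    exact_mod_cast this
  have h2 := Int.floor_le ((N : ℝ) / G)
  have h3 := Int.lt_floor_add_one (-(N : ℝ) / G)
  rw [neg_div] at h3
  rw [Int.cast_natCast] at h1
  have : 2 * (N : ℝ) / G = N / G + N / G := by ring
  rw [neg_div] at h1
  linarith

/-- Two solutions with the same third coordinate and first coordinates differing by `q` satisfy `‖q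
w₁/w₂‖ ≤ 2L/w₂`, so the finite type bound forces `|q| ≥ G` when `q ≠ 0`. For `q = 0` the condition
`2L < w₂` makes the second coordinates agree. Each third coordinate thus carries at most `2N/G + 2`
solutions. -/
theorem card_linearTriples_le {w₁ w₂ w₃ L γ c : ℝ} (h₂ : 0 < w₂) (hL : 0 < L) (hL2 : 2 * L < w₂)
    (hγ : 1 ≤ γ) (hc : 0 < c)
    (htype : ∀ q : ℕ, q ≠ 0 → c ≤ (q : ℝ) ^ γ * distNearestInt (q * (w₁ / w₂))) (N : ℕ) :
    ((linearTriples N w₁ w₂ w₃ L).card : ℝ) ≤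
      (2 * N / (c * w₂ / (2 * L)) ^ (1 / γ) + 2) * (2 * N + 1) := by
  set G : ℝ := (c * w₂ / (2 * L)) ^ (1 / γ) with hGdef
  have hG : 0 < G := by positivity
  have hγ0 : 0 < γ := by linarith
  -- distinct first coordinates over the same third coordinate are `G`-separated
  have hdiff : ∀ A ∈ linearTriples N w₁ w₂ w₃ L, ∀ B ∈ linearTriples N w₁ w₂ w₃ L,
      A.2.2 = B.2.2 →
      |(w₁ / w₂) * ((A.1 : ℝ) - B.1) + ((A.2.1 : ℝ) - B.2.1)| ≤ 2 * L / w₂ := by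
    intro A hA B hB h
    have h1 := abs_le.mp (Finset.mem_filter.mp hA).2
    have h2 := abs_le.mp (Finset.mem_filter.mp hB).2
    rw [← h] at h2
    have : (w₁ / w₂) * ((A.1 : ℝ) - B.1) + ((A.2.1 : ℝ) - B.2.1) =
        ((w₁ * A.1 + w₂ * A.2.1 + w₃ * A.2.2) - (w₁ * B.1 + w₂ * B.2.1 + w₃ * A.2.2)) / w₂ := by
      field_simp; ring
    rw [this, abs_div, abs_of_pos h₂]
    gcongr
    rw [abs_le]; constructor <;> linarith [h1.1, h1.2, h2.1, h2.2]
  refine (Finset.card_le_mul_card_of_fiber_le (t := Finset.Icc (-N : ℤ) N) (f := fun A => A.2.2)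
    (K := 2 * N / G + 2) ?_ ?_).trans ?_
  · intro A hA
    simp only [linearTriples, Finset.mem_filter, Finset.mem_product] at hA
    exact hA.1.2.2
  · intro a _
    set s := (linearTriples N w₁ w₂ w₃ L).filter (fun A => A.2.2 = a)
    have hinj : Set.InjOn (fun A : ℤ × ℤ × ℤ => A.1) s := by
      intro A hA B hB h
      simp only [s, Finset.mem_coe, Finset.mem_filter] at hA hB
      have h1 := hdiff A hA.1 B hB.1 (hA.2.trans hB.2.symm)
      have h' : A.1 = B.1 := h
      rw [h', sub_self, mul_zero, zero_add] at h1
      have h2 : |((A.2.1 - B.2.1 : ℤ) : ℝ)| < 1 := by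
        push_cast
        refine h1.trans_lt ?_
        rwa [div_lt_one h₂]
      have h3 : A.2.1 - B.2.1 = 0 := by
        rw [← Int.cast_abs] at h2
        exact Int.abs_lt_one_iff.mp (by exact_mod_cast h2)
      exact Prod.ext h' (Prod.ext (by omega) (hA.2.trans hB.2.symm))
    rw [← Finset.card_image_of_injOn hinj]
    refine card_le_of_separated hG ?_ ?_
    · intro x hx
      obtain ⟨A, hA, rfl⟩ := Finset.mem_image.mp hx
      simp only [s, linearTriples, Finset.mem_filter, Finset.mem_product] at hA
      exact hA.1.1.1
    · intro x hx y hy hxy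
      obtain ⟨A, hA, rfl⟩ := Finset.mem_image.mp hx
      obtain ⟨B, hB, rfl⟩ := Finset.mem_image.mp hy
      simp only [s, Finset.mem_filter] at hA hB
      have h1 := hdiff A hA.1 B hB.1 (hA.2.trans hB.2.symm)
      set q : ℕ := (A.1 - B.1).natAbs with hq
      have hq0 : q ≠ 0 := Int.natAbs_ne_zero.mpr (sub_ne_zero.mpr hxy)
      have hqR : (q : ℝ) = |(A.1 : ℝ) - B.1| := by
        rw [hq, ← Int.cast_natCast, Int.natCast_natAbs]; push_cast; rfl
      have hdist : distNearestInt (q * (w₁ / w₂)) ≤ 2 * L / w₂ := by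
        rw [hqR]
        rcases abs_choice ((A.1 : ℝ) - B.1) with h | h <;> rw [h]
        · refine (distNearestInt_le _ (-(A.2.1 - B.2.1))).trans (le_trans (le_of_eq ?_) h1)
          push_cast; ring_nf
        · refine (distNearestInt_le _ (A.2.1 - B.2.1)).trans (le_trans (le_of_eq ?_) h1)
          rw [← abs_neg]; push_cast; ring_nf
      have h2 := htype q hq0
      have h3 : c ≤ (q : ℝ) ^ γ * (2 * L / w₂) :=
        h2.trans (mul_le_mul_of_nonneg_left hdist (by positivity))
      have h4 : c * w₂ / (2 * L) ≤ (q : ℝ) ^ γ := by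
        rw [div_le_iff₀ (by positivity)]
        have : (q : ℝ) ^ γ * (2 * L / w₂) * w₂ = (q : ℝ) ^ γ * (2 * L) := by field_simp
        nlinarith
      rw [← hqR, hGdef]
      calc (c * w₂ / (2 * L)) ^ (1 / γ) ≤ ((q : ℝ) ^ γ) ^ (1 / γ) :=
            Real.rpow_le_rpow (by positivity) h4 (by positivity)
        _ = q := by rw [← Real.rpow_mul (by positivity), mul_one_div_cancel hγ0.ne', Real.rpow_one]
  · refine mul_le_mul_of_nonneg_left ?_ (by positivity)
    rw [Int.card_Icc]
    have : ((N : ℤ) + 1 - -N).toNat = 2 * N + 1 := by omega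
    rw [this]; push_cast; rfl


/-- The map to the three differences of squares has fibres of size at most `K³` and takes values in
the cube of half side `M²`. -/
theorem card_triples_nonzero_le {M : ℕ} {w₁ w₂ w₃ L K : ℝ} (hK0 : 0 ≤ K)
    (hK : ∀ A, A ≠ 0 → (((pairs M).filter (fun p => sqDiff p = A)).card : ℝ) ≤ K) :
    (((triples M w₁ w₂ w₃ L).filter (fun p => sqDiff p.1 ≠ 0 ∧ sqDiff p.2.1 ≠ 0 ∧
      sqDiff p.2.2 ≠ 0)).card : ℝ) ≤ K ^ 3 * (linearTriples (M ^ 2) w₁ w₂ w₃ L).card := by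
  classical
  have hIcc : ∀ p ∈ pairs M, sqDiff p ∈ Finset.Icc (-(M ^ 2 : ℕ) : ℤ) (M ^ 2 : ℕ) := by
    intro p hp
    have := abs_le.mp (abs_sqDiff_le hp)
    rw [Finset.mem_Icc]; push_cast; exact this
  refine (Finset.card_le_mul_card_of_fiber_le
    (t := (linearTriples (M ^ 2) w₁ w₂ w₃ L).filter (fun A => A.1 ≠ 0 ∧ A.2.1 ≠ 0 ∧ A.2.2 ≠ 0))
    (f := fun p => (sqDiff p.1, sqDiff p.2.1, sqDiff p.2.2)) (K := K ^ 3) ?_ ?_).trans ?_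
  · intro p hp
    obtain ⟨h1, h2⟩ := Finset.mem_filter.mp hp
    obtain ⟨⟨h3, h4, h5⟩, h6⟩ := mem_triples.mp h1
    refine Finset.mem_filter.mpr ⟨Finset.mem_filter.mpr ⟨?_, h6⟩, h2⟩
    exact Finset.mem_product.mpr ⟨hIcc _ h3, Finset.mem_product.mpr ⟨hIcc _ h4, hIcc _ h5⟩⟩
  · intro A hA
    obtain ⟨-, hA1, hA2, hA3⟩ := Finset.mem_filter.mp hA
    calc _ ≤ (((pairs M).filter (fun p => sqDiff p = A.1) ×ˢ
          ((pairs M).filter (fun p => sqDiff p = A.2.1) ×ˢ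
            (pairs M).filter (fun p => sqDiff p = A.2.2))).card : ℝ) := by
          refine Nat.cast_le.mpr (Finset.card_le_card fun p hp => ?_)
          obtain ⟨h1, h2⟩ := Finset.mem_filter.mp hp
          obtain ⟨⟨h3, h4, h5⟩, -⟩ := mem_triples.mp (Finset.mem_filter.mp h1).1
          rw [← h2]
          simp [h3, h4, h5]
      _ ≤ K * (K * K) := by
          rw [Finset.card_product, Finset.card_product]
          push_cast
          gcongr
          · exact hK _ hA1
          · exact hK _ hA2
          · exact hK _ hA3
      _ = K ^ 3 := by ring
  · exact mul_le_mul_of_nonneg_left (Nat.cast_le.mpr (Finset.card_filter_le _ _)) (by positivity)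

theorem card_triples_all_zero_le {M : ℕ} (hM : 1 ≤ M) (w₁ w₂ w₃ L : ℝ) :
    (((triples M w₁ w₂ w₃ L).filter (fun p => sqDiff p.1 = 0 ∧ sqDiff p.2.1 = 0 ∧
      sqDiff p.2.2 = 0)).card : ℝ) ≤ 216 * (M : ℝ) ^ 3 := by
  set Z := (pairs M).filter (fun p => sqDiff p = 0)
  have hZ : (Z.card : ℝ) ≤ 6 * M := by exact_mod_cast card_fiber_le_linear hM 0
  calc _ ≤ ((Z ×ˢ (Z ×ˢ Z)).card : ℝ) := by
        refine Nat.cast_le.mpr (Finset.card_le_card fun p hp => ?_)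
        obtain ⟨h1, h2⟩ := Finset.mem_filter.mp hp
        obtain ⟨⟨h3, h4, h5⟩, -⟩ := mem_triples.mp h1
        simp [Z, h2, h3, h4, h5]
    _ ≤ (6 * M) * ((6 * M) * (6 * M)) := by
        rw [Finset.card_product, Finset.card_product]; push_cast; gcongr
    _ = _ := by ring

/-- Only triples with all differences nonzero require the finite type hypothesis; they give the term
`M⁴ L^(1/γ)`. A vanishing difference forces the count down to about `M³`. -/
theorem card_triples_le_of_small {w₁ w₂ w₃ γ c ε : ℝ} (h₁ : 0 < w₁) (h₂ : 0 < w₂) (h₃ : 0 < w₃)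
    (hγ : 1 ≤ γ) (hc : 0 < c)
    (htype : ∀ q : ℕ, q ≠ 0 → c ≤ (q : ℝ) ^ γ * distNearestInt (q * (w₁ / w₂))) (hε : 0 < ε) :
    ∃ C : ℝ, 0 < C ∧ ∀ M : ℕ, 1 ≤ M → ∀ L : ℝ, 0 < L → 2 * L < w₁ → 2 * L < w₂ → 2 * L < w₃ →
      ((triples M w₁ w₂ w₃ L).card : ℝ) ≤
        C * (M : ℝ) ^ ε * (M ^ 4 * L ^ (1 / γ) + M ^ 3) := by
  -- The exponent is `ε / 3` because three fibre bounds get multiplied.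
  obtain ⟨C, hC, hfib⟩ := card_fiber_le_rpow (show 0 < ε / 3 by positivity)
  set g : ℝ := (c * w₂ / 2) ^ (1 / γ) with hg
  have hg0 : 0 < g := by positivity
  refine ⟨C ^ 3 * (6 / g + 6) + 3 * (108 * C) + 216, by positivity,
    fun M hM L hL hL1 hL2 hL3 => ?_⟩
  have hM1 : (1 : ℝ) ≤ M := by exact_mod_cast hM
  set E : ℝ := (M : ℝ) ^ (ε / 3) with hE
  have hE1 : 1 ≤ E := Real.one_le_rpow hM1 (by positivity)
  have hE3 : E ^ 3 = (M : ℝ) ^ ε := by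
    rw [hE, ← Real.rpow_natCast, ← Real.rpow_mul (by positivity)]; congr 1; push_cast; ring
  have hE3' : E ≤ E ^ 3 := le_self_pow₀ hE1 (by norm_num)
  set T := triples M w₁ w₂ w₃ L with hT
  have hKfib := fun A hA => hfib M hM A hA
  have hw : ∀ w : ℝ, 0 < w → 2 * L < w → 2 * L / w + 1 ≤ 2 := by
    intro w hw h
    have : 2 * L / w ≤ 1 := (div_le_one hw).mpr h.le
    linarith
  have hzero : ∀ w : ℝ, 0 < w → 2 * L < w → ∀ A : ℤ, |w * A| ≤ L → A = 0 := by
    intro w hw h A hA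
    rw [abs_mul, abs_of_pos hw] at hA
    have : |(A : ℝ)| < 1 := by
      by_contra hcon
      nlinarith [not_lt.mp hcon]
    rw [← Int.cast_abs] at this
    exact Int.abs_lt_one_iff.mp (by exact_mod_cast this)
  -- If the last two differences vanish, then `|w₁ A₁| ≤ L < w₁` makes the first one vanish too; so
  -- five classes suffice.
  have hcover : T ⊆ T.filter (fun p => sqDiff p.1 ≠ 0 ∧ sqDiff p.2.1 ≠ 0 ∧ sqDiff p.2.2 ≠ 0) ∪
      (T.filter (fun p => sqDiff p.1 = 0 ∧ sqDiff p.2.2 ≠ 0) ∪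
      (T.filter (fun p => sqDiff p.2.1 = 0 ∧ sqDiff p.2.2 ≠ 0) ∪
      (T.filter (fun p => sqDiff p.2.2 = 0 ∧ sqDiff p.2.1 ≠ 0) ∪
      T.filter (fun p => sqDiff p.1 = 0 ∧ sqDiff p.2.1 = 0 ∧ sqDiff p.2.2 = 0)))) := by
    intro p hp
    have hform := (mem_triples.mp hp).2
    simp only [Finset.mem_union, Finset.mem_filter, hp, true_and]
    by_cases h3 : sqDiff p.2.2 = 0
    · by_cases h2 : sqDiff p.2.1 = 0
      · have h1 : sqDiff p.1 = 0 := by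
          refine hzero w₁ h₁ hL1 _ ?_
          simpa [h2, h3] using hform
        tauto
      · tauto
    · tauto
  have hA := card_triples_nonzero_le (w₁ := w₁) (w₂ := w₂) (w₃ := w₃) (L := L)
    (K := C * E) (by positivity) hKfib
  have hA' := card_linearTriples_le (w₃ := w₃) h₂ hL hL2 hγ hc htype (M ^ 2)
  have hB := card_triples_zero_cond_le hM (w₁ := w₁) (w₂ := w₂) h₃ hL.le (K := C * E)
    (by positivity) (fun A => A ≠ 0) hKfib
  have hB2 := card_triples_zero_cond_le hM (w₁ := w₂) (w₂ := w₁) h₃ hL.le (K := C * E)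
    (by positivity) (fun A => A ≠ 0) hKfib
  have hB3 := card_triples_zero_cond_le hM (w₁ := w₃) (w₂ := w₁) h₂ hL.le (K := C * E)
    (by positivity) (fun A => A ≠ 0) hKfib
  have hswap := card_triples_swap M w₁ w₂ w₃ L (fun _ B C => B = 0 ∧ C ≠ 0)
  have hrot := card_triples_rotate M w₁ w₂ w₃ L (fun _ B C => C = 0 ∧ B ≠ 0)
  have hZ := card_triples_all_zero_le hM w₁ w₂ w₃ L
  have hG : (c * w₂ / (2 * L)) ^ (1 / γ) = g / L ^ (1 / γ) := by
    rw [hg, ← Real.div_rpow (by positivity) hL.le]; congr 1; field_simp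
  rw [hG] at hA'
  have hcardT : (T.card : ℝ) ≤ (C * E) ^ 3 * (linearTriples (M ^ 2) w₁ w₂ w₃ L).card +
      ((2 * L / w₃ + 1) * (C * E) * (54 * (M : ℝ) ^ 3) +
      ((2 * L / w₃ + 1) * (C * E) * (54 * (M : ℝ) ^ 3) +
      ((2 * L / w₂ + 1) * (C * E) * (54 * (M : ℝ) ^ 3) + 216 * (M : ℝ) ^ 3))) := by
    have hu : (T.card : ℝ) ≤ _ := Nat.cast_le.mpr (Finset.card_le_card hcover)
    refine hu.trans ?_
    refine (Nat.cast_le.mpr (Finset.card_union_le _ _)).trans ?_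
    rw [Nat.cast_add]
    refine add_le_add hA ?_
    refine (Nat.cast_le.mpr (Finset.card_union_le _ _)).trans ?_
    rw [Nat.cast_add]
    refine add_le_add hB ?_
    refine (Nat.cast_le.mpr (Finset.card_union_le _ _)).trans ?_
    rw [Nat.cast_add]
    refine add_le_add ((Nat.cast_le.mpr hswap).trans hB2) ?_
    refine (Nat.cast_le.mpr (Finset.card_union_le _ _)).trans ?_
    rw [Nat.cast_add]
    exact add_le_add ((Nat.cast_le.mpr hrot).trans hB3) hZ
  refine hcardT.trans ?_
  have hlin : ((linearTriples (M ^ 2) w₁ w₂ w₃ L).card : ℝ) ≤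
      (6 / g + 6) * (M ^ 4 * L ^ (1 / γ) + M ^ 3) := by
    refine hA'.trans ?_
    push_cast
    have hLg : 0 < L ^ (1 / γ) := by positivity
    have e1 : 2 * (M : ℝ) ^ 2 / (g / L ^ (1 / γ)) = 2 * M ^ 2 * L ^ (1 / γ) / g := by
      field_simp
    rw [e1]
    calc (2 * (M : ℝ) ^ 2 * L ^ (1 / γ) / g + 2) * (2 * M ^ 2 + 1)
        ≤ (2 * (M : ℝ) ^ 2 * L ^ (1 / γ) / g + 2) * (3 * M ^ 2) := by
          gcongr; nlinarith
      _ = 6 / g * (M ^ 4 * L ^ (1 / γ)) + 6 * M ^ 2 := by ring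
      _ ≤ 6 / g * (M ^ 4 * L ^ (1 / γ) + M ^ 3) + 6 * (M ^ 4 * L ^ (1 / γ) + M ^ 3) := by
          have hsq : (M : ℝ) ^ 2 ≤ M ^ 3 := pow_le_pow_right₀ hM1 (by norm_num)
          have hp : 0 ≤ (M : ℝ) ^ 4 * L ^ (1 / γ) := by positivity
          gcongr
          · linarith [show (0 : ℝ) ≤ M ^ 3 by positivity]
          · linarith
      _ = _ := by ring
  set Y : ℝ := M ^ 4 * L ^ (1 / γ) + M ^ 3 with hY
  have hYM : (M : ℝ) ^ 3 ≤ Y := by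
    have : 0 ≤ (M : ℝ) ^ 4 * L ^ (1 / γ) := by positivity
    linarith
  have hY0 : 0 ≤ Y := le_trans (by positivity) hYM
  have t1 : (C * E) ^ 3 * ((linearTriples (M ^ 2) w₁ w₂ w₃ L).card : ℝ) ≤
      C ^ 3 * (6 / g + 6) * E ^ 3 * Y := by
    calc _ ≤ (C * E) ^ 3 * ((6 / g + 6) * Y) := by gcongr
      _ = _ := by ring
  have t2 : ∀ w : ℝ, 0 < w → 2 * L < w →
      (2 * L / w + 1) * (C * E) * (54 * (M : ℝ) ^ 3) ≤ 108 * C * E ^ 3 * Y := by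
    intro w hw0 hLw
    calc _ ≤ 2 * (C * E ^ 3) * (54 * Y) := by
          have := hw w hw0 hLw
          gcongr
      _ = _ := by ring
  have t3 : 216 * (M : ℝ) ^ 3 ≤ 216 * E ^ 3 * Y := by
    have : 1 ≤ E ^ 3 := one_le_pow₀ hE1
    calc 216 * (M : ℝ) ^ 3 ≤ 216 * 1 * Y := by linarith
      _ ≤ _ := by gcongr
  rw [← hE3]
  calc _ ≤ C ^ 3 * (6 / g + 6) * E ^ 3 * Y + (108 * C * E ^ 3 * Y + (108 * C * E ^ 3 * Y +
        (108 * C * E ^ 3 * Y + 216 * E ^ 3 * Y))) :=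
        add_le_add t1 (add_le_add (t2 _ h₃ hL3) (add_le_add (t2 _ h₃ hL3)
          (add_le_add (t2 _ h₂ hL2) t3)))
    _ = _ := by ring

/-- The saving is `κ = 1 / γ`. When `2L` is not below all weights, `L ^ κ` is bounded from below,
and the trivial bound at `D = 1` is already of the required form. -/
theorem card_triples_le_of_finiteType {w₁ w₂ w₃ : ℝ} (h₁ : 0 < w₁) (h₂ : 0 < w₂)
    (h₃ : 0 < w₃) (htype : IsIrrationalOfFiniteType (w₁ / w₂)) :
    ∃ κ : ℝ, 0 < κ ∧ κ ≤ 1 ∧ ∀ ε : ℝ, 0 < ε → ∃ C : ℝ, 0 < C ∧ ∀ M : ℕ, 1 ≤ M → ∀ L : ℝ, 0 < L →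
      L ≤ 1 → ((triples M w₁ w₂ w₃ L).card : ℝ) ≤
        C * (M : ℝ) ^ ε * (M ^ 4 * L ^ κ + M ^ 3) := by
  obtain ⟨γ, c, hγ, hc, hq⟩ := htype.exists_lower_bound
  refine ⟨1 / γ, by positivity, by rw [div_le_one (by linarith)]; exact hγ, fun ε hε => ?_⟩
  obtain ⟨C, hC, h⟩ := card_triples_le_of_small h₁ h₂ h₃ hγ hc hq hε
  obtain ⟨C', hC', h'⟩ := card_triples_le (w₁ := w₁) h₂ h₃ hε
  set m := min w₁ (min w₂ w₃) with hm
  have hm0 : 0 < m := lt_min h₁ (lt_min h₂ h₃)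
  have hm1 : m ≤ w₁ := min_le_left _ _
  have hm2 : m ≤ w₂ := (min_le_right _ _).trans (min_le_left _ _)
  have hm3 : m ≤ w₃ := (min_le_right _ _).trans (min_le_right _ _)
  set m' := (m / 2) ^ (1 / γ) with hm'
  have hm'0 : 0 < m' := by positivity
  refine ⟨C + C' / m', by positivity, fun M hM L hL hL1 => ?_⟩
  have hp : 0 ≤ (M : ℝ) ^ 4 * L ^ (1 / γ) := by positivity
  have hM3 : (0 : ℝ) ≤ (M : ℝ) ^ 3 := by positivity
  have hMε : (0 : ℝ) ≤ (M : ℝ) ^ ε := by positivity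
  by_cases hLm : 2 * L < m
  · refine (h M hM L hL (hLm.trans_le hm1) (hLm.trans_le hm2) (hLm.trans_le hm3)).trans ?_
    gcongr
    have : 0 < C' / m' := by positivity
    linarith
  · have hmono : ((triples M w₁ w₂ w₃ L).card : ℝ) ≤ (triples M w₁ w₂ w₃ 1).card := by
      refine Nat.cast_le.mpr (Finset.card_le_card fun p hp => ?_)
      rw [mem_triples] at hp ⊢
      exact ⟨hp.1, hp.2.trans hL1⟩
    refine hmono.trans ((h' M hM 1 le_rfl).trans ?_)
    have hLm' : m' ≤ L ^ (1 / γ) := by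
      rw [hm']
      exact Real.rpow_le_rpow (by positivity) (by linarith) (by positivity)
    calc C' * (M : ℝ) ^ ε * M ^ 4 * 1 = C' / m' * M ^ ε * (M ^ 4 * m') := by field_simp
      _ ≤ C' / m' * M ^ ε * (M ^ 4 * L ^ (1 / γ) + M ^ 3) := by
          gcongr
          calc (M : ℝ) ^ 4 * m' ≤ M ^ 4 * L ^ (1 / γ) := by gcongr
            _ ≤ _ := by linarith
      _ ≤ _ := by gcongr; linarith

end QuadraticCount

/-! ### Pairs of dual lattice points with close norms -/

namespace PointScatterer

/-- The coefficients of the quadratic form `dualNormSq`. -/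
noncomputable def weight (a b c : ℝ) : Fin 3 → ℝ := ![1 / a ^ 2, 1 / b ^ 2, 1 / c ^ 2]

theorem dualNormSq_eq_sum (a b c : ℝ) (k : Fin 3 → ℤ) :
    dualNormSq a b c k = ∑ i, weight a b c i * (k i : ℝ) ^ 2 := by
  simp only [dualNormSq, weight, Fin.sum_univ_three, Matrix.cons_val]
  ring

theorem weight_pos {a b c : ℝ} (ha : 0 < a) (hb : 0 < b) (hc : 0 < c) (i : Fin 3) :
    0 < weight a b c i := by
  fin_cases i <;> simp [weight] <;> positivity

theorem dualNormSq_nonneg (a b c : ℝ) (k : Fin 3 → ℤ) : 0 ≤ dualNormSq a b c k := by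
  unfold dualNormSq; positivity

theorem dualNormSq_zero (a b c : ℝ) : dualNormSq a b c 0 = 0 := by
  simp [dualNormSq]

theorem sq_coord_le {a b c : ℝ} (ha : 0 < a) (hb : 0 < b) (hc : 0 < c) (k : Fin 3 → ℤ)
    (i : Fin 3) : (k i : ℝ) ^ 2 ≤ (a + b + c) ^ 2 * dualNormSq a b c k := by
  have key : ∀ t : ℝ, 0 < t → t ≤ a + b + c → ∀ m : ℝ, (m / t) ^ 2 ≤ dualNormSq a b c k →
      m ^ 2 ≤ (a + b + c) ^ 2 * dualNormSq a b c k := by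
    intro t ht hts m hm
    calc m ^ 2 = t ^ 2 * (m / t) ^ 2 := by field_simp
      _ ≤ _ := by gcongr
  have h0 := sq_nonneg ((k 0 : ℝ) / a)
  have h1 := sq_nonneg ((k 1 : ℝ) / b)
  have h2 := sq_nonneg ((k 2 : ℝ) / c)
  fin_cases i
  · exact key a ha (by linarith) (k 0) (by unfold dualNormSq; linarith)
  · exact key b hb (by linarith) (k 1) (by unfold dualNormSq; linarith)
  · exact key c hc (by linarith) (k 2) (by unfold dualNormSq; linarith)

/-- The bound for the coordinates of the points of `ball a b c X`. -/
noncomputable def radius (a b c X : ℝ) : ℕ := ⌈(a + b + c) * √X⌉₊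

theorem radius_le {a b c X : ℝ} (ha : 0 < a) (hb : 0 < b) (hc : 0 < c) (hX : 1 ≤ X) :
    (radius a b c X : ℝ) ≤ (a + b + c + 1) * X ^ (1 / 2 : ℝ) := by
  have h := Nat.ceil_lt_add_one (show 0 ≤ (a + b + c) * √X by positivity)
  have h1 : 1 ≤ √X := Real.one_le_sqrt.mpr hX
  rw [← Real.sqrt_eq_rpow]
  unfold radius; nlinarith

theorem one_le_radius {a b c X : ℝ} (ha : 0 < a) (hb : 0 < b) (hc : 0 < c) (hX : 1 ≤ X) :
    1 ≤ radius a b c X := Nat.one_le_ceil_iff.mpr (by positivity)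

theorem abs_coord_le_radius {a b c X : ℝ} (ha : 0 < a) (hb : 0 < b) (hc : 0 < c)
    {k : Fin 3 → ℤ} (hk : dualNormSq a b c k ≤ X) (i : Fin 3) : |k i| ≤ radius a b c X := by
  have h1 : |(k i : ℝ)| ≤ (a + b + c) * √X := by
    rw [← Real.sqrt_sq (show 0 ≤ a + b + c by positivity), ← Real.sqrt_mul (by positivity),
      ← Real.sqrt_sq_eq_abs]
    refine Real.sqrt_le_sqrt ((sq_coord_le ha hb hc k i).trans ?_)
    gcongr
  have h2 := h1.trans (Nat.le_ceil _)
  rw [← Int.cast_abs] at h2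
  exact_mod_cast h2

/-- The points of the dual lattice with squared length at most `X`, when `a, b, c > 0`. -/
noncomputable def ball (a b c X : ℝ) : Finset (Fin 3 → ℤ) :=
  (Fintype.piFinset fun _ => Finset.Icc (-(radius a b c X) : ℤ) (radius a b c X)).filter
    (fun k => dualNormSq a b c k ≤ X)

theorem mem_ball {a b c X : ℝ} (ha : 0 < a) (hb : 0 < b) (hc : 0 < c) {k : Fin 3 → ℤ} :
    k ∈ ball a b c X ↔ dualNormSq a b c k ≤ X := by
  simp only [ball, Finset.mem_filter, Fintype.mem_piFinset, Finset.mem_Icc, and_iff_right_iff_imp]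
  exact fun h i => abs_le.mp (abs_coord_le_radius ha hb hc h i)

theorem finite_dualNormSq_le {a b c : ℝ} (ha : 0 < a) (hb : 0 < b) (hc : 0 < c) (X : ℝ) :
    {k | dualNormSq a b c k ≤ X}.Finite :=
  (ball a b c X).finite_toSet.subset fun _ hk => (mem_ball ha hb hc).mpr hk

/-- The pairs of points of `ball a b c X` whose squared lengths differ by at most `D`. -/
noncomputable def closePairs (a b c X D : ℝ) : Finset ((Fin 3 → ℤ) × (Fin 3 → ℤ)) :=
  (ball a b c X ×ˢ ball a b c X).filter
    (fun p => |dualNormSq a b c p.1 - dualNormSq a b c p.2| ≤ D)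

theorem mem_closePairs {a b c X D : ℝ} (ha : 0 < a) (hb : 0 < b) (hc : 0 < c)
    {p : (Fin 3 → ℤ) × (Fin 3 → ℤ)} :
    p ∈ closePairs a b c X D ↔ (dualNormSq a b c p.1 ≤ X ∧ dualNormSq a b c p.2 ≤ X) ∧
      |dualNormSq a b c p.1 - dualNormSq a b c p.2| ≤ D := by
  simp [closePairs, mem_ball ha hb hc]

-- The permutation serves to put the two weights whose ratio is of finite type in the first two
-- places, as `card_triples_le_of_finiteType` requires.
open QuadraticCount in
theorem card_closePairs_le_triples {a b c : ℝ} (ha : 0 < a) (hb : 0 < b) (hc : 0 < c)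
    (X D : ℝ) (σ : Equiv.Perm (Fin 3)) :
    (closePairs a b c X D).card ≤ (triples (radius a b c X) (weight a b c (σ 0))
      (weight a b c (σ 1)) (weight a b c (σ 2)) D).card := by
  refine Finset.card_le_card_of_injOn (fun p => ((p.1 (σ 0), p.2 (σ 0)),
    (p.1 (σ 1), p.2 (σ 1)), (p.1 (σ 2), p.2 (σ 2)))) ?_ ?_
  · intro p hp
    obtain ⟨⟨h1, h2⟩, h3⟩ := (mem_closePairs ha hb hc).mp hp
    rw [Finset.mem_coe, mem_triples]
    simp only [mem_pairs]
    have hk := abs_coord_le_radius ha hb hc h1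
    have hl := abs_coord_le_radius ha hb hc h2
    refine ⟨⟨⟨hk _, hl _⟩, ⟨hk _, hl _⟩, hk _, hl _⟩, ?_⟩
    convert! h3 using 2
    rw [dualNormSq_eq_sum, dualNormSq_eq_sum, ← Finset.sum_sub_distrib, ← Equiv.sum_comp σ,
      Fin.sum_univ_three]
    simp only [sqDiff]; push_cast; ring
  · intro p _ q _ h
    simp only [Prod.mk.injEq] at h
    obtain ⟨⟨h1, h2⟩, ⟨h3, h4⟩, h5, h6⟩ := h
    have hall : ∀ i, p.1 (σ i) = q.1 (σ i) ∧ p.2 (σ i) = q.2 (σ i) := by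
      intro i; fin_cases i
      exacts [⟨h1, h2⟩, ⟨h3, h4⟩, ⟨h5, h6⟩]
    refine Prod.ext (funext fun i => ?_) (funext fun i => ?_)
    · simpa using (hall (σ.symm i)).1
    · simpa using (hall (σ.symm i)).2

theorem exists_perm_finiteType {a b c : ℝ}
    (htype : IsIrrationalOfFiniteType (b ^ 2 / a ^ 2) ∨
      IsIrrationalOfFiniteType (c ^ 2 / a ^ 2) ∨ IsIrrationalOfFiniteType (c ^ 2 / b ^ 2)) :
    ∃ σ : Equiv.Perm (Fin 3),
      IsIrrationalOfFiniteType (weight a b c (σ 0) / weight a b c (σ 1)) := by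
  rcases htype with h | h | h
  · exact ⟨1, by convert! h using 1; simp [weight]; field_simp⟩
  · exact ⟨Equiv.swap 1 2, by
      have h0 : Equiv.swap (1 : Fin 3) 2 0 = 0 := by decide
      have h1 : Equiv.swap (1 : Fin 3) 2 1 = 2 := by decide
      convert! h using 1; rw [h0, h1]; simp [weight]; field_simp⟩
  · exact ⟨finRotate 3, by
      have h0 : finRotate 3 0 = 1 := by decide
      have h1 : finRotate 3 1 = 2 := by decide
      convert! h using 1; rw [h0, h1]; simp [weight]; field_simp⟩

open QuadraticCount in
/-- Bounds for the number of pairs of dual lattice points with close squared lengths, with a power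
saving at short distances. -/
theorem exists_card_closePairs_le {a b c : ℝ} (ha : 0 < a) (hb : 0 < b) (hc : 0 < c)
    (htype : IsIrrationalOfFiniteType (b ^ 2 / a ^ 2) ∨
      IsIrrationalOfFiniteType (c ^ 2 / a ^ 2) ∨ IsIrrationalOfFiniteType (c ^ 2 / b ^ 2)) :
    ∃ κ : ℝ, 0 < κ ∧ κ ≤ 1 ∧ ∀ ε : ℝ, 0 < ε → ∃ C : ℝ, 0 < C ∧ ∀ X : ℝ, 1 ≤ X →
      (∀ D : ℝ, 1 ≤ D → ((closePairs a b c X D).card : ℝ) ≤ C * X ^ ε * X ^ 2 * D) ∧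
      (∀ L : ℝ, 0 < L → L ≤ 1 → ((closePairs a b c X L).card : ℝ) ≤
        C * X ^ ε * (X ^ 2 * L ^ κ + X ^ (3 / 2 : ℝ))) := by
  obtain ⟨σ, hσ⟩ := exists_perm_finiteType htype
  have hw := weight_pos ha hb hc
  obtain ⟨κ, hκ, hκ1, h⟩ := card_triples_le_of_finiteType (hw (σ 0)) (hw (σ 1)) (hw (σ 2)) hσ
  refine ⟨κ, hκ, hκ1, fun ε hε => ?_⟩
  obtain ⟨C, hC, hsmall⟩ := h ε hε
  obtain ⟨C', hC', hlarge⟩ := card_triples_le (w₁ := weight a b c (σ 0)) (hw (σ 1)) (hw (σ 2)) hε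
  set B := a + b + c + 1 with hB
  have hB1 : 1 ≤ B := by linarith
  refine ⟨(C + C') * B ^ ε * B ^ 4, by positivity, fun X hX => ?_⟩
  have hX0 : 0 < X := by linarith
  have hM := radius_le ha hb hc hX
  have hM1 := one_le_radius ha hb hc hX
  set M := radius a b c X
  have hMε : (M : ℝ) ^ ε ≤ B ^ ε * X ^ ε := by
    refine (Real.rpow_le_rpow (by positivity) hM hε.le).trans ?_
    rw [Real.mul_rpow (by positivity) (by positivity), ← Real.rpow_mul hX0.le]
    gcongr
    linarith
  have hM4 : (M : ℝ) ^ 4 ≤ B ^ 4 * X ^ 2 := by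
    calc (M : ℝ) ^ 4 ≤ (B * X ^ (1 / 2 : ℝ)) ^ 4 := by gcongr
      _ = B ^ 4 * X ^ 2 := by
        rw [mul_pow, ← Real.rpow_natCast (X ^ (1 / 2 : ℝ)), ← Real.rpow_mul hX0.le]
        norm_num
  have hM3 : (M : ℝ) ^ 3 ≤ B ^ 4 * X ^ (3 / 2 : ℝ) := by
    calc (M : ℝ) ^ 3 ≤ (B * X ^ (1 / 2 : ℝ)) ^ 3 := by gcongr
      _ = B ^ 3 * X ^ (3 / 2 : ℝ) := by
        rw [mul_pow, ← Real.rpow_natCast (X ^ (1 / 2 : ℝ)), ← Real.rpow_mul hX0.le]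
        norm_num
      _ ≤ _ := by gcongr; norm_num
  constructor
  · intro D hD
    have h0 : ((closePairs a b c X D).card : ℝ) ≤ _ :=
      Nat.cast_le.mpr (card_closePairs_le_triples ha hb hc X D σ)
    refine h0.trans ((hlarge M hM1 D hD).trans ?_)
    calc C' * (M : ℝ) ^ ε * M ^ 4 * D ≤ (C + C') * (B ^ ε * X ^ ε) * (B ^ 4 * X ^ 2) * D := by
          gcongr; linarith
      _ = _ := by ring
  · intro L hL hL1
    have h0 : ((closePairs a b c X L).card : ℝ) ≤ _ :=
      Nat.cast_le.mpr (card_closePairs_le_triples ha hb hc X L σ)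
    refine h0.trans ((hsmall M hM1 L hL hL1).trans ?_)
    calc C * (M : ℝ) ^ ε * (M ^ 4 * L ^ κ + M ^ 3)
        ≤ (C + C') * (B ^ ε * X ^ ε) * (B ^ 4 * X ^ 2 * L ^ κ + B ^ 4 * X ^ (3 / 2 : ℝ)) := by
          gcongr; linarith
      _ = _ := by ring

/-- Functions on `Fin 3` as triples. -/
def finThreeEquiv : (Fin 3 → ℤ) ≃ ℤ × ℤ × ℤ where
  toFun k := (k 0, k 1, k 2)
  invFun p := ![p.1, p.2.1, p.2.2]
  left_inv k := by ext i; fin_cases i <;> rfl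
  right_inv _ := rfl

theorem summable_one_add_sq_rpow : Summable fun m : ℤ => (1 + (m : ℝ) ^ 2) ^ (-(2 / 3) : ℝ) := by
  have h1 := Real.summable_abs_int_rpow (b := 4 / 3) (by norm_num)
  have h2 : Summable fun m : ℤ => if m = 0 then (1 : ℝ) else 0 :=
    summable_of_ne_finset_zero (s := {0}) (fun m hm => by simpa using hm)
  refine Summable.of_nonneg_of_le (fun m => by positivity) (fun m => ?_) (h1.add h2)
  by_cases hm : m = 0
  · subst hm; simp
  · simp only [hm, if_false, add_zero]
    have hm0 : 0 < |(m : ℝ)| := abs_pos.mpr (by exact_mod_cast hm)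
    have : |(m : ℝ)| ^ (-(4 / 3) : ℝ) = (|(m : ℝ)| ^ 2) ^ (-(2 / 3) : ℝ) := by
      rw [← Real.rpow_natCast, ← Real.rpow_mul hm0.le]; norm_num
    rw [this, sq_abs]
    have : 0 < (m : ℝ) ^ 2 := by rw [← sq_abs]; positivity
    exact Real.rpow_le_rpow_of_nonpos this (by linarith) (by norm_num)

/-- Each `1 + kᵢ²` is at most a constant times `1 + n_k`. Distributing the exponent `2` as `2/3`
over the three coordinates bounds the term by a product of three one-dimensional terms, summable
since `4/3 > 1`. -/
theorem summable_inv_one_add_dualNormSq_sq {a b c : ℝ} (ha : 0 < a) (hb : 0 < b) (hc : 0 < c) :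
    Summable fun k : Fin 3 → ℤ => 1 / (1 + dualNormSq a b c k) ^ 2 := by
  set f : ℤ → ℝ := fun m => (1 + (m : ℝ) ^ 2) ^ (-(2 / 3) : ℝ) with hf
  have hf0 : ∀ m, 0 ≤ f m := fun m => by positivity
  have hs := summable_one_add_sq_rpow
  have hprod : Summable fun k : Fin 3 → ℤ => f (k 0) * (f (k 1) * f (k 2)) := by
    have h2 := hs.mul_of_nonneg hs hf0 hf0
    have h3 := hs.mul_of_nonneg h2 hf0 (fun p => mul_nonneg (hf0 _) (hf0 _))
    exact (finThreeEquiv.summable_iff (f := fun p : ℤ × ℤ × ℤ => f p.1 * (f p.2.1 * f p.2.2))).mpr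
      h3
  set A := (a + b + c) ^ 2 + 1 with hA
  have hA0 : 0 < A := by positivity
  refine Summable.of_nonneg_of_le (fun k => by positivity) (fun k => ?_) (hprod.mul_left (A ^ 2))
  have hn := dualNormSq_nonneg a b c k
  set n := dualNormSq a b c k
  have hcoord : ∀ i, (A * (1 + n)) ^ (-(2 / 3) : ℝ) ≤ f (k i) := by
    intro i
    refine Real.rpow_le_rpow_of_nonpos (by positivity) ?_ (by norm_num)
    have := sq_coord_le ha hb hc k i
    rw [hA]; nlinarith
  have hP : (A * (1 + n)) ^ (-(2 / 3) : ℝ) * ((A * (1 + n)) ^ (-(2 / 3) : ℝ) *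
      (A * (1 + n)) ^ (-(2 / 3) : ℝ)) = 1 / (A * (1 + n)) ^ 2 := by
    have h0 : 0 < A * (1 + n) := by positivity
    rw [← Real.rpow_add h0, ← Real.rpow_add h0, one_div, ← Real.rpow_natCast,
      ← Real.rpow_neg h0.le]
    norm_num
  calc 1 / (1 + n) ^ 2 = A ^ 2 * (1 / (A * (1 + n)) ^ 2) := by field_simp
    _ ≤ A ^ 2 * (f (k 0) * (f (k 1) * f (k 2))) := by
      rw [← hP]
      gcongr
      exacts [hcoord 0, hcoord 1, hcoord 2]

/-! ### Interlacing and the transfer from eigenvalues to lattice points -/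

/-- The set `Λ` interlaces with the set `N` of nonnegative numbers. -/
structure Interlaces (N Λ : Set ℝ) : Prop where
  notMem : ∀ μ ∈ Λ, μ ∉ N
  between : ∀ μ ∈ Λ, ∀ μ' ∈ Λ, μ < μ' → ∃ n ∈ N, μ < n ∧ n < μ'
  exists_below : ∀ n ∈ N, 0 < n → ∃ μ ∈ Λ, μ < n ∧ ∀ m ∈ N, m < n → m < μ

theorem exists_dualNormSq_gt {a : ℝ} (ha : 0 < a) (b c μ : ℝ) :
    ∃ k, μ < dualNormSq a b c k := by
  obtain ⟨m, hm⟩ := exists_nat_gt (a * (|μ| + 1))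
  refine ⟨![m, 0, 0], ?_⟩
  have h1 : |μ| + 1 < m / a := by rw [lt_div_iff₀ ha]; linarith
  have h2 : dualNormSq a b c ![(m : ℤ), 0, 0] = ((m : ℝ) / a) ^ 2 := by
    simp [dualNormSq]
  rw [h2]
  nlinarith [le_abs_self μ, abs_nonneg μ]

theorem exists_next {a b c : ℝ} (ha : 0 < a) (hb : 0 < b) (hc : 0 < c) (μ : ℝ) :
    ∃ k, μ < dualNormSq a b c k ∧
      ∀ l, μ < dualNormSq a b c l → dualNormSq a b c k ≤ dualNormSq a b c l := by
  obtain ⟨k₀, hk₀⟩ := exists_dualNormSq_gt ha b c μ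
  obtain ⟨k, hk, hmin⟩ := ((ball a b c (dualNormSq a b c k₀)).filter
    (fun k => μ < dualNormSq a b c k)).exists_min_image (dualNormSq a b c)
    ⟨k₀, Finset.mem_filter.mpr ⟨(mem_ball ha hb hc).mpr le_rfl, hk₀⟩⟩
  rw [Finset.mem_filter, mem_ball ha hb hc] at hk
  refine ⟨k, hk.2, fun l hl => ?_⟩
  by_cases h : dualNormSq a b c l ≤ dualNormSq a b c k₀
  · exact hmin l (Finset.mem_filter.mpr ⟨(mem_ball ha hb hc).mpr h, hl⟩)
  · exact hk.1.trans (not_le.mp h).le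

/-- A lattice point whose squared length is the least one exceeding `μ`. -/
noncomputable def next (a b c μ : ℝ) : Fin 3 → ℤ :=
  Classical.epsilon fun k => μ < dualNormSq a b c k ∧
    ∀ l, μ < dualNormSq a b c l → dualNormSq a b c k ≤ dualNormSq a b c l

theorem next_spec {a b c : ℝ} (ha : 0 < a) (hb : 0 < b) (hc : 0 < c) (μ : ℝ) :
    μ < dualNormSq a b c (next a b c μ) ∧
      ∀ l, μ < dualNormSq a b c l → dualNormSq a b c (next a b c μ) ≤ dualNormSq a b c l :=
  Classical.epsilon_spec (exists_next ha hb hc μ)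

theorem Interlaces.next_lt {a b c : ℝ} (ha : 0 < a) (hb : 0 < b) (hc : 0 < c) {Λ : Set ℝ}
    (h : Interlaces (range (dualNormSq a b c)) Λ) {μ μ' : ℝ} (hμ : μ ∈ Λ) (hμ' : μ' ∈ Λ)
    (hlt : μ < μ') : dualNormSq a b c (next a b c μ) < μ' := by
  obtain ⟨_, ⟨k, rfl⟩, h1, h2⟩ := h.between μ hμ μ' hμ' hlt
  exact ((next_spec ha hb hc μ).2 k h1).trans_lt h2

/-- A norm lies between any two elements of `Λ`, so they are followed by different norms. This
injection turns every count of eigenvalues into a count of lattice points. -/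
theorem Interlaces.next_injOn {a b c : ℝ} (ha : 0 < a) (hb : 0 < b) (hc : 0 < c) {Λ : Set ℝ}
    (h : Interlaces (range (dualNormSq a b c)) Λ) : InjOn (next a b c) Λ := by
  intro μ hμ μ' hμ' heq
  by_contra hne
  rcases lt_or_gt_of_ne hne with hlt | hlt
  · have h1 := h.next_lt ha hb hc hμ hμ' hlt
    rw [heq] at h1
    exact lt_asymm h1 (next_spec ha hb hc μ').1
  · have h1 := h.next_lt ha hb hc hμ' hμ hlt
    rw [← heq] at h1
    exact lt_asymm h1 (next_spec ha hb hc μ).1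

theorem Interlaces.finite_inter_Iic {a b c : ℝ} (ha : 0 < a) (hb : 0 < b) (hc : 0 < c)
    {Λ : Set ℝ} (h : Interlaces (range (dualNormSq a b c)) Λ) (X : ℝ) : (Λ ∩ Iic X).Finite := by
  refine Set.Finite.of_finite_image ?_ ((h.next_injOn ha hb hc).mono inter_subset_left)
  refine (finite_dualNormSq_le ha hb hc (dualNormSq a b c (next a b c X))).subset ?_
  rintro _ ⟨μ, ⟨_, hμ⟩, rfl⟩
  exact (next_spec ha hb hc μ).2 _ (lt_of_le_of_lt hμ (next_spec ha hb hc X).1)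

/-- The lattice points whose squared length is at distance at most `D` from `μ`. -/
noncomputable def near (a b c μ D : ℝ) : Finset (Fin 3 → ℤ) :=
  (ball a b c (μ + D)).filter (fun k => |dualNormSq a b c k - μ| ≤ D)

theorem mem_near {a b c : ℝ} (ha : 0 < a) (hb : 0 < b) (hc : 0 < c) {μ D : ℝ} {k : Fin 3 → ℤ} :
    k ∈ near a b c μ D ↔ |dualNormSq a b c k - μ| ≤ D := by
  rw [near, Finset.mem_filter, mem_ball ha hb hc, and_iff_right_iff_imp]
  exact fun h => by linarith [(abs_le.mp h).2]

/-- A Markov type inequality: a set of elements of `Λ` with many lattice points nearby produces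
many close pairs of lattice points. -/
theorem Interlaces.card_mul_le_closePairs {a b c : ℝ} (ha : 0 < a) (hb : 0 < b) (hc : 0 < c)
    {Λ : Set ℝ} (h : Interlaces (range (dualNormSq a b c)) Λ) {X D g W Y : ℝ} {s : Finset ℝ}
    (hs : ↑s ⊆ Λ) (hsX : ∀ μ ∈ s, μ ≤ X)
    (hgap : ∀ μ ∈ s, dualNormSq a b c (next a b c μ) - μ ≤ g)
    (hW : ∀ μ ∈ s, W < (near a b c μ D).card) (hDY : X + D ≤ Y) (hgY : X + g ≤ Y) :
    W * s.card ≤ (closePairs a b c Y (D + g)).card := by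
  calc W * s.card = ∑ μ ∈ s, W := by rw [Finset.sum_const, nsmul_eq_mul, mul_comm]
    _ ≤ ∑ μ ∈ s, ((near a b c μ D).card : ℝ) := Finset.sum_le_sum fun μ hμ => (hW μ hμ).le
    _ = ((s.sigma fun μ => near a b c μ D).card : ℝ) := by
        rw [Finset.card_sigma]; push_cast; rfl
    _ ≤ (closePairs a b c Y (D + g)).card := by
        -- A point `k` near `μ` is paired with the norm following `μ`; their norms differ by at most
        -- `D + g`, and the second entry recovers `μ`.
        refine Nat.cast_le.mpr (Finset.card_le_card_of_injOn
          (fun p => (p.2, next a b c p.1)) ?_ ?_)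
        · rintro ⟨μ, k⟩ hp
          rw [Finset.mem_coe, Finset.mem_sigma, mem_near ha hb hc] at hp
          rw [Finset.mem_coe, mem_closePairs ha hb hc]
          have h1 := hgap μ hp.1
          have h2 := (next_spec ha hb hc μ).1
          have h3 := hsX μ hp.1
          have h4 := abs_le.mp hp.2
          simp only at h1 h2 h4 ⊢
          refine ⟨⟨by linarith, by linarith⟩, ?_⟩
          rw [abs_le]; constructor <;> linarith
        · rintro ⟨μ, k⟩ hp ⟨μ', k'⟩ hp' heq
          rw [Finset.mem_coe, Finset.mem_sigma] at hp hp'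
          simp only [Prod.mk.injEq] at heq
          have := h.next_injOn ha hb hc (hs hp.1) (hs hp'.1) heq.2
          simp only at this
          subst this
          rw [heq.1]

/-- There are few elements of `Λ` which are followed by a long gap. -/
theorem Interlaces.card_le_of_gap {a b c : ℝ} (ha : 0 < a) (hb : 0 < b) (hc : 0 < c)
    {Λ : Set ℝ} (h : Interlaces (range (dualNormSq a b c)) Λ) {X g : ℝ} {s : Finset ℝ}
    (hg : 0 < g) (hX : 0 ≤ X) (hs : ↑s ⊆ Λ) (hsX : ∀ μ ∈ s, X < μ ∧ μ ≤ 2 * X)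
    (hgap : ∀ μ ∈ s, g < dualNormSq a b c (next a b c μ) - μ) :
    (s.card : ℝ) ≤ X / g + 2 := by
  -- The next element of `Λ` comes after the long gap, so distinct elements of `s` are more than `g`
  -- apart.
  have hinj : InjOn (fun μ : ℝ => ⌊μ / g⌋) s := by
    have key : ∀ μ ∈ s, ∀ μ' ∈ s, μ < μ' → ⌊μ / g⌋ ≠ ⌊μ' / g⌋ := by
      intro μ hμ μ' hμ' hlt heq
      have h1 := h.next_lt ha hb hc (hs hμ) (hs hμ') hlt
      have h2 := hgap μ hμ
      have h3 := (abs_lt.mp (Int.abs_sub_lt_one_of_floor_eq_floor heq)).1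
      rw [← sub_div, lt_div_iff₀ hg] at h3
      linarith
    intro μ hμ μ' hμ' heq
    by_contra hne
    rcases lt_or_gt_of_ne hne with hlt | hlt
    · exact key μ hμ μ' hμ' hlt heq
    · exact key μ' hμ' μ hμ hlt heq.symm
  have hcard := Finset.card_le_card_of_injOn (t := Finset.Icc ⌊X / g⌋ ⌊2 * X / g⌋) _
    (fun μ hμ => by
      have := hsX μ hμ
      exact Finset.mem_coe.mpr (Finset.mem_Icc.mpr ⟨Int.floor_le_floor (by gcongr; exact this.1.le),
        Int.floor_le_floor (by gcongr; exact this.2)⟩)) hinj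
  rw [Int.card_Icc] at hcard
  have hle : ⌊X / g⌋ ≤ ⌊2 * X / g⌋ := Int.floor_le_floor (by gcongr; linarith)
  have h1 : ((s.card : ℤ) : ℝ) ≤ ⌊2 * X / g⌋ + 1 - ⌊X / g⌋ := by
    have : (s.card : ℤ) ≤ ⌊2 * X / g⌋ + 1 - ⌊X / g⌋ := by omega
    exact_mod_cast this
  rw [Int.cast_natCast] at h1
  have h2 := Int.floor_le (2 * X / g)
  have h3 := Int.lt_floor_add_one (X / g)
  have h4 : 2 * X / g = X / g + X / g := by ring
  linarith

theorem card_le_of_abs_add_mul_le {s : Finset ℤ} {w t D : ℝ} (hw : w ≠ 0) (hD : 0 ≤ D)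
    (hs : ∀ A ∈ s, |t + w * A| ≤ D) : (s.card : ℝ) ≤ 2 * D / |w| + 1 := by
  rcases lt_or_gt_of_ne hw with h | h
  · rw [abs_of_neg h]
    refine le_trans ?_ (QuadraticCount.card_window_le (t := -t) (neg_pos.mpr h) hD)
    refine Nat.cast_le.mpr (Finset.card_le_card fun A hA => ?_)
    rw [QuadraticCount.mem_window (neg_pos.mpr h), ← abs_neg]
    convert! hs A hA using 2; ring
  · rw [abs_of_pos h]
    refine le_trans ?_ (QuadraticCount.card_window_le (t := t) h hD)
    exact Nat.cast_le.mpr (Finset.card_le_card fun A hA =>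
      (QuadraticCount.mem_window h).mpr (hs A hA))

/-- A subset of the ball with few points on each line in the direction of the `i`-th axis has few
points. -/
theorem exists_card_le_of_card_fiber_le {a b c : ℝ} (ha : 0 < a) (hb : 0 < b) (hc : 0 < c)
    (i : Fin 3) : ∃ C : ℝ, 0 < C ∧ ∀ X : ℝ, 1 ≤ X → ∀ s ⊆ ball a b c X, ∀ K : ℝ, 0 ≤ K →
      (∀ y : Fin 2 → ℤ,
        (((s.filter (fun k => i.removeNth k = y)).image (fun k => k i)).card : ℝ) ≤ K) →
      (s.card : ℝ) ≤ C * K * X := by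
  refine ⟨9 * (a + b + c + 1) ^ 2, by positivity, fun X hX s hs K hK h => ?_⟩
  have hX0 : 0 < X := by linarith
  have hM := radius_le ha hb hc hX
  have hM1 : (1 : ℝ) ≤ radius a b c X := by exact_mod_cast one_le_radius ha hb hc hX
  set M := radius a b c X with hMdef
  refine (Finset.card_le_mul_card_of_fiber_le
    (t := Fintype.piFinset fun _ : Fin 2 => Finset.Icc (-M : ℤ) M)
    (f := fun k => i.removeNth k) (K := K) ?_ ?_).trans ?_
  · intro k hk
    have hk := (mem_ball ha hb hc).mp (hs hk)
    refine Fintype.mem_piFinset.mpr fun j => Finset.mem_Icc.mpr (abs_le.mp ?_)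
    exact abs_coord_le_radius ha hb hc hk _
  · intro y _
    refine le_trans (le_of_eq ?_) (h y)
    rw [Finset.card_image_of_injOn]
    intro k hk l hl hkl
    simp only [Finset.mem_coe, Finset.mem_filter] at hk hl
    rw [← Fin.insertNth_self_removeNth i k, ← Fin.insertNth_self_removeNth i l, hk.2, hl.2]
    have hkl : k i = l i := hkl
    rw [hkl]
  · rw [Fintype.card_piFinset]
    simp only [Int.card_Icc, Finset.prod_const, Finset.card_univ, Fintype.card_fin]
    have : ((M : ℤ) + 1 - -M).toNat = 2 * M + 1 := by omega
    rw [this]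
    push_cast
    have hXX : X ^ (1 / 2 : ℝ) * X ^ (1 / 2 : ℝ) = X := by
      rw [← Real.rpow_add hX0]; norm_num
    calc K * (2 * (M : ℝ) + 1) ^ 2 ≤ K * (3 * ((a + b + c + 1) * X ^ (1 / 2 : ℝ))) ^ 2 := by
          gcongr; linarith
      _ = 9 * (a + b + c + 1) ^ 2 * K * (X ^ (1 / 2 : ℝ) * X ^ (1 / 2 : ℝ)) := by ring
      _ = _ := by rw [hXX]

theorem apply_eq_of_removeNth_eq {i : Fin 3} {k l : Fin 3 → ℤ}
    (h : i.removeNth k = i.removeNth l) {j : Fin 3} (hj : j ≠ i) : k j = l j := by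
  obtain ⟨m, rfl⟩ := Fin.exists_succAbove_eq hj
  exact congrFun h m

/-- The lattice points in a slab orthogonal to `ζ` are few. -/
theorem exists_card_slab_le {a b c : ℝ} (ha : 0 < a) (hb : 0 < b) (hc : 0 < c)
    {ζ : Fin 3 → ℤ} (hζ : ζ ≠ 0) :
    ∃ C : ℝ, 0 < C ∧ ∀ X : ℝ, 1 ≤ X → (((ball a b c X).filter
      (fun k => |dualNormSq a b c (k + ζ) - dualNormSq a b c k| ≤ 2)).card : ℝ) ≤ C * X := by
  obtain ⟨i, hi⟩ := Function.ne_iff.mp hζ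
  obtain ⟨C, hC, h⟩ := exists_card_le_of_card_fiber_le ha hb hc i
  -- The difference of the norms of `k + ζ` and `k` is affine in `k`. Its slope `v` along the axis
  -- `i` is nonzero, so each line in that direction meets the slab in boundedly many points.
  set v : ℝ := 2 * weight a b c i * ζ i with hv
  have hv0 : v ≠ 0 := by
    have := (weight_pos ha hb hc i).ne'
    have : (ζ i : ℝ) ≠ 0 := by exact_mod_cast hi
    positivity
  refine ⟨C * (2 * 2 / |v| + 1), by positivity, fun X hX => ?_⟩
  refine h X hX _ (Finset.filter_subset _ _) _ (by positivity) fun y => ?_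
  set s := ((ball a b c X).filter
    (fun k => |dualNormSq a b c (k + ζ) - dualNormSq a b c k| ≤ 2)).filter
      (fun k => i.removeNth k = y) with hs
  rcases s.eq_empty_or_nonempty with he | ⟨k₀, hk₀⟩
  · rw [he]; simp; positivity
  set t : ℝ := dualNormSq a b c (k₀ + ζ) - dualNormSq a b c k₀ - v * k₀ i with ht
  refine card_le_of_abs_add_mul_le (t := t) hv0 (by norm_num) fun A hA => ?_
  obtain ⟨k, hk, rfl⟩ := Finset.mem_image.mp hA
  rw [hs, Finset.mem_filter, Finset.mem_filter] at hk hk₀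
  have hkey : ∀ k, dualNormSq a b c (k + ζ) - dualNormSq a b c k =
      ∑ j, weight a b c j * (2 * ζ j * k j + ζ j ^ 2) := by
    intro k
    rw [dualNormSq_eq_sum, dualNormSq_eq_sum, ← Finset.sum_sub_distrib]
    refine Finset.sum_congr rfl fun j _ => ?_
    simp only [Pi.add_apply]; push_cast; ring
  have heq : t + v * k i = dualNormSq a b c (k + ζ) - dualNormSq a b c k := by
    rw [ht, hkey, hkey, ← Finset.add_sum_erase _ _ (Finset.mem_univ i),
      ← Finset.add_sum_erase _ _ (Finset.mem_univ i), hv]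
    have : ∑ j ∈ Finset.univ.erase i, weight a b c j * (2 * ζ j * k₀ j + ζ j ^ 2) =
        ∑ j ∈ Finset.univ.erase i, weight a b c j * (2 * (ζ j : ℝ) * k j + ζ j ^ 2) := by
      refine Finset.sum_congr rfl fun j hj => ?_
      rw [apply_eq_of_removeNth_eq (hk₀.2.trans hk.2.symm) (Finset.ne_of_mem_erase hj)]
    rw [this]; ring
  rw [heq]; exact hk.1.2

theorem card_le_two_mul_card_sq (s : Finset ℤ) : s.card ≤ 2 * (s.image (fun m => m ^ 2)).card := by
  refine Finset.card_le_mul_card_image s 2 fun q hq => ?_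
  obtain ⟨m, _, rfl⟩ := Finset.mem_image.mp hq
  refine (Finset.card_le_card (t := {m, -m}) fun l hl => ?_).trans Finset.card_le_two
  simpa using sq_eq_sq_iff_eq_or_eq_neg.mp (Finset.mem_filter.mp hl).2

/-- The trivial bound for the number of lattice points in a shell. -/
theorem exists_card_shell_le {a b c : ℝ} (ha : 0 < a) (hb : 0 < b) (hc : 0 < c) :
    ∃ C : ℝ, 0 < C ∧ ∀ X : ℝ, 1 ≤ X → ∀ D : ℝ, 1 ≤ D → ∀ y : ℝ, (((ball a b c X).filter
      (fun k => |dualNormSq a b c k - y| ≤ D)).card : ℝ) ≤ C * X * D := by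
  obtain ⟨C, hC, h⟩ := exists_card_le_of_card_fiber_le ha hb hc 2
  set w := weight a b c 2 with hwdef
  have hw : 0 < w := weight_pos ha hb hc 2
  refine ⟨C * (2 * (2 / w + 1)), by positivity, fun X hX D hD y => ?_⟩
  have hX0 : 0 < X := by linarith
  refine (h X hX _ (Finset.filter_subset _ _) (2 * (2 / w + 1) * D) (by positivity)
    fun z => ?_).trans (le_of_eq (by ring))
  set s := ((ball a b c X).filter (fun k => |dualNormSq a b c k - y| ≤ D)).filter
      (fun k => (2 : Fin 3).removeNth k = z) with hs
  rcases s.eq_empty_or_nonempty with he | ⟨k₀, hk₀⟩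
  · rw [he]; simp; positivity
  set t : ℝ := dualNormSq a b c k₀ - w * (k₀ 2) ^ 2 - y with ht
  -- On a line in the last direction the norm is affine in the square of the last coordinate, so the
  -- squares are counted, at the cost of a factor two.
  have h1 : (((s.image (fun k => k 2)).image (fun m => m ^ 2)).card : ℝ) ≤ 2 * D / |w| + 1 := by
    refine card_le_of_abs_add_mul_le (t := t) hw.ne' (by linarith) fun A hA => ?_
    obtain ⟨m, hm, rfl⟩ := Finset.mem_image.mp hA
    obtain ⟨k, hk, rfl⟩ := Finset.mem_image.mp hm
    rw [hs, Finset.mem_filter, Finset.mem_filter] at hk hk₀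
    have heq : t + w * ((k 2 ^ 2 : ℤ) : ℝ) = dualNormSq a b c k - y := by
      have e0 := apply_eq_of_removeNth_eq (hk₀.2.trans hk.2.symm) (j := 0) (by decide)
      have e1 := apply_eq_of_removeNth_eq (hk₀.2.trans hk.2.symm) (j := 1) (by decide)
      rw [ht, dualNormSq_eq_sum, dualNormSq_eq_sum, Fin.sum_univ_three, Fin.sum_univ_three, e0, e1]
      push_cast; ring
    rw [heq]; exact hk.1.2
  rw [abs_of_pos hw] at h1
  have h2 : ((s.image (fun k => k 2)).card : ℝ) ≤
      2 * ((s.image (fun k => k 2)).image (fun m => m ^ 2)).card := by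
    exact_mod_cast card_le_two_mul_card_sq _
  calc _ ≤ 2 * (2 * D / w + 1) := by linarith
    _ = 2 * (2 / w * D + 1) := by ring
    _ ≤ 2 * (2 / w * D + D) := by linarith
    _ = _ := by ring

/-- The shell at distance about `iD` from `μ` has `O(XD)` points, each contributing at most
`(iD)⁻²`; summing over `i ≥ 1` gives `O(X / D)`. For norms above `5X` one has `n - μ ≥ (1 + n)/2`,
and a convergent sum independent of `μ` takes over. -/
theorem exists_sum_far_le {a b c : ℝ} (ha : 0 < a) (hb : 0 < b) (hc : 0 < c) :
    ∃ C : ℝ, 0 < C ∧ ∀ X : ℝ, 1 ≤ X → ∀ D : ℝ, 1 ≤ D → D ≤ X → ∀ μ : ℝ, μ ≤ 2 * X →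
      ∀ s : Finset (Fin 3 → ℤ), (∀ k ∈ s, D < |dualNormSq a b c k - μ|) →
        ∑ k ∈ s, (1 / (dualNormSq a b c k - μ)) ^ 2 ≤ C * (X / D) := by
  obtain ⟨C, hC, hshell⟩ := exists_card_shell_le ha hb hc
  have hsum := summable_inv_one_add_dualNormSq_sq ha hb hc
  have hzeta : Summable fun j : ℕ => 1 / (j : ℝ) ^ 2 := Real.summable_one_div_nat_pow.mpr one_lt_two
  set Z := ∑' k : Fin 3 → ℤ, 1 / (1 + dualNormSq a b c k) ^ 2 with hZ
  set Z' := ∑' j : ℕ, 1 / (j : ℝ) ^ 2 with hZ'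
  have hZ0 : 0 ≤ Z := tsum_nonneg fun k => by positivity
  have hZ'0 : 0 ≤ Z' := tsum_nonneg fun k => by positivity
  refine ⟨10 * C * Z' + 4 * Z + 1, by positivity, fun X hX D hD hDX μ hμ s hs => ?_⟩
  have hX0 : 0 < X := by linarith
  have hD0 : 0 < D := by linarith
  have hXD : 1 ≤ X / D := (one_le_div hD0).mpr hDX
  rw [← Finset.sum_filter_add_sum_filter_not s (fun k => dualNormSq a b c k ≤ 5 * X)]
  have hB : ∑ k ∈ s.filter (fun k => ¬ dualNormSq a b c k ≤ 5 * X),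
      (1 / (dualNormSq a b c k - μ)) ^ 2 ≤ 4 * Z := by
    calc _ ≤ ∑ k ∈ s.filter (fun k => ¬ dualNormSq a b c k ≤ 5 * X),
          4 * (1 / (1 + dualNormSq a b c k) ^ 2) := by
          refine Finset.sum_le_sum fun k hk => ?_
          have h5 := not_le.mp (Finset.mem_filter.mp hk).2
          have h1 : (1 + dualNormSq a b c k) / 2 ≤ dualNormSq a b c k - μ := by linarith
          have h2 : 0 < 1 + dualNormSq a b c k := by linarith
          calc (1 / (dualNormSq a b c k - μ)) ^ 2 ≤ (1 / ((1 + dualNormSq a b c k) / 2)) ^ 2 := by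
                have : 0 < dualNormSq a b c k - μ := by linarith
                gcongr
            _ = _ := by field_simp; norm_num
      _ ≤ 4 * Z := by
          rw [← Finset.mul_sum]
          exact mul_le_mul_of_nonneg_left (hsum.sum_le_tsum _ fun _ _ => by positivity)
            (by norm_num)
  have hA : ∑ k ∈ s.filter (fun k => dualNormSq a b c k ≤ 5 * X),
      (1 / (dualNormSq a b c k - μ)) ^ 2 ≤ 10 * C * Z' * (X / D) := by
    set sA := s.filter (fun k => dualNormSq a b c k ≤ 5 * X) with hsA
    set j : (Fin 3 → ℤ) → ℕ := fun k => ⌊|dualNormSq a b c k - μ| / D⌋₊ with hj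
    rw [← Finset.sum_fiberwise_of_maps_to (t := sA.image j) (g := j)
      (fun k hk => Finset.mem_image_of_mem j hk)]
    have hfib : ∀ i ∈ sA.image j, ∑ k ∈ sA.filter (fun k => j k = i),
        (1 / (dualNormSq a b c k - μ)) ^ 2 ≤ 10 * C * (X / D) * (1 / (i : ℝ) ^ 2) := by
      intro i hi
      have hi1 : 1 ≤ i := by
        obtain ⟨k, hk, rfl⟩ := Finset.mem_image.mp hi
        rw [hj, Nat.one_le_floor_iff, one_le_div hD0]
        exact (hs k (Finset.mem_filter.mp hk).1).le
      have hiR : (1 : ℝ) ≤ i := by exact_mod_cast hi1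
      have hjk : ∀ k ∈ sA.filter (fun k => j k = i),
          i * D ≤ |dualNormSq a b c k - μ| ∧ |dualNormSq a b c k - μ| ≤ (i + 1) * D := by
        intro k hk
        have h1 : j k = i := (Finset.mem_filter.mp hk).2
        have h2 := Nat.floor_le (show 0 ≤ |dualNormSq a b c k - μ| / D by positivity)
        have h3 := Nat.lt_floor_add_one (|dualNormSq a b c k - μ| / D)
        simp only [hj] at h1
        rw [h1] at h2 h3
        exact ⟨(le_div_iff₀ hD0).mp h2, ((div_lt_iff₀ hD0).mp h3).le⟩
      have hcard : ((sA.filter (fun k => j k = i)).card : ℝ) ≤ 10 * C * X * D := by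
        have hsub : sA.filter (fun k => j k = i) ⊆
            (ball a b c (5 * X)).filter (fun k => |dualNormSq a b c k - (μ + i * D)| ≤ D) ∪
            (ball a b c (5 * X)).filter (fun k => |dualNormSq a b c k - (μ - i * D)| ≤ D) := by
          intro k hk
          obtain ⟨h1, h2⟩ := hjk k hk
          have h3 := (Finset.mem_filter.mp (Finset.mem_filter.mp hk).1).2
          rw [Finset.mem_union, Finset.mem_filter, Finset.mem_filter, mem_ball ha hb hc]
          rcases abs_cases (dualNormSq a b c k - μ) with h | h
          · refine Or.inl ⟨h3, abs_le.mpr ⟨?_, ?_⟩⟩ <;> linarith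
          · refine Or.inr ⟨h3, abs_le.mpr ⟨?_, ?_⟩⟩ <;> linarith
        have h1 := hshell (5 * X) (by linarith) D hD (μ + i * D)
        have h2 := hshell (5 * X) (by linarith) D hD (μ - i * D)
        have h3 : ((sA.filter (fun k => j k = i)).card : ℝ) ≤ _ :=
          Nat.cast_le.mpr ((Finset.card_le_card hsub).trans (Finset.card_union_le _ _))
        push_cast at h3
        linarith
      calc _ ≤ ∑ k ∈ sA.filter (fun k => j k = i), 1 / (i * D) ^ 2 := by
            refine Finset.sum_le_sum fun k hk => ?_
            rw [div_pow, one_pow, ← sq_abs (dualNormSq a b c k - μ)]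
            have := (hjk k hk).1
            gcongr
        _ = (sA.filter (fun k => j k = i)).card * (1 / (i * D) ^ 2) := by
            rw [Finset.sum_const, nsmul_eq_mul]
        _ ≤ 10 * C * X * D * (1 / (i * D) ^ 2) := by gcongr
        _ = _ := by field_simp
    refine (Finset.sum_le_sum hfib).trans ?_
    rw [← Finset.mul_sum]
    calc _ ≤ 10 * C * (X / D) * Z' :=
          mul_le_mul_of_nonneg_left (hzeta.sum_le_tsum _ fun _ _ => by positivity) (by positivity)
      _ = _ := by ring
  have h4 : 4 * Z ≤ 4 * Z * (X / D) := le_mul_of_one_le_right (by positivity) hXD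
  nlinarith

/-! ### Correlations of resolvent coefficients and exceptional eigenvalues -/

/-- This needs no condition on `μ`: the comparison fails for finitely many `k` only, and a vanishing
denominator contributes `0` by convention. -/
theorem summable_resolvent_sq {a b c : ℝ} (ha : 0 < a) (hb : 0 < b) (hc : 0 < c) (μ : ℝ) :
    Summable fun k : Fin 3 → ℤ => (1 / (dualNormSq a b c k - μ)) ^ 2 := by
  refine Summable.of_norm_bounded_eventually
    ((summable_inv_one_add_dualNormSq_sq ha hb hc).mul_left 4) ?_
  refine (finite_dualNormSq_le ha hb hc (2 * |μ| + 1)).subset fun k hk => ?_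
  by_contra hcon
  have hcon : 2 * |μ| + 1 < dualNormSq a b c k := not_le.mp hcon
  refine hk ?_
  have h0 := le_abs_self μ
  have h0' := abs_nonneg μ
  have h1 : (1 + dualNormSq a b c k) / 2 ≤ dualNormSq a b c k - μ := by linarith
  have h2 : 0 < 1 + dualNormSq a b c k := by linarith
  show ‖(1 / (dualNormSq a b c k - μ)) ^ 2‖ ≤ _
  rw [Real.norm_of_nonneg (sq_nonneg _)]
  have h3 : 0 < dualNormSq a b c k - μ := by linarith
  calc (1 / (dualNormSq a b c k - μ)) ^ 2 ≤ (1 / ((1 + dualNormSq a b c k) / 2)) ^ 2 := by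
        gcongr
    _ = _ := by field_simp; norm_num

/-- The normalized correlation of the Fourier coefficients of a Green's function with their
translates by `ζ`. -/
noncomputable def overlap (a b c μ : ℝ) (ζ : Fin 3 → ℤ) : ℝ :=
  (∑' k, |1 / (dualNormSq a b c k - μ) * (1 / (dualNormSq a b c (k + ζ) - μ))|) /
    ∑' k, (1 / (dualNormSq a b c k - μ)) ^ 2

/-- By `hpair`, for every `k` at least one of `k` and `k + ζ` has norm at distance more than `L`
from `μ`. Splitting accordingly and applying Cauchy-Schwarz, one factor is bounded by `√T` and the
other by the full sum. -/
theorem sum_overlap_le {a b c : ℝ} (ha : 0 < a) (hb : 0 < b) (hc : 0 < c) {μ L T : ℝ}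
    {ζ : Fin 3 → ℤ}
    (hfar : ∀ s : Finset (Fin 3 → ℤ), (∀ k ∈ s, L < |dualNormSq a b c k - μ|) →
      ∑ k ∈ s, (1 / (dualNormSq a b c k - μ)) ^ 2 ≤ T)
    (hpair : ∀ k, |dualNormSq a b c k - μ| ≤ L → L < |dualNormSq a b c (k + ζ) - μ|)
    (s : Finset (Fin 3 → ℤ)) :
    ∑ k ∈ s, |1 / (dualNormSq a b c k - μ) * (1 / (dualNormSq a b c (k + ζ) - μ))| ≤
      2 * √T * √(∑' k, (1 / (dualNormSq a b c k - μ)) ^ 2) := by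
  have hsum := summable_resolvent_sq ha hb hc μ
  set A : (Fin 3 → ℤ) → ℝ := fun k => 1 / (dualNormSq a b c k - μ) with hA
  have hS : ∀ t : Finset (Fin 3 → ℤ), ∑ k ∈ t, A k ^ 2 ≤ ∑' k, A k ^ 2 := fun t =>
    hsum.sum_le_tsum t fun _ _ => sq_nonneg _
  have hshift : ∀ t : Finset (Fin 3 → ℤ), ∑ k ∈ t, A (k + ζ) ^ 2 =
      ∑ k ∈ t.map (addRightEmbedding ζ), A k ^ 2 := fun t => by
    rw [Finset.sum_map]; rfl
  have hcs : ∀ t : Finset (Fin 3 → ℤ), ∑ k ∈ t, |A k * A (k + ζ)| ≤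
      √(∑ k ∈ t, A k ^ 2) * √(∑ k ∈ t, A (k + ζ) ^ 2) := fun t => by
    have := Real.sum_mul_le_sqrt_mul_sqrt t (fun k => |A k|) (fun k => |A (k + ζ)|)
    simpa only [abs_mul, sq_abs] using this
  rw [← Finset.sum_filter_add_sum_filter_not s (fun k => L < |dualNormSq a b c k - μ|)]
  have h1 : ∑ k ∈ s.filter (fun k => L < |dualNormSq a b c k - μ|), |A k * A (k + ζ)| ≤
      √T * √(∑' k, A k ^ 2) := by
    refine (hcs _).trans (mul_le_mul (Real.sqrt_le_sqrt ?_) (Real.sqrt_le_sqrt ?_)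
      (Real.sqrt_nonneg _) (Real.sqrt_nonneg _))
    · exact hfar _ fun k hk => (Finset.mem_filter.mp hk).2
    · rw [hshift]; exact hS _
  have h2 : ∑ k ∈ s.filter (fun k => ¬ L < |dualNormSq a b c k - μ|), |A k * A (k + ζ)| ≤
      √(∑' k, A k ^ 2) * √T := by
    refine (hcs _).trans (mul_le_mul (Real.sqrt_le_sqrt (hS _)) (Real.sqrt_le_sqrt ?_)
      (Real.sqrt_nonneg _) (Real.sqrt_nonneg _))
    rw [hshift]
    refine hfar _ fun k hk => ?_
    obtain ⟨l, hl, rfl⟩ := Finset.mem_map.mp hk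
    exact hpair l (not_lt.mp (Finset.mem_filter.mp hl).2)
  calc _ ≤ √T * √(∑' k, A k ^ 2) + √(∑' k, A k ^ 2) * √T := add_le_add h1 h2
    _ = _ := by ring

/-- The norm following `μ` alone contributes at least `1 / g²` to the denominator `S`; hence `1 / √S
≤ g`, while the numerator is at most `2 √T √S`. -/
theorem overlap_le {a b c : ℝ} (ha : 0 < a) (hb : 0 < b) (hc : 0 < c) {μ L T g : ℝ}
    {ζ : Fin 3 → ℤ} (hg : 0 < g)
    (hfar : ∀ s : Finset (Fin 3 → ℤ), (∀ k ∈ s, L < |dualNormSq a b c k - μ|) →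
      ∑ k ∈ s, (1 / (dualNormSq a b c k - μ)) ^ 2 ≤ T)
    (hpair : ∀ k, |dualNormSq a b c k - μ| ≤ L → L < |dualNormSq a b c (k + ζ) - μ|)
    (hnext : dualNormSq a b c (next a b c μ) - μ ≤ g) :
    overlap a b c μ ζ ≤ 2 * √T * g := by
  have hsum := summable_resolvent_sq ha hb hc μ
  have hpos := sub_pos.mpr (next_spec ha hb hc μ).1
  have hS : (1 / g) ^ 2 ≤ ∑' k, (1 / (dualNormSq a b c k - μ)) ^ 2 := by
    refine le_trans ?_ (hsum.le_tsum (next a b c μ) fun _ _ => sq_nonneg _)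
    gcongr
  have hS' : 1 / g ≤ √(∑' k, (1 / (dualNormSq a b c k - μ)) ^ 2) :=
    Real.le_sqrt_of_sq_le hS
  have hnum : ∑' k, |1 / (dualNormSq a b c k - μ) * (1 / (dualNormSq a b c (k + ζ) - μ))| ≤
      2 * √T * √(∑' k, (1 / (dualNormSq a b c k - μ)) ^ 2) :=
    Real.tsum_le_of_sum_le (fun _ => abs_nonneg _) (sum_overlap_le ha hb hc hfar hpair)
  rw [overlap]
  set S := ∑' k, (1 / (dualNormSq a b c k - μ)) ^ 2
  have hS0 : 0 < S := lt_of_lt_of_le (by positivity) hS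
  rw [div_le_iff₀ hS0]
  refine hnum.trans ?_
  have h1 : √S * √S = S := Real.mul_self_sqrt hS0.le
  have h2 : 1 ≤ g * √S := by
    have := mul_le_mul_of_nonneg_left hS' hg.le
    rwa [mul_one_div_cancel hg.ne'] at this
  calc 2 * √T * √S ≤ 2 * √T * √S * (g * √S) := le_mul_of_one_le_right (by positivity) h2
    _ = 2 * √T * g * (√S * √S) := by ring
    _ = _ := by rw [h1]

/-- The elements of `Λ` which have few lattice points nearby, but at least two differing by `ζ`,
are few. -/
theorem Interlaces.card_le_of_pair {a b c : ℝ} (ha : 0 < a) (hb : 0 < b) (hc : 0 < c)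
    {Λ : Set ℝ} (h : Interlaces (range (dualNormSq a b c)) Λ) {ζ : Fin 3 → ℤ} {X L W : ℝ}
    (hL : L ≤ 1) (hLX : L ≤ 3 * X) (hW0 : 0 ≤ W) {s : Finset ℝ} (hs : ↑s ⊆ Λ)
    (hsX : ∀ μ ∈ s, μ ≤ 2 * X)
    (hgap : ∀ μ ∈ s, dualNormSq a b c (next a b c μ) - μ ≤ L)
    (hW : ∀ μ ∈ s, ((near a b c μ (3 * L)).card : ℝ) ≤ W)
    (hpair : ∀ μ ∈ s, ∃ k, |dualNormSq a b c k - μ| ≤ L ∧ |dualNormSq a b c (k + ζ) - μ| ≤ L) :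
    (s.card : ℝ) ≤ W * ((ball a b c (5 * X)).filter
      (fun k => |dualNormSq a b c (k + ζ) - dualNormSq a b c k| ≤ 2)).card := by
  -- The chosen point lies in the slab. Eigenvalues sharing it are within `2L` of each other, so
  -- their following norms, at most `L` further on, belong to distinct lattice points within `3L` of
  -- any one of them.
  choose! f hf using hpair
  refine Finset.card_le_mul_card_of_fiber_le (f := f) ?_ ?_
  · intro μ hμ
    have h1 := abs_le.mp (hf μ hμ).1
    have h2 := abs_le.mp (hf μ hμ).2
    have h3 := hsX μ hμ
    rw [Finset.mem_filter, mem_ball ha hb hc, abs_le]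
    refine ⟨by linarith, by linarith, by linarith⟩
  · intro k _
    rcases (s.filter (fun μ => f μ = k)).eq_empty_or_nonempty with he | ⟨μ₀, hμ₀⟩
    · rw [he]; simpa using hW0
    rw [Finset.mem_filter] at hμ₀
    refine le_trans ?_ (hW μ₀ hμ₀.1)
    refine Nat.cast_le.mpr (Finset.card_le_card_of_injOn (next a b c) ?_ ?_)
    · intro μ hμ
      obtain ⟨hμs, rfl⟩ := Finset.mem_filter.mp hμ
      have h1 := abs_le.mp (hf μ hμs).1
      have h2 := abs_le.mp (hf μ₀ hμ₀.1).1
      rw [hμ₀.2] at h2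
      have h3 := hgap μ hμs
      have h4 := (next_spec ha hb hc μ).1
      rw [Finset.mem_coe, mem_near ha hb hc, abs_le]
      constructor <;> linarith [h1.1, h1.2, h2.1, h2.2]
    · exact (h.next_injOn ha hb hc).mono fun μ hμ => hs (Finset.mem_filter.mp hμ).1

theorem eventually_le_rpow {p : ℝ} (hp : 0 < p) (C : ℝ) : ∀ᶠ X : ℝ in atTop, C ≤ X ^ p :=
  (tendsto_rpow_atTop hp).eventually_ge_atTop C

/-- For all but a power-saving set of elements of `Λ` the overlap is small. -/
theorem exists_card_overlap_le {a b c : ℝ} (ha : 0 < a) (hb : 0 < b) (hc : 0 < c)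
    (htype : IsIrrationalOfFiniteType (b ^ 2 / a ^ 2) ∨
      IsIrrationalOfFiniteType (c ^ 2 / a ^ 2) ∨ IsIrrationalOfFiniteType (c ^ 2 / b ^ 2)) :
    ∃ δ : ℝ, 0 < δ ∧ δ ≤ 1 / 80 ∧ ∀ Λ : Set ℝ, Interlaces (range (dualNormSq a b c)) Λ →
      ∀ ζ : Fin 3 → ℤ, ζ ≠ 0 → ∃ C : ℝ, 0 < C ∧ ∀ᶠ X : ℝ in atTop, ∀ s : Finset ℝ, ↑s ⊆ Λ →
        (∀ μ ∈ s, X < μ ∧ μ ≤ 2 * X ∧ μ ^ (-(1 / 80) : ℝ) < overlap a b c μ ζ) →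
        (s.card : ℝ) ≤ C * X ^ (3 / 2 - δ) := by
  obtain ⟨κ, hκ, hκ1, hpairs⟩ := exists_card_closePairs_le ha hb hc htype
  obtain ⟨C₁, hC₁, hclose⟩ := hpairs (κ / 80) (by positivity)
  obtain ⟨C₂, hC₂, hfar⟩ := exists_sum_far_le ha hb hc
  refine ⟨κ / 80, by positivity, by linarith, fun Λ hΛ ζ hζ => ?_⟩
  obtain ⟨C₃, hC₃, hslab⟩ := exists_card_slab_le ha hb hc hζ
  set P : ℝ := C₁ * 5 ^ (κ / 80) * 25 with hP
  have hP0 : 0 < P := by positivity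
  refine ⟨3 + 2 * P + 2 * P + C₃ * 5, by positivity, ?_⟩
  -- The exponent `17/40 = 19/40 - 1/20` yields `g ≤ L`. The exponent `1/80` absorbs the constants
  -- when `X^(-1/40)` is compared with `μ^(-1/80)`.
  filter_upwards [eventually_ge_atTop (1 : ℝ), eventually_le_rpow (p := 17 / 40) (by norm_num) 4,
    eventually_le_rpow (p := 1 / 80) (by norm_num) (4 * √(16 + C₂))] with X hX hX1 hX2 s hs hsX
  have hX0 : 0 < X := by linarith
  classical
  -- Here `g` bounds the gap after `μ`, `L` and `D` are the short and long distances, and `W` and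
  -- `V` the numbers of points tolerated within `3L` and `D`. The choice gives `T = O(X^(9/10))`, so
  -- `√T · g = O(X^(-1/40))`, while every exceptional set keeps a power saving over `X^(3/2)`.
  set g : ℝ := X ^ (-(19 / 40) : ℝ) with hg
  set L : ℝ := X ^ (-(1 / 20) : ℝ) / 4 with hL
  set D : ℝ := X ^ (1 / 10 : ℝ) with hD
  set V : ℝ := X ^ (3 / 4 : ℝ) with hV
  set W : ℝ := X ^ (1 / 2 - κ / 80 : ℝ) with hW
  set N := dualNormSq a b c with hN
  have hg0 : 0 < g := by positivity
  have hL0 : 0 < L := by positivity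
  have hD1 : 1 ≤ D := Real.one_le_rpow hX (by norm_num)
  have hDX : D ≤ X := by
    calc D ≤ X ^ (1 : ℝ) := Real.rpow_le_rpow_of_exponent_le hX (by norm_num)
      _ = X := Real.rpow_one X
  have h4L : 4 * L ≤ 1 := by
    rw [hL]
    have : X ^ (-(1 / 20) : ℝ) ≤ 1 := Real.rpow_le_one_of_one_le_of_nonpos hX (by norm_num)
    linarith
  have hgL : g ≤ L := by
    have : X ^ (-(1 / 20) : ℝ) = g * X ^ (17 / 40 : ℝ) := by
      rw [hg, ← Real.rpow_add hX0]; norm_num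
    rw [hL, this]
    nlinarith
  have hpow : ∀ p q : ℝ, p ≤ q → X ^ p ≤ X ^ q := fun p q hpq =>
    Real.rpow_le_rpow_of_exponent_le hX hpq
  -- the exceptional sets
  set s₁ := s.filter (fun μ => g < N (next a b c μ) - μ) with hs₁
  set s₂ := s.filter (fun μ => N (next a b c μ) - μ ≤ g ∧ V < (near a b c μ D).card) with hs₂
  set s₃ := s.filter (fun μ => N (next a b c μ) - μ ≤ g ∧ W < (near a b c μ (3 * L)).card) with hs₃
  set s₄ := s.filter (fun μ => N (next a b c μ) - μ ≤ g ∧ ((near a b c μ (3 * L)).card : ℝ) ≤ W ∧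
    ∃ k, |N k - μ| ≤ L ∧ |N (k + ζ) - μ| ≤ L) with hs₄
  have hcover : s ⊆ s₁ ∪ (s₂ ∪ (s₃ ∪ s₄)) := by
    intro μ hμ
    by_contra hcon
    simp only [hs₁, hs₂, hs₃, hs₄, Finset.mem_union, Finset.mem_filter, hμ, true_and, not_or,
      not_and, not_lt, not_exists, not_le] at hcon
    obtain ⟨n1, n2, n3, n4⟩ := hcon
    have n2 := n2 n1
    have n4 := n4 n1 (n3 n1)
    obtain ⟨hμX, hμ2X, hμov⟩ := hsX μ hμ
    -- The constant in `T` collects two ranges: at most `V` points between `L` and `D`, each with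
    -- `(1/L)² = 16 X^(1/10)`, and the points beyond `D`, with total `C₂ X / D`.
    have hov := overlap_le ha hb hc (L := L) (T := (16 + C₂) * X ^ (9 / 10 : ℝ)) (ζ := ζ) hg0
      (fun t ht => ?_) (fun k hk => n4 k hk) n1
    · have e1 : 2 * √((16 + C₂) * X ^ (9 / 10 : ℝ)) * g =
          2 * √(16 + C₂) * X ^ (-(1 / 40) : ℝ) := by
        rw [Real.sqrt_mul (by positivity), Real.sqrt_eq_rpow (X ^ (9 / 10 : ℝ)),
          ← Real.rpow_mul hX0.le, mul_assoc, mul_assoc, mul_assoc, hg, ← Real.rpow_add hX0]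
        norm_num
      have e2 : (2 * X) ^ (-(1 / 80) : ℝ) ≤ μ ^ (-(1 / 80) : ℝ) :=
        Real.rpow_le_rpow_of_nonpos (by linarith) hμ2X (by norm_num)
      have e3 : X ^ (-(1 / 80) : ℝ) / 2 ≤ (2 * X) ^ (-(1 / 80) : ℝ) := by
        rw [Real.mul_rpow (by norm_num) hX0.le, div_eq_inv_mul]
        gcongr
        calc (2 : ℝ)⁻¹ = 2 ^ (-1 : ℝ) := by rw [Real.rpow_neg_one]
          _ ≤ 2 ^ (-(1 / 80) : ℝ) :=
            Real.rpow_le_rpow_of_exponent_le (by norm_num) (by norm_num)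
      have e4 : 4 * √(16 + C₂) * X ^ (-(1 / 40) : ℝ) ≤ X ^ (-(1 / 80) : ℝ) := by
        calc _ ≤ X ^ (1 / 80 : ℝ) * X ^ (-(1 / 40) : ℝ) := by gcongr
          _ = _ := by rw [← Real.rpow_add hX0]; norm_num
      linarith
    · rw [← Finset.sum_filter_add_sum_filter_not t (fun k => |N k - μ| ≤ D)]
      have t1 : ∑ k ∈ t.filter (fun k => |N k - μ| ≤ D), (1 / (N k - μ)) ^ 2 ≤
          16 * X ^ (9 / 10 : ℝ) := by
        calc _ ≤ ∑ k ∈ t.filter (fun k => |N k - μ| ≤ D), (1 / L) ^ 2 := by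
              refine Finset.sum_le_sum fun k hk => ?_
              rw [← sq_abs (1 / (N k - μ)), abs_div, abs_one]
              have := ht k (Finset.mem_filter.mp hk).1
              gcongr
          _ = (t.filter (fun k => |N k - μ| ≤ D)).card * (1 / L) ^ 2 := by
              rw [Finset.sum_const, nsmul_eq_mul]
          _ ≤ V * (1 / L) ^ 2 := by
              gcongr
              refine le_trans (Nat.cast_le.mpr (Finset.card_le_card fun k hk => ?_)) n2
              exact (mem_near ha hb hc).mpr (Finset.mem_filter.mp hk).2
          _ = 16 * X ^ (17 / 20 : ℝ) := by
              have : (1 / L) ^ 2 = 16 * X ^ (1 / 10 : ℝ) := by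
                rw [hL, one_div_div, div_pow, ← Real.rpow_natCast (X ^ (-(1 / 20) : ℝ)),
                  ← Real.rpow_mul hX0.le, div_eq_mul_inv, ← Real.rpow_neg hX0.le]
                norm_num
              rw [this, hV, mul_left_comm, ← Real.rpow_add hX0]; norm_num
          _ ≤ _ := by gcongr 16 * ?_; exact hpow _ _ (by norm_num)
      have t2 : ∑ k ∈ t.filter (fun k => ¬ |N k - μ| ≤ D), (1 / (N k - μ)) ^ 2 ≤
          C₂ * X ^ (9 / 10 : ℝ) := by
        refine (hfar X hX D hD1 hDX μ hμ2X _ fun k hk =>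
          not_le.mp (Finset.mem_filter.mp hk).2).trans (le_of_eq ?_)
        congr 1
        conv_lhs => rw [← Real.rpow_one X, hD, Real.rpow_one]
        rw [div_eq_mul_inv, ← Real.rpow_neg hX0.le]
        nth_rewrite 1 [← Real.rpow_one X]
        rw [← Real.rpow_add hX0]; norm_num
      calc _ ≤ 16 * X ^ (9 / 10 : ℝ) + C₂ * X ^ (9 / 10 : ℝ) := add_le_add t1 t2
        _ = _ := by ring
  have hsub : ∀ {t : Finset ℝ}, t ⊆ s → (↑t : Set ℝ) ⊆ Λ := fun ht =>
    (Finset.coe_subset.mpr ht).trans hs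
  have h5ε : (5 * X) ^ (κ / 80) = 5 ^ (κ / 80) * X ^ (κ / 80) :=
    Real.mul_rpow (by norm_num) hX0.le
  have b₁ : (s₁.card : ℝ) ≤ 3 * X ^ (3 / 2 - κ / 80) := by
    have h0 := hΛ.card_le_of_gap ha hb hc (s := s₁) hg0 hX0.le (hsub (Finset.filter_subset _ _))
      (fun μ hμ => by
        have := hsX μ (Finset.mem_filter.mp hμ).1
        exact ⟨this.1, this.2.1⟩) (fun μ hμ => (Finset.mem_filter.mp hμ).2)
    have h1 : X / g ≤ X ^ (3 / 2 - κ / 80) := by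
      rw [hg, div_eq_mul_inv, ← Real.rpow_neg hX0.le]
      nth_rewrite 1 [← Real.rpow_one X]
      rw [← Real.rpow_add hX0]
      exact hpow _ _ (by linarith)
    have h2 : 1 ≤ X ^ (3 / 2 - κ / 80) := Real.one_le_rpow hX (by linarith)
    linarith
  -- The trivial pair count `X^(2 + κ/80) D` divided by `V` has exponent `27/20 + κ/80`, below `3/2
  -- - κ/80`.
  have b₂ : (s₂.card : ℝ) ≤ 2 * P * X ^ (3 / 2 - κ / 80) := by
    have h0 := hΛ.card_mul_le_closePairs ha hb hc (s := s₂) (X := 2 * X) (D := D) (g := g) (W := V)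
      (Y := 5 * X) (hsub (Finset.filter_subset _ _))
      (fun μ hμ => (hsX μ (Finset.mem_filter.mp hμ).1).2.1)
      (fun μ hμ => (Finset.mem_filter.mp hμ).2.1) (fun μ hμ => (Finset.mem_filter.mp hμ).2.2)
      (by linarith) (by linarith)
    have h1 := (hclose (5 * X) (by linarith)).1 (D + g) (by linarith)
    have hV0 : 0 < V := by positivity
    refine le_of_mul_le_mul_left (h0.trans (h1.trans ?_)) hV0
    calc C₁ * (5 * X) ^ (κ / 80) * (5 * X) ^ 2 * (D + g)
        ≤ C₁ * (5 * X) ^ (κ / 80) * (5 * X) ^ 2 * (2 * D) := by gcongr; linarith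
      _ = 2 * P * (X ^ (κ / 80) * X ^ (2 : ℝ) * X ^ (1 / 10 : ℝ)) := by
          rw [h5ε, Real.rpow_two, hP, hD]; ring
      _ ≤ 2 * P * (X ^ (3 / 4 : ℝ) * X ^ (3 / 2 - κ / 80)) := by
          rw [← Real.rpow_add hX0, ← Real.rpow_add hX0, ← Real.rpow_add hX0]
          gcongr 2 * P * ?_
          exact hpow _ _ (by linarith)
      _ = _ := by rw [hV]; ring
  -- This is where finite type enters: at distance `4L = X^(-1/20)` the pair count saves `X^(κ/20)`,
  -- enough to pay for both the divisor loss `X^(κ/80)` and the factor `X^(κ/80)` by which `W` falls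
  -- short of `X^(1/2)`.
  have b₃ : (s₃.card : ℝ) ≤ 2 * P * X ^ (3 / 2 - κ / 80) := by
    have h0 := hΛ.card_mul_le_closePairs ha hb hc (s := s₃) (X := 2 * X) (D := 3 * L) (g := g)
      (W := W) (Y := 5 * X) (hsub (Finset.filter_subset _ _))
      (fun μ hμ => (hsX μ (Finset.mem_filter.mp hμ).1).2.1)
      (fun μ hμ => (Finset.mem_filter.mp hμ).2.1) (fun μ hμ => (Finset.mem_filter.mp hμ).2.2)
      (by linarith) (by linarith)
    have h1 := (hclose (5 * X) (by linarith)).2 (3 * L + g) (by linarith) (by linarith)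
    have hW0 : 0 < W := by positivity
    have h2 : (3 * L + g) ^ κ ≤ X ^ (-(κ / 20)) := by
      calc (3 * L + g) ^ κ ≤ (4 * L) ^ κ :=
            Real.rpow_le_rpow (by positivity) (by linarith) hκ.le
        _ = X ^ (-(κ / 20)) := by
          have : 4 * L = X ^ (-(1 / 20) : ℝ) := by rw [hL]; ring
          rw [this, ← Real.rpow_mul hX0.le]; congr 1; ring
    have h3 : (5 * X) ^ (3 / 2 : ℝ) ≤ 25 * X ^ (2 - κ / 20) := by
      rw [Real.mul_rpow (by norm_num) hX0.le]
      have : (5 : ℝ) ^ (3 / 2 : ℝ) ≤ 25 := by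
        calc (5 : ℝ) ^ (3 / 2 : ℝ) ≤ 5 ^ (2 : ℝ) :=
              Real.rpow_le_rpow_of_exponent_le (by norm_num) (by norm_num)
          _ = 25 := by norm_num
      have := hpow (3 / 2) (2 - κ / 20) (by linarith)
      gcongr
    refine le_of_mul_le_mul_left (h0.trans (h1.trans ?_)) hW0
    calc C₁ * (5 * X) ^ (κ / 80) * ((5 * X) ^ 2 * (3 * L + g) ^ κ + (5 * X) ^ (3 / 2 : ℝ))
        ≤ C₁ * (5 * X) ^ (κ / 80) * ((5 * X) ^ 2 * X ^ (-(κ / 20)) + 25 * X ^ (2 - κ / 20)) := by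
          gcongr
      _ = 2 * P * (X ^ (κ / 80) * X ^ (2 - κ / 20)) := by
          have : X ^ (2 - κ / 20) = X ^ 2 * X ^ (-(κ / 20)) := by
            rw [sub_eq_add_neg, Real.rpow_add hX0, Real.rpow_two]
          rw [h5ε, hP, this]; ring
      _ ≤ 2 * P * (X ^ (1 / 2 - κ / 80) * X ^ (3 / 2 - κ / 80)) := by
          rw [← Real.rpow_add hX0, ← Real.rpow_add hX0]
          gcongr 2 * P * ?_
          exact hpow _ _ (by linarith)
      _ = _ := by rw [hW]; ring
  -- The slab has `O(X)` points, each serving at most `W` eigenvalues; the saving is the one built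
  -- into `W`.
  have b₄ : (s₄.card : ℝ) ≤ C₃ * 5 * X ^ (3 / 2 - κ / 80) := by
    have hW0 : 0 ≤ W := by positivity
    have h0 := hΛ.card_le_of_pair ha hb hc (s := s₄) (ζ := ζ) (X := X) (L := L) (W := W)
      (by linarith) (by linarith) hW0 (hsub (Finset.filter_subset _ _))
      (fun μ hμ => (hsX μ (Finset.mem_filter.mp hμ).1).2.1)
      (fun μ hμ => (Finset.mem_filter.mp hμ).2.1.trans hgL)
      (fun μ hμ => (Finset.mem_filter.mp hμ).2.2.1) (fun μ hμ => (Finset.mem_filter.mp hμ).2.2.2)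
    refine h0.trans ?_
    calc _ ≤ W * (C₃ * (5 * X)) := mul_le_mul_of_nonneg_left (hslab (5 * X) (by linarith)) hW0
      _ = C₃ * 5 * (W * X ^ (1 : ℝ)) := by rw [Real.rpow_one]; ring
      _ = _ := by rw [hW, ← Real.rpow_add hX0]; congr 2; ring
  have hcard : (s.card : ℝ) ≤ s₁.card + (s₂.card + (s₃.card + s₄.card)) := by
    have h1 := (Finset.card_le_card hcover).trans (Finset.card_union_le _ _)
    have h2 := Finset.card_union_le s₂ (s₃ ∪ s₄)
    have h3 := Finset.card_union_le s₃ s₄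
    exact_mod_cast h1.trans (by omega)
  nlinarith

/-- If countably many subsets of `Λ` have power-saving counting functions, then a subset of density
one of `Λ` eventually avoids each of them. -/
theorem exists_density_one_subset {Λ : Set ℝ} (hfin : ∀ X, (Λ ∩ Iic X).Finite) {p r c : ℝ}
    (hpr : p < r) (hc : 0 < c) (hlow : ∀ᶠ X : ℝ in atTop, c * X ^ r ≤ (Λ ∩ Iic X).ncard)
    (B : ℕ → Set ℝ) (hB : ∀ j, B j ⊆ Λ)
    (hcount : ∀ j, ∃ C : ℝ, ∀ᶠ X : ℝ in atTop, ((B j ∩ Iic X).ncard : ℝ) ≤ C * X ^ p) :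
    ∃ S ⊆ Λ, HasDensityIn S Λ 1 ∧ ∀ j, ∃ T, ∀ μ ∈ S, T ≤ μ → μ ∉ B j := by
  set q := (p + r) / 2 with hq
  -- Each `B j` is discarded only beyond a threshold `T j` after which its count is below `2^(-j)
  -- X^q`. These bounds sum over `j`, and `T j ≥ j` leaves finitely many `j` relevant below a given
  -- `X`.
  have hT : ∀ j : ℕ, ∃ T : ℝ, (j : ℝ) ≤ T ∧ ∀ X, T ≤ X →
      ((B j ∩ Iic X).ncard : ℝ) ≤ (1 / 2) ^ j * X ^ q := by
    intro j
    obtain ⟨C, hC⟩ := hcount j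
    have hev : ∀ᶠ X : ℝ in atTop, ((B j ∩ Iic X).ncard : ℝ) ≤ (1 / 2) ^ j * X ^ q := by
      filter_upwards [hC, eventually_gt_atTop (0 : ℝ),
        eventually_le_rpow (p := q - p) (by rw [hq]; linarith) (C * 2 ^ j)] with X h1 hX h2
      have h3 : C ≤ (1 / 2) ^ j * X ^ (q - p) := by
        calc C = (1 / 2) ^ j * (C * 2 ^ j) := by
              rw [mul_left_comm, ← mul_pow]; norm_num
          _ ≤ _ := by gcongr
      calc _ ≤ C * X ^ p := h1
        _ ≤ (1 / 2) ^ j * X ^ (q - p) * X ^ p := by gcongr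
        _ = _ := by rw [mul_assoc, ← Real.rpow_add hX]; congr 2; ring
    obtain ⟨T, hT⟩ := eventually_atTop.mp hev
    exact ⟨max T j, le_max_right _ _, fun X hX => hT X ((le_max_left _ _).trans hX)⟩
  choose T hTj hTB using hT
  set bad : Set ℝ := ⋃ j, B j ∩ Ici (T j) with hbad
  have hbadΛ : bad ⊆ Λ := iUnion_subset fun j => inter_subset_left.trans (hB j)
  refine ⟨Λ \ bad, sdiff_subset, ?_, fun j => ⟨T j, fun μ hμ hTμ hBμ => hμ.2 ?_⟩⟩
  swap
  · exact mem_iUnion.mpr ⟨j, hBμ, hTμ⟩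
  have hbadcount : ∀ X : ℝ, 0 ≤ X → ((bad ∩ Iic X).ncard : ℝ) ≤ 2 * X ^ q := by
    intro X hX
    have hsub : bad ∩ Iic X ⊆
        ⋃ j ∈ (Finset.range (⌊X⌋₊ + 1)).filter (fun j => T j ≤ X), B j ∩ Iic X := by
      rintro μ ⟨hμ, hμX⟩
      obtain ⟨j, hj, hTμ⟩ := mem_iUnion.mp hμ
      have hTX : T j ≤ X := le_trans hTμ hμX
      refine mem_biUnion (Finset.mem_coe.mpr (Finset.mem_filter.mpr ⟨?_, hTX⟩)) ⟨hj, hμX⟩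
      rw [Finset.mem_range, Nat.lt_add_one_iff]
      exact Nat.le_floor ((hTj j).trans hTX)
    have hfinU : (⋃ j ∈ (Finset.range (⌊X⌋₊ + 1)).filter (fun j => T j ≤ X),
        B j ∩ Iic X).Finite :=
      (hfin X).subset (iUnion₂_subset fun j _ => inter_subset_inter_left _ (hB j))
    have h1 := (ncard_le_ncard hsub hfinU).trans (Finset.set_ncard_biUnion_le _ _)
    calc ((bad ∩ Iic X).ncard : ℝ)
        ≤ ∑ j ∈ (Finset.range (⌊X⌋₊ + 1)).filter (fun j => T j ≤ X),
            ((B j ∩ Iic X).ncard : ℝ) := by exact_mod_cast h1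
      _ ≤ ∑ j ∈ (Finset.range (⌊X⌋₊ + 1)).filter (fun j => T j ≤ X), (1 / 2) ^ j * X ^ q :=
          Finset.sum_le_sum fun j hj => hTB j X (Finset.mem_filter.mp hj).2
      _ = (∑ j ∈ (Finset.range (⌊X⌋₊ + 1)).filter (fun j => T j ≤ X), (1 / 2 : ℝ) ^ j) * X ^ q := by
          rw [Finset.sum_mul]
      _ ≤ 2 * X ^ q := by
          gcongr
          exact (summable_geometric_two.sum_le_tsum _ fun _ _ => by positivity).trans_eq
            tsum_geometric_two
  have hratio : Tendsto (fun X : ℝ => ((bad ∩ Iic X).ncard : ℝ) / (Λ ∩ Iic X).ncard) atTop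
      (𝓝 0) := by
    have hlim : Tendsto (fun X : ℝ => 2 / c * X ^ (-(r - q))) atTop (𝓝 0) := by
      simpa using (tendsto_rpow_neg_atTop (show 0 < r - q by rw [hq]; linarith)).const_mul (2 / c)
    refine squeeze_zero' (Eventually.of_forall fun X => by positivity) ?_ hlim
    filter_upwards [hlow, eventually_gt_atTop (0 : ℝ)] with X h1 hX
    have hXr : 0 < X ^ r := by positivity
    calc _ ≤ (2 * X ^ q) / (c * X ^ r) := by
          gcongr
          exact hbadcount X hX.le
      _ = _ := by
          rw [neg_sub, Real.rpow_sub hX]; field_simp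
  have hone : Tendsto (fun X : ℝ => 1 - ((bad ∩ Iic X).ncard : ℝ) / (Λ ∩ Iic X).ncard) atTop
      (𝓝 1) := by simpa using hratio.const_sub 1
  refine hone.congr' ?_
  filter_upwards [hlow, eventually_gt_atTop (0 : ℝ)] with X h1 hX
  have hpos : 0 < ((Λ ∩ Iic X).ncard : ℝ) := lt_of_lt_of_le (by positivity) h1
  have heq : (Λ \ bad) ∩ Iic X = (Λ ∩ Iic X) \ (bad ∩ Iic X) := by
    ext μ; simp only [mem_inter_iff, Set.mem_sdiff, mem_Iic]; tauto
  have hsub : bad ∩ Iic X ⊆ Λ ∩ Iic X := inter_subset_inter_left _ hbadΛ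
  rw [heq, ncard_sdiff hsub ((hfin X).subset hsub),
    Nat.cast_sub (ncard_le_ncard hsub (hfin X)), sub_div, div_self hpos.ne']

/-- Dyadic summation of counting functions. -/
theorem exists_ncard_le_of_dyadic {B : Set ℝ} (hfin : ∀ X, (B ∩ Iic X).Finite) {p C : ℝ}
    (hp : 1 ≤ p) (hC : 0 ≤ C)
    (h : ∀ᶠ X : ℝ in atTop, ((B ∩ Ioc X (2 * X)).ncard : ℝ) ≤ C * X ^ p) :
    ∃ C' : ℝ, ∀ᶠ X : ℝ in atTop, ((B ∩ Iic X).ncard : ℝ) ≤ C' * X ^ p := by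
  obtain ⟨X₀, hX₀⟩ := eventually_atTop.mp h
  set X₁ := max X₀ 1 with hX₁
  have hX₁1 : 1 ≤ X₁ := le_max_right _ _
  set K : ℝ := ((B ∩ Iic (2 * X₁)).ncard : ℝ) with hK
  have key : ∀ n : ℕ, ∀ X : ℝ, X₁ ≤ X → X ≤ 2 ^ n * (2 * X₁) →
      ((B ∩ Iic X).ncard : ℝ) ≤ K + C * X ^ p := by
    intro n
    induction n with
    | zero =>
      intro X hX1 hX2
      rw [pow_zero, one_mul] at hX2
      have : ((B ∩ Iic X).ncard : ℝ) ≤ K := Nat.cast_le.mpr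
        (ncard_le_ncard (inter_subset_inter_right _ (Iic_subset_Iic.mpr hX2)) (hfin _))
      have : 0 ≤ C * X ^ p := by have : 0 ≤ X := by linarith
                                 positivity
      linarith
    | succ n ih =>
      intro X hX1 hX2
      have hXpos : 0 < X := by linarith
      by_cases hX : X ≤ 2 * X₁
      · have : ((B ∩ Iic X).ncard : ℝ) ≤ K := Nat.cast_le.mpr
          (ncard_le_ncard (inter_subset_inter_right _ (Iic_subset_Iic.mpr hX)) (hfin _))
        have : 0 ≤ C * X ^ p := by positivity
        linarith
      · push Not at hX
        have h1 := ih (X / 2) (by linarith) (by rw [pow_succ] at hX2; linarith)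
        have h2 := hX₀ (X / 2) (by linarith [le_max_left X₀ 1])
        have hunion : B ∩ Iic X = (B ∩ Iic (X / 2)) ∪ (B ∩ Ioc (X / 2) (2 * (X / 2))) := by
          rw [← inter_union_distrib_left, Iic_union_Ioc_eq_Iic (by linarith)]
          congr 2; ring
        have h3 : ((B ∩ Iic X).ncard : ℝ) ≤
            (B ∩ Iic (X / 2)).ncard + (B ∩ Ioc (X / 2) (2 * (X / 2))).ncard := by
          rw [hunion]; exact_mod_cast ncard_union_le _ _
        -- With `p ≥ 1` the lower half and the dyadic block together cost at most `C X^p`, so the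
        -- induction closes with an unchanged constant.
        have h4 : 2 * (X / 2) ^ p ≤ X ^ p := by
          rw [Real.div_rpow hXpos.le (by norm_num), mul_div_assoc', div_le_iff₀ (by positivity),
            mul_comm]
          gcongr
          calc (2 : ℝ) = 2 ^ (1 : ℝ) := (Real.rpow_one 2).symm
            _ ≤ 2 ^ p := Real.rpow_le_rpow_of_exponent_le (by norm_num) hp
        nlinarith
  refine ⟨K + C, ?_⟩
  filter_upwards [eventually_ge_atTop X₁] with X hX
  obtain ⟨n, hn⟩ := pow_unbounded_of_one_lt (X / (2 * X₁)) (one_lt_two (α := ℝ))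
  have h1 := key n X hX (by
    rw [div_lt_iff₀ (by linarith)] at hn; exact hn.le)
  have h2 : 1 ≤ X ^ p := Real.one_le_rpow (by linarith) (by linarith)
  have hK0 : 0 ≤ K := Nat.cast_nonneg _
  nlinarith

/-- Independence over `ℚ` recovers the integers `kᵢ²` from the norm, and nonnegativity removes the
signs. Without it, multiplicities could leave too few eigenvalues for a density statement. -/
theorem dualNormSq_injOn {a b c : ℝ}
    (hind : LinearIndependent ℚ ![1 / a ^ 2, 1 / b ^ 2, 1 / c ^ 2]) :
    InjOn (dualNormSq a b c) {k | ∀ i, 0 ≤ k i} := by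
  intro k hk l hl h
  have h1 : ∑ i, ((k i ^ 2 - l i ^ 2 : ℤ) : ℚ) • weight a b c i = 0 := by
    rw [dualNormSq_eq_sum, dualNormSq_eq_sum, ← sub_eq_zero, ← Finset.sum_sub_distrib] at h
    rw [← h]
    refine Finset.sum_congr rfl fun i _ => ?_
    rw [Rat.smul_def]; push_cast; ring
  have h2 := Fintype.linearIndependent_iff.mp hind _ h1
  funext i
  have h3 : k i ^ 2 - l i ^ 2 = 0 := by exact_mod_cast h2 i
  have h4 : k i ^ 2 = l i ^ 2 := by linarith
  exact (pow_left_inj₀ (hk i) (hl i) two_ne_zero).mp h4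

/-- The cube `[1, m]³` with `m` about `√(X/w)` consists of points of norm at most `X`. Their norms
are distinct, and each has an element of `Λ` directly below it, above all smaller norms, so these
elements are distinct too. -/
theorem Interlaces.exists_card_ge {a b c : ℝ} (ha : 0 < a) (hb : 0 < b) (hc : 0 < c)
    (hind : LinearIndependent ℚ ![1 / a ^ 2, 1 / b ^ 2, 1 / c ^ 2]) {Λ : Set ℝ}
    (h : Interlaces (range (dualNormSq a b c)) Λ) :
    ∃ C : ℝ, 0 < C ∧ ∀ᶠ X : ℝ in atTop, C * X ^ (3 / 2 : ℝ) ≤ (Λ ∩ Iic X).ncard := by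
  set w := ∑ i, weight a b c i with hw
  have hw0 : 0 < w := Finset.sum_pos (fun i _ => weight_pos ha hb hc i) Finset.univ_nonempty
  set β : ℝ := √(1 / w) with hβ
  have hβ0 : 0 < β := Real.sqrt_pos.mpr (by positivity)
  refine ⟨(β / 2) ^ 3, by positivity, ?_⟩
  filter_upwards [eventually_gt_atTop (0 : ℝ), eventually_le_rpow (p := 1 / 2) (by norm_num)
    (2 / β)] with X hX hX2
  set m : ℕ := ⌊β * √X⌋₊ with hm
  have hmle : (m : ℝ) ≤ β * √X := Nat.floor_le (by positivity)
  have hmge : β / 2 * √X ≤ m := by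
    have h1 := Nat.lt_floor_add_one (β * √X)
    rw [← Real.sqrt_eq_rpow, div_le_iff₀ hβ0] at hX2
    rw [← hm] at h1
    linarith
  have hm2 : (m : ℝ) ^ 2 * w ≤ X := by
    calc (m : ℝ) ^ 2 * w ≤ (β * √X) ^ 2 * w := by gcongr
      _ = X := by
        rw [mul_pow, hβ, Real.sq_sqrt (by positivity), Real.sq_sqrt hX.le]; field_simp
  set s : Finset (Fin 3 → ℤ) := Fintype.piFinset fun _ => Finset.Icc (1 : ℤ) m with hs
  have hmem : ∀ k ∈ s, ∀ i, 1 ≤ k i ∧ k i ≤ m := fun k hk i =>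
    Finset.mem_Icc.mp (Fintype.mem_piFinset.mp hk i)
  have hpos : ∀ k ∈ s, 0 < dualNormSq a b c k := by
    intro k hk
    have := (hmem k hk 0).1
    have h0 : (0 : ℝ) < k 0 := by exact_mod_cast this
    unfold dualNormSq; positivity
  have hleX : ∀ k ∈ s, dualNormSq a b c k ≤ X := by
    intro k hk
    rw [dualNormSq_eq_sum]
    refine le_trans ?_ hm2
    rw [hw, Finset.mul_sum]
    refine Finset.sum_le_sum fun i _ => ?_
    have h1 : (0 : ℝ) ≤ k i := by exact_mod_cast (zero_le_one.trans (hmem k hk i).1)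
    have h2 : (k i : ℝ) ≤ m := by exact_mod_cast (hmem k hk i).2
    have := (weight_pos ha hb hc i).le
    rw [mul_comm]
    gcongr
  have hex : ∀ k ∈ s, ∃ μ ∈ Λ, μ < dualNormSq a b c k ∧
      ∀ l, dualNormSq a b c l < dualNormSq a b c k → dualNormSq a b c l < μ := by
    intro k hk
    obtain ⟨μ, h1, h2, h3⟩ := h.exists_below _ ⟨k, rfl⟩ (hpos k hk)
    exact ⟨μ, h1, h2, fun l hl => h3 _ ⟨l, rfl⟩ hl⟩
  choose! f hfΛ hflt hfgap using hex
  have hinj : InjOn f s := by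
    have key : ∀ k ∈ s, ∀ l ∈ s, dualNormSq a b c k < dualNormSq a b c l → f k ≠ f l := by
      intro k hk l hl hkl heq
      have h1 := hfgap l hl k hkl
      have h2 := hflt k hk
      linarith
    intro k hk l hl heq
    refine dualNormSq_injOn hind (fun i => zero_le_one.trans (hmem k hk i).1)
      (fun i => zero_le_one.trans (hmem l hl i).1) ?_
    by_contra hne
    rcases lt_or_gt_of_ne hne with hlt | hlt
    · exact key k hk l hl hlt heq
    · exact key l hl k hk hlt heq.symm
  have hcard : s.card ≤ (Λ ∩ Iic X).ncard := by
    rw [← ncard_coe_finset]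
    exact ncard_le_ncard_of_injOn f (fun k hk => ⟨hfΛ k hk, (hflt k hk).le.trans (hleX k hk)⟩)
      hinj (h.finite_inter_Iic ha hb hc X)
  have hcs : s.card = m ^ 3 := by
    rw [hs, Fintype.card_piFinset]; simp
  rw [hcs] at hcard
  calc (β / 2) ^ 3 * X ^ (3 / 2 : ℝ) = (β / 2 * √X) ^ 3 := by
        rw [mul_pow, Real.sqrt_eq_rpow, ← Real.rpow_natCast (X ^ (1 / 2 : ℝ)),
          ← Real.rpow_mul hX.le]; norm_num
    _ ≤ (m : ℝ) ^ 3 := by gcongr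
    _ ≤ _ := by exact_mod_cast hcard

theorem overlap_nonneg (a b c μ : ℝ) (ζ : Fin 3 → ℤ) : 0 ≤ overlap a b c μ ζ :=
  div_nonneg (tsum_nonneg fun _ => abs_nonneg _) (tsum_nonneg fun _ => sq_nonneg _)

/-- Along a subset of density one all overlaps tend to zero. -/
theorem Interlaces.exists_density_one {a b c : ℝ} (ha : 0 < a) (hb : 0 < b) (hc : 0 < c)
    (hind : LinearIndependent ℚ ![1 / a ^ 2, 1 / b ^ 2, 1 / c ^ 2])
    (htype : IsIrrationalOfFiniteType (b ^ 2 / a ^ 2) ∨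
      IsIrrationalOfFiniteType (c ^ 2 / a ^ 2) ∨ IsIrrationalOfFiniteType (c ^ 2 / b ^ 2))
    {Λ : Set ℝ} (h : Interlaces (range (dualNormSq a b c)) Λ) :
    ∃ S ⊆ Λ, HasDensityIn S Λ 1 ∧ ∀ ζ : Fin 3 → ℤ, ζ ≠ 0 →
      Tendsto (fun μ => overlap a b c μ ζ) (atTop ⊓ 𝓟 S) (𝓝 0) := by
  obtain ⟨δ, hδ, hδ1, hover⟩ := exists_card_overlap_le ha hb hc htype
  obtain ⟨C₀, hC₀, hlow⟩ := h.exists_card_ge ha hb hc hind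
  have hfin := h.finite_inter_Iic ha hb hc
  obtain ⟨e, he⟩ := exists_surjective_nat (Fin 3 → ℤ)
  -- The vector `ζ = 0` is excluded, its overlap being identically one.
  set B : ℕ → Set ℝ := fun j =>
    {μ | μ ∈ Λ ∧ e j ≠ 0 ∧ μ ^ (-(1 / 80) : ℝ) < overlap a b c μ (e j)} with hB
  have hcount : ∀ j, ∃ C : ℝ, ∀ᶠ X : ℝ in atTop,
      ((B j ∩ Iic X).ncard : ℝ) ≤ C * X ^ (3 / 2 - δ) := by
    intro j
    have hBfin : ∀ X, (B j ∩ Iic X).Finite := fun X =>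
      (hfin X).subset (inter_subset_inter_left _ fun μ hμ => hμ.1)
    by_cases hj : e j = 0
    · refine ⟨0, Eventually.of_forall fun X => ?_⟩
      have : B j = ∅ := by
        ext μ; simp [hB, hj]
      rw [this]; simp
    · obtain ⟨C, hC, hCX⟩ := hover Λ h (e j) hj
      refine exists_ncard_le_of_dyadic hBfin (by linarith) hC.le ?_
      filter_upwards [hCX] with X hX
      have hf : (B j ∩ Ioc X (2 * X)).Finite :=
        (hBfin (2 * X)).subset (inter_subset_inter_right _ Ioc_subset_Iic_self)
      rw [ncard_eq_toFinset_card _ hf]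
      refine hX _ (fun μ hμ => ?_) (fun μ hμ => ?_)
      · exact ((hf.mem_toFinset.mp hμ).1).1
      · have := hf.mem_toFinset.mp hμ
        exact ⟨this.2.1, this.2.2, this.1.2.2⟩
  obtain ⟨S, hSΛ, hS, hSB⟩ := exists_density_one_subset hfin (p := 3 / 2 - δ) (by linarith) hC₀
    hlow B (fun j μ hμ => hμ.1) hcount
  refine ⟨S, hSΛ, hS, fun ζ hζ => ?_⟩
  obtain ⟨j, rfl⟩ := he ζ
  obtain ⟨T, hT⟩ := hSB j
  have hlim : Tendsto (fun μ : ℝ => μ ^ (-(1 / 80) : ℝ)) (atTop ⊓ 𝓟 S) (𝓝 0) :=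
    (tendsto_rpow_neg_atTop (by norm_num)).mono_left inf_le_left
  refine squeeze_zero' (Eventually.of_forall fun μ => overlap_nonneg _ _ _ _ _) ?_ hlim
  rw [eventually_inf_principal]
  filter_upwards [eventually_ge_atTop T] with μ hμ hμS
  by_contra hcon
  exact hT μ hμS hμ ⟨hSΛ hμS, hζ, not_le.mp hcon⟩

/-! ### The resolvent sum and its level sets -/

/-- The resolvent sum `∑ (1 / (|ξ|² - μ) - 1 / (|ξ|² + 1))`. -/
noncomputable def resolventSum (a b c μ : ℝ) : ℝ :=
  ∑' k, (1 / (dualNormSq a b c k - μ) - 1 / (dualNormSq a b c k + 1))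

theorem summable_resolvent_mul {a b c : ℝ} (ha : 0 < a) (hb : 0 < b) (hc : 0 < c) (μ : ℝ) :
    Summable fun k => |1 / (dualNormSq a b c k - μ)| * (1 / (dualNormSq a b c k + 1)) := by
  refine Summable.of_nonneg_of_le (fun k => ?_) (fun k => ?_)
    ((summable_resolvent_sq ha hb hc μ).add (summable_inv_one_add_dualNormSq_sq ha hb hc))
  · have := dualNormSq_nonneg a b c k
    positivity
  · have h1 := two_mul_le_add_sq |1 / (dualNormSq a b c k - μ)| (1 / (dualNormSq a b c k + 1))
    rw [sq_abs] at h1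
    have h2 : (1 / (dualNormSq a b c k + 1)) ^ 2 = 1 / (1 + dualNormSq a b c k) ^ 2 := by
      rw [div_pow, one_pow, add_comm]
    have := dualNormSq_nonneg a b c k
    have h3 : 0 ≤ |1 / (dualNormSq a b c k - μ)| * (1 / (dualNormSq a b c k + 1)) := by positivity
    rw [← h2]
    linarith

theorem resolvent_sub_eq {a b c μ : ℝ} {k : Fin 3 → ℤ} (h : dualNormSq a b c k ≠ μ) :
    1 / (dualNormSq a b c k - μ) - 1 / (dualNormSq a b c k + 1) =
      (1 + μ) * (1 / (dualNormSq a b c k - μ) * (1 / (dualNormSq a b c k + 1))) := by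
  have h1 := sub_ne_zero.mpr h
  have h2 : dualNormSq a b c k + 1 ≠ 0 := by
    have := dualNormSq_nonneg a b c k
    positivity
  field_simp; ring

theorem summable_resolvent_sub {a b c : ℝ} (ha : 0 < a) (hb : 0 < b) (hc : 0 < c) {μ : ℝ}
    (hμ : μ ∉ range (dualNormSq a b c)) :
    Summable fun k => 1 / (dualNormSq a b c k - μ) - 1 / (dualNormSq a b c k + 1) := by
  refine Summable.of_norm_bounded ((summable_resolvent_mul ha hb hc μ).mul_left |1 + μ|)
    fun k => ?_
  have := dualNormSq_nonneg a b c k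
  rw [resolvent_sub_eq (fun h => hμ ⟨k, h⟩), Real.norm_eq_abs, abs_mul, abs_mul,
    abs_of_nonneg (show 0 ≤ 1 / (dualNormSq a b c k + 1) by positivity)]

theorem resolvent_mono {n μ μ' : ℝ} (h : μ ≤ μ') (hn : n < μ ∨ μ' < n) :
    1 / (n - μ) ≤ 1 / (n - μ') := by
  rcases hn with hn | hn
  · exact one_div_le_one_div_of_neg_of_le (by linarith) (by linarith)
  · exact one_div_le_one_div_of_le (by linarith) (by linarith)

/-- On an interval free of norms every term increases with `μ`, so the sum grows at least as much as
any single term. One chosen term then shows both strict monotonicity and divergence at the ends of a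
gap. -/
theorem sub_le_resolventSum_sub {a b c : ℝ} (ha : 0 < a) (hb : 0 < b) (hc : 0 < c) {μ μ' : ℝ}
    (h : μ ≤ μ') (hgap : ∀ k, dualNormSq a b c k < μ ∨ μ' < dualNormSq a b c k)
    (k₀ : Fin 3 → ℤ) :
    1 / (dualNormSq a b c k₀ - μ') - 1 / (dualNormSq a b c k₀ - μ) ≤
      resolventSum a b c μ' - resolventSum a b c μ := by
  have hμ : μ ∉ range (dualNormSq a b c) := by
    rintro ⟨k, rfl⟩
    rcases hgap k with h' | h' <;> linarith
  have hμ' : μ' ∉ range (dualNormSq a b c) := by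
    rintro ⟨k, rfl⟩
    rcases hgap k with h' | h' <;> linarith
  have hs := summable_resolvent_sub ha hb hc hμ
  have hs' := summable_resolvent_sub ha hb hc hμ'
  rw [resolventSum, resolventSum, ← hs'.tsum_sub hs]
  refine le_trans (le_of_eq (by ring)) ((hs'.sub hs).le_tsum k₀ fun k _ => ?_)
  have := resolvent_mono h (hgap k)
  linarith

/-- On the gap `|1/(n - μ)|` is dominated by its values at the two end points, which supplies a
summable majorant. -/
theorem continuousOn_resolventSum {a b c : ℝ} (ha : 0 < a) (hb : 0 < b) (hc : 0 < c) {x y : ℝ}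
    (hgap : ∀ k, dualNormSq a b c k < x ∨ y < dualNormSq a b c k) :
    ContinuousOn (resolventSum a b c) (Icc x y) := by
  have hne : ∀ k, ∀ μ ∈ Icc x y, dualNormSq a b c k - μ ≠ 0 := by
    intro k μ hμ h0
    rcases hgap k with h' | h' <;> linarith [hμ.1, hμ.2]
  refine continuousOn_tsum (u := fun k => (1 + |x| + |y|) *
      (|1 / (dualNormSq a b c k - x)| * (1 / (dualNormSq a b c k + 1)) +
       |1 / (dualNormSq a b c k - y)| * (1 / (dualNormSq a b c k + 1)))) (fun k => ?_)
    (((summable_resolvent_mul ha hb hc x).add (summable_resolvent_mul ha hb hc y)).mul_left _)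
    (fun k μ hμ => ?_)
  · exact (continuousOn_const.div (continuousOn_const.sub continuousOn_id) (hne k)).sub
      continuousOn_const
  · have hn := dualNormSq_nonneg a b c k
    have hk : dualNormSq a b c k ≠ μ := fun h => hne k μ hμ (sub_eq_zero.mpr h)
    rw [resolvent_sub_eq hk, Real.norm_eq_abs, abs_mul, abs_mul,
      abs_of_nonneg (show 0 ≤ 1 / (dualNormSq a b c k + 1) by positivity), ← add_mul]
    have h1 : |1 + μ| ≤ 1 + |x| + |y| := by
      have := abs_le_max_abs_abs hμ.1 hμ.2
      have h2 := abs_add_le 1 μ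
      rw [abs_one] at h2
      have h3 : max |x| |y| ≤ |x| + |y| := max_le (by linarith [abs_nonneg y])
        (by linarith [abs_nonneg x])
      linarith
    have h2 : |1 / (dualNormSq a b c k - μ)| ≤
        |1 / (dualNormSq a b c k - x)| + |1 / (dualNormSq a b c k - y)| := by
      have hx := abs_nonneg (1 / (dualNormSq a b c k - x))
      have hy := abs_nonneg (1 / (dualNormSq a b c k - y))
      rcases hgap k with h' | h'
      · have : |1 / (dualNormSq a b c k - μ)| ≤ |1 / (dualNormSq a b c k - x)| := by
          rw [abs_div, abs_div, abs_one,
            abs_of_neg (show dualNormSq a b c k - μ < 0 by linarith [hμ.1]),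
            abs_of_neg (show dualNormSq a b c k - x < 0 by linarith)]
          exact div_le_div_of_nonneg_left zero_le_one (by linarith) (by linarith [hμ.1])
        linarith
      · have : |1 / (dualNormSq a b c k - μ)| ≤ |1 / (dualNormSq a b c k - y)| := by
          rw [abs_div, abs_div, abs_one,
            abs_of_pos (show 0 < dualNormSq a b c k - μ by linarith [hμ.2]),
            abs_of_pos (show 0 < dualNormSq a b c k - y by linarith)]
          exact div_le_div_of_nonneg_left zero_le_one (by linarith) (by linarith [hμ.2])
        linarith
    gcongr

/-- The level sets of `resolventSum` interlace with the squared lengths. -/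
theorem interlaces_resolventSum {a b c : ℝ} (ha : 0 < a) (hb : 0 < b) (hc : 0 < c) (κ : ℝ) :
    Interlaces (range (dualNormSq a b c))
      {μ | μ ∉ range (dualNormSq a b c) ∧ resolventSum a b c μ = κ} := by
  refine ⟨fun μ hμ => hμ.1, ?_, ?_⟩
  · rintro μ ⟨hμN, hμ⟩ μ' ⟨hμ'N, hμ'⟩ hlt
    by_contra hcon
    push Not at hcon
    have hgap : ∀ k, dualNormSq a b c k < μ ∨ μ' < dualNormSq a b c k := by
      intro k
      have h1 := hcon _ ⟨k, rfl⟩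
      have h2 : dualNormSq a b c k ≠ μ := fun h => hμN ⟨k, h⟩
      have h3 : dualNormSq a b c k ≠ μ' := fun h => hμ'N ⟨k, h⟩
      rcases lt_or_gt_of_ne h2 with h | h
      · exact Or.inl h
      · exact Or.inr (lt_of_le_of_ne (h1 h) h3.symm)
    -- Any norm above both points has a strictly increasing term, which contradicts equality of the
    -- two sums.
    obtain ⟨k, hk⟩ := exists_dualNormSq_gt ha b c μ'
    have h1 := sub_le_resolventSum_sub ha hb hc hlt.le hgap k
    rw [hμ, hμ', sub_self] at h1
    have h2 : 1 / (dualNormSq a b c k - μ) < 1 / (dualNormSq a b c k - μ') :=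
      one_div_lt_one_div_of_lt (by linarith) (by linarith)
    linarith
  · rintro _ ⟨q, rfl⟩ hq
    obtain ⟨p, hp, hmax⟩ := ((ball a b c (dualNormSq a b c q)).filter
      (fun k => dualNormSq a b c k < dualNormSq a b c q)).exists_max_image (dualNormSq a b c)
      ⟨0, Finset.mem_filter.mpr ⟨(mem_ball ha hb hc).mpr (by rw [dualNormSq_zero]; exact hq.le),
        by rw [dualNormSq_zero]; exact hq⟩⟩
    have hpq := (Finset.mem_filter.mp hp).2
    have hmax : ∀ k, dualNormSq a b c k < dualNormSq a b c q →
        dualNormSq a b c k ≤ dualNormSq a b c p := fun k hk =>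
      hmax k (Finset.mem_filter.mpr ⟨(mem_ball ha hb hc).mpr hk.le, hk⟩)
    set n := dualNormSq a b c q
    set m := dualNormSq a b c p
    have hgap : ∀ x y, m < x → y < n → ∀ k, dualNormSq a b c k < x ∨ y < dualNormSq a b c k := by
      intro x y hx hy k
      rcases lt_or_ge (dualNormSq a b c k) n with h | h
      · exact Or.inl ((hmax k h).trans_lt hx)
      · exact Or.inr (hy.trans_le h)
    set z := (m + n) / 2 with hz
    have hmz : m < z := by rw [hz]; linarith
    have hzn : z < n := by rw [hz]; linarith
    -- points where the sum is large and small
    obtain ⟨y, hzy, hyn, hy⟩ : ∃ y, z ≤ y ∧ y < n ∧ κ ≤ resolventSum a b c y := by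
      -- At `n - 1/t` the term of `q` equals `t`; its increase from `z` is `t - 1/(n - z)`, exactly
      -- the possible deficit at `z`.
      set t := |κ - resolventSum a b c z| + 1 / (n - z) with ht
      have hnz : 0 < 1 / (n - z) := one_div_pos.mpr (by linarith)
      have ht0 : 0 < t := by positivity
      have htz : 1 / t ≤ n - z := by
        rw [one_div_le ht0 (by linarith)]; linarith [abs_nonneg (κ - resolventSum a b c z)]
      have hlow := one_div_pos.mpr ht0
      refine ⟨n - 1 / t, by linarith, by linarith, ?_⟩
      have h1 := sub_le_resolventSum_sub ha hb hc (μ := z) (μ' := n - 1 / t) (by linarith)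
        (hgap _ _ hmz (by linarith)) q
      have h2 : 1 / (n - (n - 1 / t)) = t := by rw [sub_sub_cancel, one_div_one_div]
      rw [h2] at h1
      linarith [le_abs_self (κ - resolventSum a b c z)]
    obtain ⟨x, hmx, hxz, hx⟩ : ∃ x, m < x ∧ x ≤ z ∧ resolventSum a b c x ≤ κ := by
      set t := |resolventSum a b c z - κ| + 1 / (z - m) with ht
      have hnz : 0 < 1 / (z - m) := one_div_pos.mpr (by linarith)
      have ht0 : 0 < t := by positivity
      have htz : 1 / t ≤ z - m := by
        rw [one_div_le ht0 (by linarith)]; linarith [abs_nonneg (resolventSum a b c z - κ)]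
      have hlow := one_div_pos.mpr ht0
      refine ⟨m + 1 / t, by linarith, by linarith, ?_⟩
      have h1 := sub_le_resolventSum_sub ha hb hc (μ := m + 1 / t) (μ' := z) (by linarith)
        (hgap _ _ (by linarith) hzn) p
      have h2 : 1 / (m - (m + 1 / t)) = -t := by
        rw [sub_add_cancel_left, one_div, inv_neg, one_div, inv_inv]
      have h3 : 1 / (m - z) = -(1 / (z - m)) := by
        rw [← neg_sub z m, one_div, inv_neg, one_div]
      change 1 / (m - z) - 1 / (m - (m + 1 / t)) ≤ _ at h1
      rw [h2, h3] at h1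
      linarith [le_abs_self (resolventSum a b c z - κ)]
    obtain ⟨μ, hμ, hμκ⟩ := intermediate_value_Icc (hxz.trans hzy)
      (continuousOn_resolventSum ha hb hc (hgap x y hmx hyn)) ⟨hx, hy⟩
    refine ⟨μ, ⟨?_, hμκ⟩, hμ.2.trans_lt hyn, ?_⟩
    · rintro ⟨k, rfl⟩
      rcases hgap x y hmx hyn k with h | h <;> linarith [hμ.1, hμ.2]
    · rintro _ ⟨k, rfl⟩ hk
      exact (hmax k hk).trans_lt (hmx.trans_le hμ.1)

/-- The regularizations `1/(n + 1)` and `n/(n² + 1)` differ by a summable sequence that does not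
involve `μ`, so changing one for the other only shifts the level. -/
theorem secularEigenvalues_eq {a b c : ℝ} (ha : 0 < a) (hb : 0 < b) (hc : 0 < c) (φ : ℝ) :
    ∃ κ : ℝ, secularEigenvalues a b c φ =
      {μ | μ ∉ range (dualNormSq a b c) ∧ resolventSum a b c μ = κ} := by
  have hs : Summable fun k => 1 / (dualNormSq a b c k + 1) -
      dualNormSq a b c k / (dualNormSq a b c k ^ 2 + 1) := by
    refine Summable.of_norm_bounded
      ((summable_inv_one_add_dualNormSq_sq ha hb hc).mul_left 2) fun k => ?_
    have hn := dualNormSq_nonneg a b c k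
    set n := dualNormSq a b c k
    have h1 : 1 / (n + 1) - n / (n ^ 2 + 1) = (1 - n) / ((n + 1) * (n ^ 2 + 1)) := by
      field_simp; ring
    rw [h1, Real.norm_eq_abs, abs_div, abs_of_pos (show 0 < (n + 1) * (n ^ 2 + 1) by positivity),
      div_le_iff₀ (by positivity)]
    have h2 : |1 - n| ≤ 1 + n := abs_le.mpr ⟨by linarith, by linarith⟩
    refine h2.trans ?_
    rw [mul_one_div, div_mul_eq_mul_div, le_div_iff₀ (by positivity)]
    nlinarith [sq_nonneg (n - 1), mul_nonneg hn hn, mul_nonneg (mul_nonneg hn hn) hn]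
  refine ⟨(∑' k, 1 / (dualNormSq a b c k ^ 2 + 1)) * Real.tan (φ / 2) -
    ∑' k, (1 / (dualNormSq a b c k + 1) - dualNormSq a b c k / (dualNormSq a b c k ^ 2 + 1)), ?_⟩
  ext μ
  simp only [secularEigenvalues, Set.mem_ofPred_eq]
  refine and_congr_right fun hμ => ?_
  have : ∑' k, (1 / (dualNormSq a b c k - μ) -
      dualNormSq a b c k / (dualNormSq a b c k ^ 2 + 1)) = resolventSum a b c μ +
      ∑' k, (1 / (dualNormSq a b c k + 1) -
        dualNormSq a b c k / (dualNormSq a b c k ^ 2 + 1)) := by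
    rw [resolventSum, ← (summable_resolvent_sub ha hb hc hμ).tsum_add hs]
    exact tsum_congr fun k => by ring
  rw [this]
  exact eq_sub_iff_add_eq.symm

/-! ### Plane waves and the identification of the cell with the standard torus -/

/-- The vector `(m₀a, m₁b, m₂c)` of the lattice `L₀`. -/
noncomputable def latticeVec (a b c : ℝ) (m : Fin 3 → ℤ) : E3 :=
  !₂[(m 0 : ℝ) * a, (m 1 : ℝ) * b, (m 2 : ℝ) * c]

/-- The vector `(k₀/a, k₁/b, k₂/c)` of the dual lattice. -/
noncomputable def freq (a b c : ℝ) (k : Fin 3 → ℤ) : E3 :=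
  !₂[(k 0 : ℝ) / a, (k 1 : ℝ) / b, (k 2 : ℝ) / c]

/-- The plane wave `x ↦ exp(i⟨ξ, x⟩)` with `ξ` in the dual lattice. -/
noncomputable def wave (a b c : ℝ) (k : Fin 3 → ℤ) (x : E3) : ℂ :=
  Complex.exp (((inner ℝ (freq a b c k) x : ℝ) : ℂ) * Complex.I)

/-- The volume of the cell. -/
noncomputable def cellVol (a b c : ℝ) : ℝ := (2 * Real.pi) ^ 3 * (a * b * c)

/-- The canonical map from `ℝ³` to the standard torus. -/
noncomputable def torusMk (a b c : ℝ) (x : E3) : UnitAddTorus (Fin 3) :=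
  ![((x 0 / (2 * Real.pi * a) : ℝ) : UnitAddCircle), ((x 1 / (2 * Real.pi * b) : ℝ) : UnitAddCircle),
    ((x 2 / (2 * Real.pi * c) : ℝ) : UnitAddCircle)]

/-- The representative in the cell of a point of the standard torus. -/
noncomputable def cellPoint (a b c : ℝ) (t : UnitAddTorus (Fin 3)) : E3 :=
  !₂[2 * Real.pi * a * (AddCircle.equivIco (1 : ℝ) 0 (t 0) : ℝ),
    2 * Real.pi * b * (AddCircle.equivIco (1 : ℝ) 0 (t 1) : ℝ),
    2 * Real.pi * c * (AddCircle.equivIco (1 : ℝ) 0 (t 2) : ℝ)]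

theorem cellVol_pos {a b c : ℝ} (ha : 0 < a) (hb : 0 < b) (hc : 0 < c) : 0 < cellVol a b c := by
  have := Real.pi_pos
  unfold cellVol
  positivity

theorem norm_freq_sq (a b c : ℝ) (k : Fin 3 → ℤ) : ‖freq a b c k‖ ^ 2 = dualNormSq a b c k := by
  rw [EuclideanSpace.norm_sq_eq, Fin.sum_univ_three]
  simp [freq, dualNormSq, div_pow]

theorem inner_freq (a b c : ℝ) (k : Fin 3 → ℤ) (x : E3) :
    (inner ℝ (freq a b c k) x : ℝ) = k 0 * (x 0 / a) + k 1 * (x 1 / b) + k 2 * (x 2 / c) := by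
  simp [freq, PiLp.inner_apply, Fin.sum_univ_three]
  ring

theorem freq_zero (a b c : ℝ) : freq a b c 0 = 0 := by
  ext i; fin_cases i <;> simp [freq]

theorem freq_neg (a b c : ℝ) (k : Fin 3 → ℤ) : freq a b c (-k) = -freq a b c k := by
  ext i; fin_cases i <;> simp [freq, neg_div]

theorem freq_add (a b c : ℝ) (k l : Fin 3 → ℤ) :
    freq a b c (k + l) = freq a b c k + freq a b c l := by
  ext i; fin_cases i <;> simp [freq, add_div]

theorem wave_zero (a b c : ℝ) (x : E3) : wave a b c 0 x = 1 := by
  simp [wave, freq_zero]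

theorem wave_apply_zero (a b c : ℝ) (k : Fin 3 → ℤ) : wave a b c k 0 = 1 := by
  simp [wave]

theorem wave_add (a b c : ℝ) (k l : Fin 3 → ℤ) (x : E3) :
    wave a b c (k + l) x = wave a b c k x * wave a b c l x := by
  simp only [wave, freq_add, inner_add_left, Complex.ofReal_add, add_mul, Complex.exp_add]

theorem wave_apply_add (a b c : ℝ) (k : Fin 3 → ℤ) (x y : E3) :
    wave a b c k (x + y) = wave a b c k x * wave a b c k y := by
  simp only [wave, inner_add_right, Complex.ofReal_add, add_mul, Complex.exp_add]

theorem wave_apply_neg (a b c : ℝ) (k : Fin 3 → ℤ) (x : E3) :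
    wave a b c k (-x) = wave a b c (-k) x := by
  simp only [wave, inner_neg_right, freq_neg, inner_neg_left]

theorem norm_wave (a b c : ℝ) (k : Fin 3 → ℤ) (x : E3) : ‖wave a b c k x‖ = 1 :=
  Complex.norm_exp_ofReal_mul_I _

theorem wave_ne_zero (a b c : ℝ) (k : Fin 3 → ℤ) (x : E3) : wave a b c k x ≠ 0 :=
  Complex.exp_ne_zero _

theorem conj_wave (a b c : ℝ) (k : Fin 3 → ℤ) (x : E3) :
    (starRingEnd ℂ) (wave a b c k x) = wave a b c (-k) x := by
  simp only [wave, ← Complex.exp_conj, map_mul, Complex.conj_ofReal, Complex.conj_I, freq_neg,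
    inner_neg_left, Complex.ofReal_neg]
  ring_nf

theorem wave_mul_neg (a b c : ℝ) (k : Fin 3 → ℤ) (x : E3) :
    wave a b c k x * wave a b c (-k) x = 1 := by
  rw [← wave_add, add_neg_cancel, wave_zero]

theorem contDiff_wave (a b c : ℝ) (k : Fin 3 → ℤ) : ContDiff ℝ ∞ (wave a b c k) := by
  have h1 : ContDiff ℝ ∞ (fun x : E3 => (inner ℝ (freq a b c k) x : ℝ)) :=
    contDiff_const.inner ℝ contDiff_id
  exact ((Complex.ofRealCLM.contDiff.comp h1).mul contDiff_const).cexp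

theorem continuous_wave (a b c : ℝ) (k : Fin 3 → ℤ) : Continuous (wave a b c k) :=
  (contDiff_wave a b c k).continuous

theorem wave_latticeVec {a b c : ℝ} (ha : 0 < a) (hb : 0 < b) (hc : 0 < c) (k m : Fin 3 → ℤ) :
    wave a b c k ((2 * Real.pi) • latticeVec a b c m) = 1 := by
  rw [wave, Complex.exp_eq_one_iff]
  refine ⟨k 0 * m 0 + k 1 * m 1 + k 2 * m 2, ?_⟩
  rw [inner_freq]
  have e : (k 0 * (((2 * Real.pi) • latticeVec a b c m) 0 / a) +
      k 1 * (((2 * Real.pi) • latticeVec a b c m) 1 / b) +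
      k 2 * (((2 * Real.pi) • latticeVec a b c m) 2 / c) : ℝ) =
      2 * Real.pi * (k 0 * m 0 + k 1 * m 1 + k 2 * m 2) := by
    simp [latticeVec]
    field_simp
  rw [e]
  push_cast
  ring

theorem mem_lattice_iff (a b c : ℝ) (l : E3) : l ∈ lattice a b c ↔ ∃ m, l = latticeVec a b c m := by
  constructor
  · rintro ⟨m, n, k, rfl⟩
    exact ⟨![m, n, k], by simp [latticeVec]⟩
  · rintro ⟨m, rfl⟩
    exact ⟨m 0, m 1, m 2, rfl⟩

theorem isTorusFunction_iff (a b c : ℝ) (f : E3 → ℂ) : IsTorusFunction a b c f ↔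
    ∀ m x, f (x + (2 * Real.pi) • latticeVec a b c m) = f x := by
  constructor
  · intro h m x
    exact h _ ((mem_lattice_iff a b c _).mpr ⟨m, rfl⟩) x
  · intro h l hl x
    obtain ⟨m, rfl⟩ := (mem_lattice_iff a b c l).mp hl
    exact h m x

theorem isSmoothOnTorus_wave {a b c : ℝ} (ha : 0 < a) (hb : 0 < b) (hc : 0 < c)
    (k : Fin 3 → ℤ) : IsSmoothOnTorus a b c (wave a b c k) := by
  refine ⟨(isTorusFunction_iff a b c _).mpr fun m x => ?_, contDiff_wave a b c k⟩
  rw [wave_apply_add, wave_latticeVec ha hb hc, mul_one]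

theorem cellPoint_mem {a b c : ℝ} (ha : 0 < a) (hb : 0 < b) (hc : 0 < c)
    (t : UnitAddTorus (Fin 3)) : cellPoint a b c t ∈ cell a b c := by
  have hpi := Real.pi_pos
  have h : ∀ (u : UnitAddCircle) (L : ℝ), 0 < L →
      L * (AddCircle.equivIco (1 : ℝ) 0 u : ℝ) ∈ Ico 0 L := by
    intro u L hL
    obtain ⟨h1, h2⟩ := (AddCircle.equivIco (1 : ℝ) 0 u).2
    exact ⟨by positivity, by nlinarith⟩
  exact ⟨h _ _ (by positivity), h _ _ (by positivity), h _ _ (by positivity)⟩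

theorem torusMk_cellPoint {a b c : ℝ} (ha : 0 < a) (hb : 0 < b) (hc : 0 < c)
    (t : UnitAddTorus (Fin 3)) : torusMk a b c (cellPoint a b c t) = t := by
  have hpi := Real.pi_pos
  have h : ∀ (u : UnitAddCircle) (L : ℝ), 0 < L →
      ((L * (AddCircle.equivIco (1 : ℝ) 0 u : ℝ) / L : ℝ) : UnitAddCircle) = u := by
    intro u L hL
    rw [mul_div_cancel_left₀ _ hL.ne']
    exact AddCircle.coe_equivIco
  funext i
  fin_cases i
  · exact h _ _ (by positivity)
  · exact h _ _ (by positivity)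
  · exact h _ _ (by positivity)

theorem exists_cellPoint_torusMk {a b c : ℝ} (ha : 0 < a) (hb : 0 < b) (hc : 0 < c) (x : E3) :
    ∃ m, x = cellPoint a b c (torusMk a b c x) + (2 * Real.pi) • latticeVec a b c m := by
  have hpi := Real.pi_pos
  have h : ∀ (y L : ℝ), 0 < L → ∃ n : ℤ, y =
      L * (AddCircle.equivIco (1 : ℝ) 0 ((y / L : ℝ) : UnitAddCircle) : ℝ) + L * n := by
    intro y L hL
    refine ⟨⌊y / L⌋, ?_⟩
    rw [AddCircle.coe_equivIco_mk_apply, div_one, mul_one, ← mul_add, Int.fract_add_floor]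
    field_simp
  obtain ⟨m, hm⟩ := h (x 0) (2 * Real.pi * a) (by positivity)
  obtain ⟨n, hn⟩ := h (x 1) (2 * Real.pi * b) (by positivity)
  obtain ⟨k, hk⟩ := h (x 2) (2 * Real.pi * c) (by positivity)
  refine ⟨![m, n, k], ?_⟩
  ext i
  fin_cases i
  · refine hm.trans ?_
    simp [cellPoint, torusMk, latticeVec]
    ring
  · refine hn.trans ?_
    simp [cellPoint, torusMk, latticeVec]
    ring
  · refine hk.trans ?_
    simp [cellPoint, torusMk, latticeVec]
    ring

theorem cellPoint_torusMk {a b c : ℝ} (ha : 0 < a) (hb : 0 < b) (hc : 0 < c) {x : E3}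
    (hx : x ∈ cell a b c) : cellPoint a b c (torusMk a b c x) = x := by
  have hpi := Real.pi_pos
  have h : ∀ (y L : ℝ), 0 < L → y ∈ Ico 0 L →
      L * (AddCircle.equivIco (1 : ℝ) 0 ((y / L : ℝ) : UnitAddCircle) : ℝ) = y := by
    intro y L hL hy
    rw [AddCircle.coe_equivIco_mk_apply, div_one, mul_one,
      Int.fract_eq_self.mpr ⟨div_nonneg hy.1 hL.le, (div_lt_one hL).mpr hy.2⟩]
    field_simp
  ext i
  fin_cases i
  · exact h _ _ (by positivity) hx.1
  · exact h _ _ (by positivity) hx.2.1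
  · exact h _ _ (by positivity) hx.2.2

theorem IsTorusFunction.cellPoint_torusMk {a b c : ℝ} (ha : 0 < a) (hb : 0 < b) (hc : 0 < c)
    {f : E3 → ℂ} (hf : IsTorusFunction a b c f) (x : E3) :
    f (cellPoint a b c (torusMk a b c x)) = f x := by
  obtain ⟨m, hm⟩ := exists_cellPoint_torusMk ha hb hc x
  conv_rhs => rw [hm, (isTorusFunction_iff a b c f).mp hf]

theorem measurable_cellPoint (a b c : ℝ) : Measurable (cellPoint a b c) := by
  refine (MeasurableEquiv.toLp 2 (Fin 3 → ℝ)).measurable.comp (measurable_pi_lambda _ fun i => ?_)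
  have h : Measurable fun u : UnitAddCircle => (AddCircle.equivIco (1 : ℝ) 0 u : ℝ) :=
    measurable_subtype_coe.comp (AddCircle.measurableEquivIco 1 0).measurable
  have h' : ∀ (L : ℝ) (j : Fin 3), Measurable fun t : UnitAddTorus (Fin 3) =>
      L * (AddCircle.equivIco (1 : ℝ) 0 (t j) : ℝ) :=
    fun L j => (h.comp (measurable_pi_apply j)).const_mul _
  fin_cases i
  · exact h' _ 0
  · exact h' _ 1
  · exact h' _ 2

theorem measurable_torusMk (a b c : ℝ) : Measurable (torusMk a b c) := by
  refine measurable_pi_lambda _ fun i => ?_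
  have h : ∀ (i : Fin 3) (L : ℝ), Measurable fun x : E3 => ((x i / L : ℝ) : UnitAddCircle) :=
    fun i L => AddCircle.measurable_mk'.comp (by fun_prop)
  fin_cases i <;> exact h _ _

theorem measurableSet_cell (a b c : ℝ) : MeasurableSet (cell a b c) := by
  have h : ∀ (i : Fin 3) (L : ℝ), MeasurableSet {x : E3 | x i ∈ Ico 0 L} := fun i L =>
    measurableSet_preimage (by fun_prop) measurableSet_Ico
  exact (h 0 _).inter ((h 1 _).inter (h 2 _))

theorem measurableEmbedding_cellPoint {a b c : ℝ} (ha : 0 < a) (hb : 0 < b) (hc : 0 < c) :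
    MeasurableEmbedding (cellPoint a b c) := by
  have hr : range (cellPoint a b c) = cell a b c := by
    ext x
    constructor
    · rintro ⟨t, rfl⟩
      exact cellPoint_mem ha hb hc t
    · intro hx
      exact ⟨_, cellPoint_torusMk ha hb hc hx⟩
  exact MeasurableEmbedding.of_measurable_inverse (measurable_cellPoint a b c)
    (hr ▸ measurableSet_cell a b c) (measurable_torusMk a b c) (torusMk_cellPoint ha hb hc)

attribute [local instance] instMeasureSpaceUnitAddCircle

theorem isProbabilityMeasure_volume_unitAddCircle :
    IsProbabilityMeasure (volume : Measure UnitAddCircle) :=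
  inferInstanceAs (IsProbabilityMeasure AddCircle.haarAddCircle)

theorem isAddHaarMeasure_volume_unitAddCircle :
    Measure.IsAddHaarMeasure (volume : Measure UnitAddCircle) :=
  inferInstanceAs (Measure.IsAddHaarMeasure AddCircle.haarAddCircle)

attribute [local instance] isProbabilityMeasure_volume_unitAddCircle
  isAddHaarMeasure_volume_unitAddCircle

/-- A diagonal scaling of determinant `1 / cellVol` carries the cell to the unit cube, which
projects onto the torus with Haar probability measure. Fourier analysis on the standard torus is
thereby transported to the cell. -/
theorem measurePreserving_torusMk {a b c : ℝ} (ha : 0 < a) (hb : 0 < b) (hc : 0 < c) :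
    MeasurePreserving (torusMk a b c)
      (ENNReal.ofReal (cellVol a b c)⁻¹ • volume.restrict (cell a b c)) volume := by
  have hpi := Real.pi_pos
  set D : Fin 3 → ℝ := ![(2 * Real.pi * a)⁻¹, (2 * Real.pi * b)⁻¹, (2 * Real.pi * c)⁻¹] with hD
  have hdet : (Matrix.diagonal D).det = (cellVol a b c)⁻¹ := by
    rw [Matrix.det_diagonal, Fin.prod_univ_three]
    simp only [hD, cellVol, Matrix.cons_val_zero, Matrix.cons_val_one, Matrix.cons_val_two]
    simp
    field_simp
  have hdet0 : (Matrix.diagonal D).det ≠ 0 := by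
    rw [hdet]; exact (inv_pos.mpr (cellVol_pos ha hb hc)).ne'
  set S : (Fin 3 → ℝ) → (Fin 3 → ℝ) := fun x => Matrix.toLin' (Matrix.diagonal D) x with hS
  have hSm : Measurable S := (LinearMap.continuous_of_finiteDimensional _).measurable
  have hmap := Real.smul_map_diagonal_volume_pi hdet0
  rw [hdet, abs_of_pos (inv_pos.mpr (cellVol_pos ha hb hc))] at hmap
  set box : Set (Fin 3 → ℝ) := Set.pi univ fun _ => Ico 0 1 with hbox
  have hboxm : MeasurableSet box := MeasurableSet.univ_pi fun _ => measurableSet_Ico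
  have h1 : MeasurePreserving (fun (y : Fin 3 → ℝ) => (fun i => (y i : UnitAddCircle)))
      (volume.restrict box) (volume : Measure (UnitAddTorus (Fin 3))) := by
    have h1d : MeasurePreserving (fun y : ℝ => (y : UnitAddCircle)) (volume.restrict (Ico 0 1))
        (AddCircle.haarAddCircle) := by
      have := AddCircle.measurePreserving_mk 1 0
      rw [zero_add, ← Measure.restrict_congr_set Ico_ae_eq_Ioc] at this
      simpa [AddCircle.volume_eq_smul_haarAddCircle] using this
    have h2 := measurePreserving_pi (fun _ : Fin 3 => volume.restrict (Ico (0 : ℝ) 1)) _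
      (fun _ => h1d)
    rw [← Measure.restrict_pi_pi] at h2
    exact h2
  have h2 : MeasurePreserving S
      (ENNReal.ofReal (cellVol a b c)⁻¹ • volume.restrict (S ⁻¹' box)) (volume.restrict box) := by
    refine ⟨hSm, ?_⟩
    rw [Measure.map_smul, ← Measure.restrict_map hSm hboxm, ← Measure.restrict_smul, hmap]
  have h3 : MeasurePreserving (fun x : E3 => (x.ofLp : Fin 3 → ℝ)) volume volume :=
    EuclideanSpace.volume_preserving_symm_measurableEquiv_toLp (Fin 3)
  have hSx : ∀ x : Fin 3 → ℝ, ∀ i, S x i = D i * x i := by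
    intro x i
    simp only [hS, Matrix.toLin'_apply, Matrix.mulVec_diagonal]
  have h4 : (fun x : E3 => (x.ofLp : Fin 3 → ℝ)) ⁻¹' (S ⁻¹' box) = cell a b c := by
    ext x
    have key : ∀ (y L : ℝ), 0 < L → (L⁻¹ * y ∈ Ico (0 : ℝ) 1 ↔ y ∈ Ico 0 L) := by
      intro y L hL
      rw [← div_eq_inv_mul]
      exact and_congr (by rw [le_div_iff₀ hL, zero_mul]) (by rw [div_lt_one hL])
    simp only [mem_preimage, hbox, Set.mem_pi, mem_univ, forall_true_left, hSx, Fin.forall_fin_succ]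
    simp only [hD, cell]
    have e0 := key (x 0) (2 * Real.pi * a) (by positivity)
    have e1 := key (x 1) (2 * Real.pi * b) (by positivity)
    have e2 := key (x 2) (2 * Real.pi * c) (by positivity)
    simpa [-mem_Ico] using and_congr e0 (and_congr e1 e2)
  have h5 := (h3.restrict_preimage (hSm hboxm)).smul_measure (ENNReal.ofReal (cellVol a b c)⁻¹)
  rw [h4] at h5
  have h6 := h1.comp (h2.comp h5)
  convert! h6 using 1
  funext x i
  fin_cases i
  · simp [torusMk, hSx, hD, div_eq_inv_mul]
  · simp [torusMk, hSx, hD, div_eq_inv_mul]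
  · simp [torusMk, hSx, hD, div_eq_inv_mul]

theorem measurePreserving_cellPoint {a b c : ℝ} (ha : 0 < a) (hb : 0 < b) (hc : 0 < c) :
    MeasurePreserving (cellPoint a b c) volume
      (ENNReal.ofReal (cellVol a b c)⁻¹ • volume.restrict (cell a b c)) := by
  refine ⟨measurable_cellPoint a b c, ?_⟩
  rw [← (measurePreserving_torusMk ha hb hc).map_eq,
    Measure.map_map (measurable_cellPoint a b c) (measurable_torusMk a b c)]
  have h : ∀ᵐ x ∂(ENNReal.ofReal (cellVol a b c)⁻¹ • volume.restrict (cell a b c)),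
      (cellPoint a b c ∘ torusMk a b c) x = id x :=
    Measure.ae_smul_measure ((ae_restrict_iff' (measurableSet_cell a b c)).mpr
      (Eventually.of_forall fun x hx => cellPoint_torusMk ha hb hc hx)) _
  rw [Measure.map_congr h, Measure.map_id]

theorem volume_cell {a b c : ℝ} (ha : 0 < a) (hb : 0 < b) (hc : 0 < c) :
    volume (cell a b c) = ENNReal.ofReal (cellVol a b c) := by
  have hV := cellVol_pos ha hb hc
  have h := (measurePreserving_cellPoint ha hb hc).measure_preimage
    (s := univ) MeasurableSet.univ.nullMeasurableSet
  rw [preimage_univ, measure_univ, Measure.smul_apply, Measure.restrict_apply_univ, smul_eq_mul,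
    ENNReal.ofReal_inv_of_pos hV] at h
  rw [mul_comm] at h
  rw [ENNReal.eq_inv_of_mul_eq_one_left h.symm, inv_inv]

theorem integral_cellPoint {a b c : ℝ} (ha : 0 < a) (hb : 0 < b) (hc : 0 < c) (f : E3 → ℂ) :
    ∫ t, f (cellPoint a b c t) = (cellVol a b c : ℂ)⁻¹ * ∫ x in cell a b c, f x := by
  rw [(measurePreserving_cellPoint ha hb hc).integral_comp (measurableEmbedding_cellPoint ha hb hc),
    integral_smul_measure, ENNReal.toReal_ofReal (inv_pos.mpr (cellVol_pos ha hb hc)).le]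
  simp

theorem mFourier_eq_wave (a b c : ℝ) (k : Fin 3 → ℤ) (x : E3) :
    UnitAddTorus.mFourier k (torusMk a b c x) = wave a b c k x := by
  rw [UnitAddTorus.mFourier, ContinuousMap.coe_mk, Fin.prod_univ_three, wave, inner_freq]
  simp only [torusMk, Matrix.cons_val_zero, Matrix.cons_val_one, Matrix.cons_val_two]
  simp only [Matrix.tail_cons, Matrix.head_cons, fourier_coe_apply,
    ← Complex.exp_add]
  congr 1
  push_cast
  field_simp

/-! ### Fourier coefficients, Parseval and integration by parts on the cell -/

/-- The (unnormalized) Fourier coefficients of a function on the torus. -/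
noncomputable def coeff (a b c : ℝ) (f : E3 → ℂ) (k : Fin 3 → ℤ) : ℂ :=
  ∫ x in cell a b c, f x * wave a b c (-k) x

section Torus

attribute [local instance] instMeasureSpaceUnitAddCircle
attribute [local instance] isProbabilityMeasure_volume_unitAddCircle
  isAddHaarMeasure_volume_unitAddCircle

theorem mFourierCoeff_cellPoint {a b c : ℝ} (ha : 0 < a) (hb : 0 < b) (hc : 0 < c) (f : E3 → ℂ)
    (k : Fin 3 → ℤ) : UnitAddTorus.mFourierCoeff (fun t => f (cellPoint a b c t)) k =
      (cellVol a b c : ℂ)⁻¹ * coeff a b c f k := by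
  rw [coeff, ← integral_cellPoint ha hb hc, UnitAddTorus.mFourierCoeff]
  congr 1
  funext t
  rw [smul_eq_mul, mul_comm, ← mFourier_eq_wave, torusMk_cellPoint ha hb hc]

theorem memLp_cellPoint_iff {a b c : ℝ} (ha : 0 < a) (hb : 0 < b) (hc : 0 < c) (f : E3 → ℂ)
    (p : ENNReal) : MemLp (fun t => f (cellPoint a b c t)) p volume ↔
      MemLp f p (volume.restrict (cell a b c)) := by
  have hV := cellVol_pos ha hb hc
  have h := (measurableEmbedding_cellPoint ha hb hc).memLp_map_measure_iff (p := p) (g := f)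
    (μ := volume)
  rw [(measurePreserving_cellPoint ha hb hc).map_eq] at h
  have h0 : ENNReal.ofReal (cellVol a b c)⁻¹ ≠ 0 := by simpa using hV
  refine h.symm.trans ⟨fun hf => ?_, fun hf => hf.smul_measure ENNReal.ofReal_ne_top⟩
  have := hf.smul_measure (c := (ENNReal.ofReal (cellVol a b c)⁻¹)⁻¹) (ENNReal.inv_ne_top.mpr h0)
  rwa [smul_smul, ENNReal.inv_mul_cancel h0 ENNReal.ofReal_ne_top, one_smul] at this

/-- Parseval's identity. -/
theorem hasSum_conj_coeff_mul {a b c : ℝ} (ha : 0 < a) (hb : 0 < b) (hc : 0 < c) {f g : E3 → ℂ}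
    (hf : MemLp f 2 (volume.restrict (cell a b c)))
    (hg : MemLp g 2 (volume.restrict (cell a b c))) :
    HasSum (fun k => (starRingEnd ℂ) (coeff a b c f k) * coeff a b c g k)
      (cellVol a b c * ∫ x in cell a b c, (starRingEnd ℂ) (f x) * g x) := by
  have hV : (cellVol a b c : ℂ) ≠ 0 := Complex.ofReal_ne_zero.mpr (cellVol_pos ha hb hc).ne'
  have hf' := (memLp_cellPoint_iff ha hb hc f 2).mpr hf
  have hg' := (memLp_cellPoint_iff ha hb hc g 2).mpr hg
  have h := UnitAddTorus.hasSum_prod_mFourierCoeff (hf'.toLp _) (hg'.toLp _)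
  have e : ∀ {u : E3 → ℂ} (hu : MemLp (fun t => u (cellPoint a b c t)) 2 volume) (k : Fin 3 → ℤ),
      UnitAddTorus.mFourierCoeff (hu.toLp _) k = (cellVol a b c : ℂ)⁻¹ * coeff a b c u k := by
    intro u hu k
    rw [← mFourierCoeff_cellPoint ha hb hc]
    exact integral_congr_ae (hu.coeFn_toLp.mono fun t ht => by simp only [ht])
  simp only [e] at h
  have e2 : ∫ t, (starRingEnd ℂ) ((hf'.toLp _) t) * (hg'.toLp _) t =
      (cellVol a b c : ℂ)⁻¹ * ∫ x in cell a b c, (starRingEnd ℂ) (f x) * g x := by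
    rw [← integral_cellPoint ha hb hc]
    refine integral_congr_ae ?_
    filter_upwards [hf'.coeFn_toLp, hg'.coeFn_toLp] with t h1 h2
    rw [h1, h2]
  rw [e2] at h
  have h3 := h.mul_left ((cellVol a b c : ℂ) ^ 2)
  convert! h3 using 1
  · funext k
    simp only [map_mul, map_inv₀, Complex.conj_ofReal]
    field_simp
  · field_simp

theorem torusMk_add (a b c : ℝ) (x y : E3) :
    torusMk a b c (x + y) = torusMk a b c x + torusMk a b c y := by
  funext i
  fin_cases i <;> simp [torusMk, add_div]

theorem IsTorusFunction.apply_cellPoint_add {a b c : ℝ} (ha : 0 < a) (hb : 0 < b) (hc : 0 < c)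
    {f : E3 → ℂ} (hf : IsTorusFunction a b c f) (h : E3) (t : UnitAddTorus (Fin 3)) :
    f (cellPoint a b c t + h) = f (cellPoint a b c (t + torusMk a b c h)) := by
  rw [← hf.cellPoint_torusMk ha hb hc (cellPoint a b c t + h), torusMk_add,
    torusMk_cellPoint ha hb hc]

/-- Translation of a periodic function corresponds to translation on the torus, where Haar measure
is invariant. -/
theorem IsTorusFunction.integral_add {a b c : ℝ} (ha : 0 < a) (hb : 0 < b) (hc : 0 < c)
    {f : E3 → ℂ} (hf : IsTorusFunction a b c f) (h : E3) :
    ∫ x in cell a b c, f (x + h) = ∫ x in cell a b c, f x := by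
  have hV : (cellVol a b c : ℂ)⁻¹ ≠ 0 :=
    inv_ne_zero (Complex.ofReal_ne_zero.mpr (cellVol_pos ha hb hc).ne')
  apply mul_left_cancel₀ hV
  refine (integral_cellPoint ha hb hc fun x => f (x + h)).symm.trans
    (Eq.trans ?_ (integral_cellPoint ha hb hc f))
  simp only [hf.apply_cellPoint_add ha hb hc]
  exact integral_add_right_eq_self (fun t => f (cellPoint a b c t)) _

theorem IsTorusFunction.memLp_add_iff {a b c : ℝ} (ha : 0 < a) (hb : 0 < b) (hc : 0 < c)
    {f : E3 → ℂ} (hf : IsTorusFunction a b c f) (h : E3) (p : ENNReal) :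
    MemLp (fun x => f (x + h)) p (volume.restrict (cell a b c)) ↔
      MemLp f p (volume.restrict (cell a b c)) := by
  rw [← memLp_cellPoint_iff ha hb hc, ← memLp_cellPoint_iff ha hb hc]
  simp only [hf.apply_cellPoint_add ha hb hc]
  have hm := measurePreserving_add_right (volume : Measure (UnitAddTorus (Fin 3)))
    (torusMk a b c h)
  have := (measurableEmbedding_addRight (torusMk a b c h)).memLp_map_measure_iff (p := p)
    (g := fun t => f (cellPoint a b c t)) (μ := volume)
  rw [hm.map_eq] at this
  exact this.symm

end Torus

theorem IsTorusFunction.shift {a b c : ℝ} {f : E3 → ℂ} (hf : IsTorusFunction a b c f) (h : E3) :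
    IsTorusFunction a b c (fun x => f (x + h)) := by
  intro l hl x
  show f (x + (2 * Real.pi) • l + h) = f (x + h)
  rw [add_right_comm, hf l hl]

theorem IsTorusFunction.mul {a b c : ℝ} {f g : E3 → ℂ} (hf : IsTorusFunction a b c f)
    (hg : IsTorusFunction a b c g) : IsTorusFunction a b c (fun x => f x * g x) := by
  intro l hl x
  show f _ * g _ = _
  rw [hf l hl, hg l hl]

theorem IsL2OnTorus.shift {a b c : ℝ} (ha : 0 < a) (hb : 0 < b) (hc : 0 < c) {f : E3 → ℂ}
    (hf : IsL2OnTorus a b c f) (h : E3) : IsL2OnTorus a b c (fun x => f (x + h)) :=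
  ⟨hf.1.shift h, (hf.1.memLp_add_iff ha hb hc h 2).mpr hf.2⟩

theorem coeff_shift {a b c : ℝ} (ha : 0 < a) (hb : 0 < b) (hc : 0 < c) {f : E3 → ℂ}
    (hf : IsTorusFunction a b c f) (h : E3) (k : Fin 3 → ℤ) :
    coeff a b c (fun x => f (x + h)) k = wave a b c k h * coeff a b c f k := by
  have := (hf.mul (isSmoothOnTorus_wave ha hb hc (-k)).1).integral_add ha hb hc h
  rw [coeff, coeff, ← this, ← integral_const_mul]
  congr 1
  funext x
  rw [wave_apply_add]
  linear_combination (-(f (x + h) * wave a b c (-k) x)) * wave_mul_neg a b c k h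

theorem coeff_const_mul (a b c : ℝ) (f : E3 → ℂ) (z : ℂ) (k : Fin 3 → ℤ) :
    coeff a b c (fun x => z * f x) k = z * coeff a b c f k := by
  simp only [coeff, mul_assoc, integral_const_mul]

theorem volume_cell_ne_top {a b c : ℝ} (ha : 0 < a) (hb : 0 < b) (hc : 0 < c) :
    volume (cell a b c) ≠ ⊤ := by
  rw [volume_cell ha hb hc]; exact ENNReal.ofReal_ne_top

theorem isFiniteMeasure_restrict_cell {a b c : ℝ} (ha : 0 < a) (hb : 0 < b) (hc : 0 < c) :
    IsFiniteMeasure (volume.restrict (cell a b c)) :=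
  isFiniteMeasure_restrict.mpr (volume_cell_ne_top ha hb hc)

theorem integrable_mul_wave {a b c : ℝ} {f : E3 → ℂ}
    (hf : Integrable f (volume.restrict (cell a b c))) (k : Fin 3 → ℤ) :
    Integrable (fun x => f x * wave a b c k x) (volume.restrict (cell a b c)) :=
  hf.mul_bdd (c := 1) (continuous_wave a b c k).aestronglyMeasurable
    (Eventually.of_forall fun x => (norm_wave a b c k x).le)

theorem coeff_add {a b c : ℝ} {f g : E3 → ℂ}
    (hf : Integrable f (volume.restrict (cell a b c)))
    (hg : Integrable g (volume.restrict (cell a b c))) (k : Fin 3 → ℤ) :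
    coeff a b c (fun x => f x + g x) k = coeff a b c f k + coeff a b c g k := by
  simp only [coeff, add_mul]
  exact integral_add (integrable_mul_wave hf _) (integrable_mul_wave hg _)

theorem integrable_of_memLp {a b c : ℝ} (ha : 0 < a) (hb : 0 < b) (hc : 0 < c) {f : E3 → ℂ}
    (hf : MemLp f 2 (volume.restrict (cell a b c))) :
    Integrable f (volume.restrict (cell a b c)) := by
  have := isFiniteMeasure_restrict_cell ha hb hc
  exact hf.integrable one_le_two

theorem coeff_conj (a b c : ℝ) (f : E3 → ℂ) (k : Fin 3 → ℤ) :
    coeff a b c (fun x => (starRingEnd ℂ) (f x)) k = (starRingEnd ℂ) (coeff a b c f (-k)) := by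
  rw [coeff, coeff, ← integral_conj]
  simp only [map_mul, conj_wave, neg_neg]

theorem memLp_conj {μ : Measure E3} {p : ENNReal} {f : E3 → ℂ} (hf : MemLp f p μ) :
    MemLp (fun x => (starRingEnd ℂ) (f x)) p μ :=
  hf.star

/-- The bilinear form of Parseval's identity. -/
theorem hasSum_coeff_neg_mul {a b c : ℝ} (ha : 0 < a) (hb : 0 < b) (hc : 0 < c) {f g : E3 → ℂ}
    (hf : MemLp f 2 (volume.restrict (cell a b c)))
    (hg : MemLp g 2 (volume.restrict (cell a b c))) :
    HasSum (fun k => coeff a b c f (-k) * coeff a b c g k)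
      (cellVol a b c * ∫ x in cell a b c, f x * g x) := by
  have h := hasSum_conj_coeff_mul ha hb hc (memLp_conj hf) hg
  simpa only [coeff_conj, Complex.conj_conj] using h

theorem hasSum_norm_coeff_sq {a b c : ℝ} (ha : 0 < a) (hb : 0 < b) (hc : 0 < c) {f : E3 → ℂ}
    (hf : MemLp f 2 (volume.restrict (cell a b c))) :
    HasSum (fun k => ‖coeff a b c f k‖ ^ 2)
      (cellVol a b c * ∫ x in cell a b c, ‖f x‖ ^ 2) := by
  have h := hasSum_conj_coeff_mul ha hb hc hf hf
  simp only [← Complex.normSq_eq_conj_mul_self, Complex.normSq_eq_norm_sq] at h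
  have e : ∫ x in cell a b c, ((‖f x‖ ^ 2 : ℝ) : ℂ) = ((∫ x in cell a b c, ‖f x‖ ^ 2 : ℝ) : ℂ) :=
    integral_ofReal
  rw [e, ← Complex.ofReal_mul] at h
  exact_mod_cast h

theorem ae_eq_of_coeff_eq {a b c : ℝ} (ha : 0 < a) (hb : 0 < b) (hc : 0 < c) {f g : E3 → ℂ}
    (hf : MemLp f 2 (volume.restrict (cell a b c)))
    (hg : MemLp g 2 (volume.restrict (cell a b c)))
    (h : ∀ k, coeff a b c f k = coeff a b c g k) :
    f =ᵐ[volume.restrict (cell a b c)] g := by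
  have hV := cellVol_pos ha hb hc
  have hfg := hf.sub hg
  have hz : ∀ k, coeff a b c (f - g) k = 0 := by
    intro k
    have e : (f - g) = fun x => f x + (-1) * g x := by funext x; simp; ring
    rw [e, coeff_add (integrable_of_memLp ha hb hc hf)
      ((integrable_of_memLp ha hb hc hg).const_mul _), coeff_const_mul, h]
    ring
  have hs := hasSum_norm_coeff_sq ha hb hc hfg
  simp only [hz, norm_zero, ne_eq, OfNat.ofNat_ne_zero, not_false_eq_true, zero_pow] at hs
  have h0 := hs.unique hasSum_zero
  have h1 : ∫ x in cell a b c, ‖(f - g) x‖ ^ 2 = 0 := by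
    rcases mul_eq_zero.mp h0 with h | h
    · exact absurd h hV.ne'
    · exact h
  rw [integral_eq_zero_iff_of_nonneg (fun x => by positivity) hfg.norm.integrable_sq] at h1
  filter_upwards [h1] with x hx
  have : ‖(f - g) x‖ = 0 := by simpa using hx
  exact sub_eq_zero.mp (norm_eq_zero.mp this)

/-- Countably many translates of the cell cover the space. Equality on all of `ℝ³` is needed because
`x₀` may lie outside the cell or on its boundary. -/
theorem ae_eq_of_restrict_cell {a b c : ℝ} (ha : 0 < a) (hb : 0 < b) (hc : 0 < c) {f g : E3 → ℂ}
    (hf : IsTorusFunction a b c f) (hg : IsTorusFunction a b c g)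
    (h : f =ᵐ[volume.restrict (cell a b c)] g) : f =ᵐ[volume] g := by
  have h' := (ae_restrict_iff' (measurableSet_cell a b c)).mp h
  have h2 : ∀ m : Fin 3 → ℤ, ∀ᵐ x ∂(volume : Measure E3),
      x + (2 * Real.pi) • latticeVec a b c m ∈ cell a b c →
      f (x + (2 * Real.pi) • latticeVec a b c m) = g (x + (2 * Real.pi) • latticeVec a b c m) :=
    fun m => (measurePreserving_add_right volume
      ((2 * Real.pi) • latticeVec a b c m)).quasiMeasurePreserving.ae h'
  filter_upwards [ae_all_iff.mpr h2] with x hx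
  obtain ⟨m, hm⟩ := exists_cellPoint_torusMk ha hb hc x
  have e : x + (2 * Real.pi) • latticeVec a b c (-m) = cellPoint a b c (torusMk a b c x) := by
    have : latticeVec a b c (-m) = -latticeVec a b c m := by
      ext i; fin_cases i <;> simp [latticeVec]
    rw [this, smul_neg]
    conv_lhs => rw [hm]
    simp
  have h3 := hx (-m)
  rw [e] at h3
  have := h3 (cellPoint_mem ha hb hc _)
  rwa [hf.cellPoint_torusMk ha hb hc, hg.cellPoint_torusMk ha hb hc] at this

theorem cell_subset_closedBall (a b c : ℝ) : cell a b c ⊆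
    Metric.closedBall 0 (2 * Real.pi * a + 2 * Real.pi * b + 2 * Real.pi * c) := by
  intro x ⟨h0, h1, h2⟩
  rw [mem_closedBall_zero_iff, EuclideanSpace.norm_eq, Fin.sum_univ_three]
  refine Real.sqrt_le_iff.mpr ⟨by linarith [h0.1, h1.1, h2.1, h0.2, h1.2, h2.2], ?_⟩
  simp only [Real.norm_eq_abs, sq_abs]
  nlinarith [h0.1, h1.1, h2.1, h0.2, h1.2, h2.2, mul_nonneg h0.1 h1.1, mul_nonneg h0.1 h2.1,
    mul_nonneg h1.1 h2.1]

theorem IsTorusFunction.exists_norm_le {a b c : ℝ} (ha : 0 < a) (hb : 0 < b) (hc : 0 < c)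
    {f : E3 → ℂ} (hf : IsTorusFunction a b c f) (hcont : Continuous f) :
    ∃ C, ∀ x, ‖f x‖ ≤ C := by
  obtain ⟨C, hC⟩ := ((isCompact_closedBall (0 : E3)
    (2 * Real.pi * a + 2 * Real.pi * b + 2 * Real.pi * c)).image hcont).isBounded.exists_norm_le
  refine ⟨C, fun x => ?_⟩
  rw [← hf.cellPoint_torusMk ha hb hc]
  exact hC _ ⟨_, cell_subset_closedBall a b c (cellPoint_mem ha hb hc _), rfl⟩

theorem memLp_of_continuous {a b c : ℝ} (ha : 0 < a) (hb : 0 < b) (hc : 0 < c) {f : E3 → ℂ}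
    (hf : IsTorusFunction a b c f) (hcont : Continuous f) (p : ENNReal) :
    MemLp f p (volume.restrict (cell a b c)) := by
  obtain ⟨C, hC⟩ := hf.exists_norm_le ha hb hc hcont
  have := isFiniteMeasure_restrict_cell ha hb hc
  exact MemLp.of_bound hcont.aestronglyMeasurable C (Eventually.of_forall hC)

theorem integrable_of_continuous {a b c : ℝ} (ha : 0 < a) (hb : 0 < b) (hc : 0 < c) {f : E3 → ℂ}
    (hf : IsTorusFunction a b c f) (hcont : Continuous f) :
    Integrable f (volume.restrict (cell a b c)) :=
  memLp_one_iff_integrable.mp (memLp_of_continuous ha hb hc hf hcont 1)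

theorem IsSmoothOnTorus.fderiv_apply {a b c : ℝ} {f : E3 → ℂ} (hf : IsSmoothOnTorus a b c f)
    (v : E3) : IsSmoothOnTorus a b c (fun x => fderiv ℝ f x v) := by
  refine ⟨fun l hl x => ?_, ?_⟩
  · have h : (fun y => f (y + (2 * Real.pi) • l)) = f := funext fun y => hf.1 l hl y
    have h2 := fderiv_comp_add_right (𝕜 := ℝ) (f := f) (x := x) ((2 * Real.pi) • l)
    rw [h] at h2
    show fderiv ℝ f (x + (2 * Real.pi) • l) v = _
    rw [← h2]
  · exact (hf.2.fderiv_right (by simp)).clm_apply contDiff_const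

theorem IsSmoothOnTorus.mul {a b c : ℝ} {f g : E3 → ℂ} (hf : IsSmoothOnTorus a b c f)
    (hg : IsSmoothOnTorus a b c g) : IsSmoothOnTorus a b c (fun x => f x * g x) :=
  ⟨hf.1.mul hg.1, hf.2.mul hg.2⟩

/-- The integral of `x ↦ f (x + t v)` over the cell does not depend on `t`; differentiating under
the integral sign avoids any boundary terms. -/
theorem IsSmoothOnTorus.integral_fderiv {a b c : ℝ} (ha : 0 < a) (hb : 0 < b) (hc : 0 < c)
    {f : E3 → ℂ} (hf : IsSmoothOnTorus a b c f) (v : E3) :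
    ∫ x in cell a b c, fderiv ℝ f x v = 0 := by
  have hd := hf.fderiv_apply v
  obtain ⟨C, hC⟩ := hd.1.exists_norm_le ha hb hc hd.2.continuous
  have := isFiniteMeasure_restrict_cell ha hb hc
  have h := hasDerivAt_integral_of_dominated_loc_of_deriv_le (𝕜 := ℝ)
    (μ := volume.restrict (cell a b c)) (F := fun (t : ℝ) x => f (x + t • v)) (x₀ := 0)
    (F' := fun t x => fderiv ℝ f (x + t • v) v) (s := univ) (bound := fun _ => C) univ_mem
    (Eventually.of_forall fun t =>
      (hf.2.continuous.comp (continuous_id.add continuous_const)).aestronglyMeasurable)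
    (by simpa using integrable_of_continuous ha hb hc hf.1 hf.2.continuous)
    (hd.2.continuous.comp (continuous_id.add continuous_const)).aestronglyMeasurable
    (Eventually.of_forall fun x t _ => hC _) (integrable_const _)
    (Eventually.of_forall fun x t _ => by
      have h1 : HasFDerivAt f (fderiv ℝ f (x + t • v)) (x + t • v) :=
        (hf.2.differentiable (by simp) _).hasFDerivAt
      have h2 : HasDerivAt (fun t : ℝ => x + t • v) v t := by
        simpa using ((hasDerivAt_id t).smul_const v).const_add x
      exact h1.comp_hasDerivAt t h2)
  have h3 : (fun t : ℝ => ∫ x in cell a b c, f (x + t • v)) =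
      fun _ => ∫ x in cell a b c, f x := funext fun t => hf.1.integral_add ha hb hc _
  have h4 := h.2
  rw [h3] at h4
  simpa using h4.unique (hasDerivAt_const 0 _)

theorem fderiv_wave (a b c : ℝ) (k : Fin 3 → ℤ) (x v : E3) :
    fderiv ℝ (wave a b c k) x v =
      wave a b c k x * ((inner ℝ (freq a b c k) v : ℝ) * Complex.I) := by
  have h1 : HasFDerivAt (fun x : E3 => (((inner ℝ (freq a b c k) x : ℝ) : ℂ) * Complex.I))
      ((Complex.I • Complex.ofRealCLM).comp (innerSL ℝ (freq a b c k))) x := by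
    have := ((Complex.I • Complex.ofRealCLM).comp (innerSL ℝ (freq a b c k))).hasFDerivAt (x := x)
    refine this.congr_of_eventuallyEq (Eventually.of_forall fun y => ?_)
    simp [mul_comm]
  have h2 := h1.cexp
  rw [show wave a b c k = fun x => Complex.exp (((inner ℝ (freq a b c k) x : ℝ) : ℂ) * Complex.I)
    from rfl, h2.fderiv]
  simp [mul_comm]

theorem coeff_fderiv {a b c : ℝ} (ha : 0 < a) (hb : 0 < b) (hc : 0 < c)
    {f : E3 → ℂ} (hf : IsSmoothOnTorus a b c f) (v : E3) (k : Fin 3 → ℤ) :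
    coeff a b c (fun x => fderiv ℝ f x v) k =
      ((inner ℝ (freq a b c k) v : ℝ) * Complex.I) * coeff a b c f k := by
  have hw := isSmoothOnTorus_wave ha hb hc (-k)
  have h := (hf.mul hw).integral_fderiv ha hb hc v
  have e : ∀ x, fderiv ℝ (fun x => f x * wave a b c (-k) x) x v =
      fderiv ℝ f x v * wave a b c (-k) x -
        ((inner ℝ (freq a b c k) v : ℝ) * Complex.I) * (f x * wave a b c (-k) x) := by
    intro x
    rw [fderiv_fun_mul (hf.2.differentiable (by simp) x) (hw.2.differentiable (by simp) x)]
    simp only [add_apply, smul_apply, smul_eq_mul,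
      fderiv_wave, freq_neg, inner_neg_left, Complex.ofReal_neg]
    ring
  simp only [e] at h
  rw [integral_sub, integral_const_mul, sub_eq_zero] at h
  · exact h
  · exact integrable_of_continuous ha hb hc ((hf.fderiv_apply v).mul hw).1
      ((hf.fderiv_apply v).mul hw).2.continuous
  · exact (integrable_of_continuous ha hb hc (hf.mul hw).1 (hf.mul hw).2.continuous).const_mul _

theorem laplacian_apply {f : E3 → ℂ} (hf : ContDiff ℝ ∞ f) (x : E3) :
    Laplacian.laplacian f x = ∑ i, fderiv ℝ (fun y => fderiv ℝ f y
      (EuclideanSpace.basisFun (Fin 3) ℝ i)) x (EuclideanSpace.basisFun (Fin 3) ℝ i) := by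
  rw [InnerProductSpace.laplacian_eq_iteratedFDeriv_orthonormalBasis f
    (EuclideanSpace.basisFun (Fin 3) ℝ)]
  refine Finset.sum_congr rfl fun i _ => ?_
  rw [iteratedFDeriv_two_apply, fderiv_clm_apply
    (((hf.fderiv_right (m := ∞) (by simp)).differentiable (by simp)) x) (by fun_prop)]
  simp

theorem IsSmoothOnTorus.laplacian {a b c : ℝ} {f : E3 → ℂ} (hf : IsSmoothOnTorus a b c f) :
    IsSmoothOnTorus a b c (Laplacian.laplacian f) := by
  have e : Laplacian.laplacian f = fun x => ∑ i, fderiv ℝ (fun y => fderiv ℝ f y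
      (EuclideanSpace.basisFun (Fin 3) ℝ i)) x (EuclideanSpace.basisFun (Fin 3) ℝ i) :=
    funext fun x => laplacian_apply hf.2 x
  have h := fun i : Fin 3 => (hf.fderiv_apply (EuclideanSpace.basisFun (Fin 3) ℝ i)).fderiv_apply
    (EuclideanSpace.basisFun (Fin 3) ℝ i)
  rw [e]
  exact ⟨fun l hl x => Finset.sum_congr rfl fun i _ => (h i).1 l hl x,
    ContDiff.sum fun i _ => (h i).2⟩

theorem coeff_laplacian {a b c : ℝ} (ha : 0 < a) (hb : 0 < b) (hc : 0 < c)
    {f : E3 → ℂ} (hf : IsSmoothOnTorus a b c f) (k : Fin 3 → ℤ) :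
    coeff a b c (Laplacian.laplacian f) k = -(dualNormSq a b c k : ℂ) * coeff a b c f k := by
  have h := fun i : Fin 3 => (hf.fderiv_apply (EuclideanSpace.basisFun (Fin 3) ℝ i)).fderiv_apply
    (EuclideanSpace.basisFun (Fin 3) ℝ i)
  have e : Laplacian.laplacian f = fun x => ∑ i, fderiv ℝ (fun y => fderiv ℝ f y
      (EuclideanSpace.basisFun (Fin 3) ℝ i)) x (EuclideanSpace.basisFun (Fin 3) ℝ i) :=
    funext fun x => laplacian_apply hf.2 x
  rw [e, coeff]
  simp only [Finset.sum_mul]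
  rw [integral_finsetSum _ fun i _ => integrable_mul_wave
    (integrable_of_continuous ha hb hc (h i).1 (h i).2.continuous) _]
  have e2 : ∀ i : Fin 3, ∫ x in cell a b c, fderiv ℝ (fun y => fderiv ℝ f y
      (EuclideanSpace.basisFun (Fin 3) ℝ i)) x (EuclideanSpace.basisFun (Fin 3) ℝ i) *
        wave a b c (-k) x = -((freq a b c k i : ℝ) : ℂ) ^ 2 * coeff a b c f k := by
    intro i
    have := coeff_fderiv ha hb hc (hf.fderiv_apply (EuclideanSpace.basisFun (Fin 3) ℝ i))
      (EuclideanSpace.basisFun (Fin 3) ℝ i) k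
    rw [coeff_fderiv ha hb hc hf] at this
    rw [coeff] at this
    rw [this]
    have e3 : (inner ℝ (freq a b c k) (EuclideanSpace.basisFun (Fin 3) ℝ i) : ℝ) =
        freq a b c k i := by
      rw [EuclideanSpace.basisFun_apply, EuclideanSpace.inner_single_right]
      simp
    rw [e3]
    linear_combination ((freq a b c k i : ℝ) : ℂ) ^ 2 * coeff a b c f k * Complex.I_sq
  simp only [e2, ← norm_freq_sq, EuclideanSpace.norm_sq_eq, Real.norm_eq_abs, sq_abs]
  rw [← Finset.sum_mul]
  push_cast
  simp

theorem dualNormSq_eq_zero {a b c : ℝ} (ha : 0 < a) (hb : 0 < b) (hc : 0 < c) {k : Fin 3 → ℤ}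
    (h : dualNormSq a b c k = 0) : k = 0 := by
  funext i
  have := sq_coord_le ha hb hc k i
  rw [h, mul_zero] at this
  have h2 : (k i : ℝ) = 0 := by
    exact pow_eq_zero_iff (two_ne_zero) |>.mp (le_antisymm this (sq_nonneg _))
  exact_mod_cast h2

theorem integral_wave {a b c : ℝ} (ha : 0 < a) (hb : 0 < b) (hc : 0 < c) (k : Fin 3 → ℤ) :
    ∫ x in cell a b c, wave a b c k x = if k = 0 then (cellVol a b c : ℂ) else 0 := by
  split_ifs with h
  · subst h
    simp only [wave_zero]
    simp [Measure.real, volume_cell ha hb hc, (cellVol_pos ha hb hc).le]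
  · have h1 := (isSmoothOnTorus_wave ha hb hc k).integral_fderiv ha hb hc (freq a b c k)
    simp only [fderiv_wave, real_inner_self_eq_norm_sq, norm_freq_sq] at h1
    rw [integral_mul_const] at h1
    rcases mul_eq_zero.mp h1 with h2 | h2
    · exact h2
    · rcases mul_eq_zero.mp h2 with h3 | h3
      · exact absurd (dualNormSq_eq_zero ha hb hc (Complex.ofReal_eq_zero.mp h3)) h
      · exact absurd h3 Complex.I_ne_zero

theorem coeff_wave {a b c : ℝ} (ha : 0 < a) (hb : 0 < b) (hc : 0 < c) (l k : Fin 3 → ℤ) :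
    coeff a b c (wave a b c l) k = if l = k then (cellVol a b c : ℂ) else 0 := by
  simp only [coeff, ← wave_add, integral_wave ha hb hc, add_neg_eq_zero]

/-! ### Absolutely convergent Fourier series -/

section Series

variable {a b c : ℝ} {d : (Fin 3 → ℤ) → ℂ}

theorem summable_mul_wave (a b c : ℝ) (hd : Summable fun k => ‖d k‖) (x : E3) :
    Summable fun k => d k * wave a b c k x :=
  Summable.of_norm (by simpa only [norm_mul, norm_wave, mul_one] using hd)

theorem continuous_tsum_wave (a b c : ℝ) (hd : Summable fun k => ‖d k‖) :
    Continuous fun x => ∑' k, d k * wave a b c k x :=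
  continuous_tsum (fun k => continuous_const.mul (continuous_wave a b c k)) hd
    fun k x => by rw [norm_mul, norm_wave, mul_one]

theorem isTorusFunction_tsum_wave (ha : 0 < a) (hb : 0 < b) (hc : 0 < c)
    (d : (Fin 3 → ℤ) → ℂ) : IsTorusFunction a b c fun x => ∑' k, d k * wave a b c k x := by
  intro l hl x
  have : ∀ k, wave a b c k (x + (2 * Real.pi) • l) = wave a b c k x :=
    fun k => (isSmoothOnTorus_wave ha hb hc k).1 l hl x
  simp only [this]

/-- Termwise integration of a bounded function against an absolutely convergent trigonometric
series. -/
theorem hasSum_integral_tsum_wave (hd : Summable fun k => ‖d k‖) {g : E3 → ℂ}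
    (hg : Integrable g (volume.restrict (cell a b c))) :
    HasSum (fun k => d k * ∫ x in cell a b c, wave a b c k x * g x)
      (∫ x in cell a b c, (∑' k, d k * wave a b c k x) * g x) := by
  have h := hasSum_integral_of_summable_integral_norm (μ := volume.restrict (cell a b c))
    (F := fun k x => d k * (wave a b c k x * g x)) (fun k => ?_) ?_
  · simp only [integral_const_mul] at h
    convert! h using 1
    congr 1
    funext x
    rw [← tsum_mul_right]
    simp only [mul_assoc]
  · simp_rw [mul_comm _ (g _)]
    exact (integrable_mul_wave hg k).const_mul _
  · simp only [norm_mul, norm_wave, one_mul, integral_const_mul]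
    exact hd.mul_right _

theorem coeff_tsum_wave (ha : 0 < a) (hb : 0 < b) (hc : 0 < c) (hd : Summable fun k => ‖d k‖)
    (l : Fin 3 → ℤ) :
    coeff a b c (fun x => ∑' k, d k * wave a b c k x) l = cellVol a b c * d l := by
  have h := hasSum_integral_tsum_wave (a := a) (b := b) (c := c) hd
    (g := wave a b c (-l)) (integrable_of_continuous ha hb hc
      (isSmoothOnTorus_wave ha hb hc (-l)).1 (continuous_wave a b c _))
  have e : ∀ k, d k * ∫ x in cell a b c, wave a b c k x * wave a b c (-l) x =
      if k = l then cellVol a b c * d l else 0 := by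
    intro k
    have := coeff_wave ha hb hc k l
    rw [coeff] at this
    rw [this]
    split_ifs with h
    · rw [h, mul_comm]
    · rw [mul_zero]
  simp only [e] at h
  exact h.unique (hasSum_ite_eq l _)

end Series

/-- Since `f - Δf` is in `L²`, the sequence `(1 + n) |coeff f|` is square summable, and so is `1 /
(1 + n)` in dimension three; their product is summable. -/
theorem IsSmoothOnTorus.summable_norm_coeff {a b c : ℝ} (ha : 0 < a) (hb : 0 < b) (hc : 0 < c)
    {f : E3 → ℂ} (hf : IsSmoothOnTorus a b c f) : Summable fun k => ‖coeff a b c f k‖ := by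
  have hl := hf.laplacian
  have hi := integrable_of_continuous ha hb hc hf.1 hf.2.continuous
  have hil := integrable_of_continuous ha hb hc hl.1 hl.2.continuous
  have hs := hasSum_norm_coeff_sq ha hb hc (f := fun x => f x + (-1) * Laplacian.laplacian f x)
    ((memLp_of_continuous ha hb hc hf.1 hf.2.continuous 2).add
      ((memLp_of_continuous ha hb hc hl.1 hl.2.continuous 2).const_mul (-1)))
  have e : ∀ k, ‖coeff a b c (fun x => f x + (-1) * Laplacian.laplacian f x) k‖ =
      (1 + dualNormSq a b c k) * ‖coeff a b c f k‖ := by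
    intro k
    rw [coeff_add hi (hil.const_mul _), coeff_const_mul, coeff_laplacian ha hb hc hf]
    have : coeff a b c f k + -1 * (-(dualNormSq a b c k : ℂ) * coeff a b c f k) =
        ((1 + dualNormSq a b c k : ℝ) : ℂ) * coeff a b c f k := by
      push_cast; ring
    rw [this, norm_mul, Complex.norm_real, Real.norm_of_nonneg]
    linarith [dualNormSq_nonneg a b c k]
  simp only [e] at hs
  refine Summable.of_nonneg_of_le (fun k => norm_nonneg _) (fun k => ?_)
    ((summable_inv_one_add_dualNormSq_sq ha hb hc).add hs.summable)
  have hn := dualNormSq_nonneg a b c k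
  set n := dualNormSq a b c k
  set z := ‖coeff a b c f k‖
  have h1 : z = (1 / (1 + n)) * ((1 + n) * z) := by field_simp
  have h2 : 1 / (1 + n) ^ 2 = (1 / (1 + n)) ^ 2 := by rw [div_pow, one_pow]
  rw [h2]
  nlinarith [sq_nonneg (1 / (1 + n) - (1 + n) * z), sq_nonneg (1 / (1 + n)), sq_nonneg ((1 + n) * z)]

/-- A smooth function on the torus is the sum of its Fourier series. -/
theorem IsSmoothOnTorus.hasSum_coeff {a b c : ℝ} (ha : 0 < a) (hb : 0 < b) (hc : 0 < c)
    {f : E3 → ℂ} (hf : IsSmoothOnTorus a b c f) (x : E3) :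
    HasSum (fun k => (cellVol a b c : ℂ)⁻¹ * coeff a b c f k * wave a b c k x) (f x) := by
  have hV : (cellVol a b c : ℂ) ≠ 0 := Complex.ofReal_ne_zero.mpr (cellVol_pos ha hb hc).ne'
  have hd : Summable fun k => ‖(cellVol a b c : ℂ)⁻¹ * coeff a b c f k‖ := by
    simp only [norm_mul]
    exact (hf.summable_norm_coeff ha hb hc).mul_left _
  have ht := isTorusFunction_tsum_wave ha hb hc
    (fun k => (cellVol a b c : ℂ)⁻¹ * coeff a b c f k)
  have hcont := continuous_tsum_wave a b c hd
  have h := ae_eq_of_coeff_eq ha hb hc (memLp_of_continuous ha hb hc hf.1 hf.2.continuous 2)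
    (memLp_of_continuous ha hb hc ht hcont 2) (fun k => by
      rw [coeff_tsum_wave ha hb hc hd, mul_inv_cancel_left₀ hV])
  have h2 := ae_eq_of_restrict_cell ha hb hc hf.1 ht h
  have h3 := (Continuous.ae_eq_iff_eq volume hf.2.continuous hcont).mp h2
  have h4 := (summable_mul_wave a b c hd x).hasSum
  rwa [← congrFun h3 x] at h4

/-! ### The Yukawa potential on `ℝ³` -/

/-- The weight in the representation of the Yukawa potential as a mixture of Gaussians. -/
noncomputable def yukawaWeight (s : ℝ) : ℝ := s ^ (-(1 / 2) : ℝ) * Real.exp (-s⁻¹)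

/-- The Yukawa potential, i.e. the fundamental solution of `1 - Δ` on `ℝ³`. -/
noncomputable def yukawa (x : E3) : ℝ :=
  (4 * Real.pi) ^ (-(3 / 2) : ℝ) *
    ∫ s in Ioi (0 : ℝ), yukawaWeight s * Real.exp (-(‖x‖ ^ 2 / 4 * s))

/-- The difference of the Coulomb and the Yukawa potential. -/
noncomputable def yukawaDefect (x : E3) : ℝ :=
  (4 * Real.pi) ^ (-(3 / 2) : ℝ) *
    ∫ s in Ioi (0 : ℝ), (s ^ (-(1 / 2) : ℝ) * (1 - Real.exp (-s⁻¹))) *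
      Real.exp (-(‖x‖ ^ 2 / 4 * s))

theorem yukawaWeight_nonneg {s : ℝ} (hs : 0 < s) : 0 ≤ yukawaWeight s := by
  unfold yukawaWeight; positivity

theorem measurable_yukawaWeight : Measurable yukawaWeight := by
  unfold yukawaWeight; fun_prop

/-- The square of the weight is `s⁻¹ exp(-2/s)`, and `exp(2/s) ≥ s⁻³`. A linear bound near `s = 0`
translates into decay of order `|x|⁻⁴`, which suffices for summation over the lattice. -/
theorem yukawaWeight_le {s : ℝ} (hs : 0 < s) : yukawaWeight s ≤ s := by
  refine abs_le_of_sq_le_sq' ?_ hs.le |>.2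
  have h1 : yukawaWeight s ^ 2 = s⁻¹ * (Real.exp (2 * s⁻¹))⁻¹ := by
    rw [yukawaWeight, mul_pow, ← Real.rpow_natCast, ← Real.rpow_mul hs.le, ← Real.exp_nat_mul,
      ← Real.exp_neg]
    norm_num
    rw [Real.rpow_neg_one]
  have h2 := Real.pow_div_factorial_le_exp (2 * s⁻¹) (by positivity) 3
  have h3 : (s⁻¹) ^ 3 ≤ Real.exp (2 * s⁻¹) := by
    refine le_trans ?_ h2
    have h3 : (0 : ℝ) < s⁻¹ ^ 3 := by positivity
    have h4 : (2 * s⁻¹) ^ 3 / ((Nat.factorial 3 : ℕ) : ℝ) = 8 / 6 * s⁻¹ ^ 3 := by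
      simp only [Nat.factorial]
      push_cast
      ring
    rw [h4]
    linarith
  rw [h1]
  calc s⁻¹ * (Real.exp (2 * s⁻¹))⁻¹ ≤ s⁻¹ * ((s⁻¹) ^ 3)⁻¹ := by gcongr
    _ = s ^ 2 := by field_simp

theorem integrableOn_rpow_mul_exp {p r : ℝ} (hp : -1 < p) (hr : 0 < r) :
    IntegrableOn (fun s : ℝ => s ^ p * Real.exp (-(r * s))) (Ioi 0) := by
  have := integrableOn_rpow_mul_exp_neg_mul_rpow hp zero_lt_one hr
  simpa only [Real.rpow_one, neg_mul] using this

/-- Without the factor `exp(-1/s)` the mixture of Gaussians is a Gamma integral with value `Γ(1/2) =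
√π` up to scaling. -/
theorem coulomb_eq {x : E3} (hx : x ≠ 0) : (4 * Real.pi) ^ (-(3 / 2) : ℝ) *
    ∫ s in Ioi (0 : ℝ), s ^ (-(1 / 2) : ℝ) * Real.exp (-(‖x‖ ^ 2 / 4 * s)) =
      1 / (4 * Real.pi * ‖x‖) := by
  have hpi := Real.pi_pos
  have hx' : 0 < ‖x‖ := norm_pos_iff.mpr hx
  have h := Real.integral_rpow_mul_exp_neg_mul_Ioi (a := 1 / 2) (r := ‖x‖ ^ 2 / 4) (by norm_num)
    (by positivity)
  norm_num at h
  have hq : (4 / ‖x‖ ^ 2) ^ (1 / 2 : ℝ) = 2 / ‖x‖ := by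
    rw [← Real.sqrt_eq_rpow, Real.sqrt_div (by norm_num), Real.sqrt_sq hx'.le,
      show (4 : ℝ) = 2 ^ 2 by norm_num, Real.sqrt_sq (by norm_num)]
  have h4 : (4 * Real.pi) ^ (-(3 / 2) : ℝ) = 1 / (4 * Real.pi * (2 * Real.sqrt Real.pi)) := by
    rw [Real.rpow_neg (by positivity), show (3 / 2 : ℝ) = 1 + 1 / 2 by norm_num,
      Real.rpow_add (by positivity), Real.rpow_one, ← Real.sqrt_eq_rpow, Real.sqrt_mul (by norm_num),
      show (4 : ℝ) = 2 ^ 2 by norm_num, Real.sqrt_sq (by norm_num)]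
    field_simp
  have hs : 0 < Real.sqrt Real.pi := Real.sqrt_pos.mpr hpi
  rw [h, hq, h4, Real.Gamma_one_half_eq]
  field_simp

/-- The weight is at most `s^(-1/2)` near zero and `s^(-3/2)` at infinity, since `1 - exp(-1/s) ≤
1/s`. Hence the defect is continuous even at the origin, and the Yukawa singularity is exactly the
Coulomb one. -/
theorem integrableOn_defect_weight :
    IntegrableOn (fun s : ℝ => s ^ (-(1 / 2) : ℝ) * (1 - Real.exp (-s⁻¹))) (Ioi 0) := by
  rw [← Ioc_union_Ioi_eq_Ioi zero_le_one, integrableOn_union]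
  have hm : Measurable fun s : ℝ => s ^ (-(1 / 2) : ℝ) * (1 - Real.exp (-s⁻¹)) := by fun_prop
  constructor
  · have h1 : IntegrableOn (fun s : ℝ => s ^ (-(1 / 2) : ℝ)) (Ioc 0 1) :=
      (intervalIntegrable_iff_integrableOn_Ioc_of_le zero_le_one).mp
        (intervalIntegral.intervalIntegrable_rpow' (by norm_num))
    refine h1.mono' hm.aestronglyMeasurable ?_
    refine (ae_restrict_iff' measurableSet_Ioc).mpr (Eventually.of_forall fun s hs => ?_)
    have h2 : Real.exp (-s⁻¹) ≤ 1 := Real.exp_le_one_iff.mpr (by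
      have := inv_pos.mpr hs.1; linarith)
    have h3 := Real.exp_pos (-s⁻¹)
    have h4 : 0 ≤ s ^ (-(1 / 2) : ℝ) := Real.rpow_nonneg hs.1.le _
    rw [Real.norm_of_nonneg (mul_nonneg h4 (by linarith))]
    nlinarith
  · have h1 : IntegrableOn (fun s : ℝ => s ^ (-(3 / 2) : ℝ)) (Ioi 1) :=
      integrableOn_Ioi_rpow_of_lt (by norm_num) zero_lt_one
    refine h1.mono' hm.aestronglyMeasurable ?_
    refine (ae_restrict_iff' measurableSet_Ioi).mpr (Eventually.of_forall fun s hs => ?_)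
    have hs0 : 0 < s := zero_lt_one.trans hs
    have h2 : Real.exp (-s⁻¹) ≤ 1 := Real.exp_le_one_iff.mpr (by
      have := inv_pos.mpr hs0; linarith)
    have h3 := Real.add_one_le_exp (-s⁻¹)
    have h4 : 0 ≤ s ^ (-(1 / 2) : ℝ) := Real.rpow_nonneg hs0.le _
    rw [Real.norm_of_nonneg (mul_nonneg h4 (by linarith)),
      show (-(3 / 2) : ℝ) = -(1 / 2) + -1 by norm_num, Real.rpow_add hs0, Real.rpow_neg_one]
    exact mul_le_mul_of_nonneg_left (by linarith) h4

theorem continuous_yukawaDefect : Continuous yukawaDefect := by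
  refine continuous_const.mul (continuous_of_dominated
    (bound := fun s : ℝ => ‖s ^ (-(1 / 2) : ℝ) * (1 - Real.exp (-s⁻¹))‖) (fun x => ?_) (fun x => ?_)
    integrableOn_defect_weight.norm ?_)
  · have : Measurable fun s : ℝ => (s ^ (-(1 / 2) : ℝ) * (1 - Real.exp (-s⁻¹))) *
      Real.exp (-(‖x‖ ^ 2 / 4 * s)) := by fun_prop
    exact this.aestronglyMeasurable
  · refine (ae_restrict_iff' measurableSet_Ioi).mpr (Eventually.of_forall fun s hs => ?_)
    rw [norm_mul, Real.norm_of_nonneg (Real.exp_pos _).le]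
    refine mul_le_of_le_one_right (norm_nonneg _) (Real.exp_le_one_iff.mpr ?_)
    have : 0 < s := hs
    have : 0 ≤ ‖x‖ ^ 2 / 4 * s := by positivity
    linarith
  · exact Eventually.of_forall fun s => by fun_prop

theorem integrableOn_yukawa {x : E3} (hx : x ≠ 0) :
    IntegrableOn (fun s => yukawaWeight s * Real.exp (-(‖x‖ ^ 2 / 4 * s))) (Ioi 0) := by
  have hx' : 0 < ‖x‖ := norm_pos_iff.mpr hx
  have h1 := integrableOn_rpow_mul_exp (p := 1) (r := ‖x‖ ^ 2 / 4) (by norm_num) (by positivity)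
  have hm : Measurable fun s : ℝ => yukawaWeight s * Real.exp (-(‖x‖ ^ 2 / 4 * s)) :=
    measurable_yukawaWeight.mul (by fun_prop)
  refine h1.mono' hm.aestronglyMeasurable ?_
  refine (ae_restrict_iff' measurableSet_Ioi).mpr (Eventually.of_forall fun s hs => ?_)
  rw [Real.rpow_one, Real.norm_of_nonneg (mul_nonneg (yukawaWeight_nonneg hs) (Real.exp_pos _).le)]
  exact mul_le_mul_of_nonneg_right (yukawaWeight_le hs) (Real.exp_pos _).le

theorem yukawa_eq {x : E3} (hx : x ≠ 0) :
    yukawa x = 1 / (4 * Real.pi * ‖x‖) - yukawaDefect x := by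
  have hx' : 0 < ‖x‖ := norm_pos_iff.mpr hx
  rw [← coulomb_eq hx, yukawaDefect, yukawa, ← mul_sub, ← integral_sub]
  · congr 1
    refine setIntegral_congr_fun measurableSet_Ioi fun s _ => ?_
    simp only [yukawaWeight]
    ring
  · exact integrableOn_rpow_mul_exp (by norm_num) (by positivity)
  · have h1 := (integrableOn_rpow_mul_exp (p := -(1 / 2)) (r := ‖x‖ ^ 2 / 4) (by norm_num)
      (by positivity)).sub (integrableOn_yukawa hx)
    refine h1.congr_fun (fun s _ => ?_) measurableSet_Ioi
    simp only [yukawaWeight, Pi.sub_apply]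
    ring

theorem yukawa_nonneg (x : E3) : 0 ≤ yukawa x :=
  mul_nonneg (by have := Real.pi_pos; positivity) (setIntegral_nonneg measurableSet_Ioi fun s hs =>
    mul_nonneg (yukawaWeight_nonneg hs) (Real.exp_pos _).le)

theorem yukawaDefect_nonneg (x : E3) : 0 ≤ yukawaDefect x := by
  refine mul_nonneg (by have := Real.pi_pos; positivity)
    (setIntegral_nonneg measurableSet_Ioi fun s hs => mul_nonneg (mul_nonneg
      (Real.rpow_nonneg (le_of_lt hs) _) (sub_nonneg.mpr (Real.exp_le_one_iff.mpr ?_)))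
        (Real.exp_pos _).le)
  have : 0 < s⁻¹ := inv_pos.mpr hs
  linarith

theorem yukawa_le {x : E3} (hx : x ≠ 0) : yukawa x ≤ 1 / (4 * Real.pi * ‖x‖) := by
  rw [yukawa_eq hx]
  linarith [yukawaDefect_nonneg x]

theorem yukawa_le_pow {x : E3} (hx : x ≠ 0) : yukawa x ≤ 16 / ‖x‖ ^ 4 := by
  have hpi := Real.pi_gt_three
  have hx' : 0 < ‖x‖ := norm_pos_iff.mpr hx
  have h := Real.integral_rpow_mul_exp_neg_mul_Ioi (a := 2) (r := ‖x‖ ^ 2 / 4) (by norm_num)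
    (by positivity)
  have e : (1 / (‖x‖ ^ 2 / 4)) ^ (2 : ℝ) * Real.Gamma 2 = 16 / ‖x‖ ^ 4 := by
    rw [Real.Gamma_two, show (2 : ℝ) = (2 : ℕ) by norm_num, Real.rpow_natCast]
    field_simp
    norm_num
  rw [e] at h
  have h1 : (4 * Real.pi) ^ (-(3 / 2) : ℝ) ≤ 1 :=
    Real.rpow_le_one_of_one_le_of_nonpos (by linarith) (by norm_num)
  have h2 : ∫ s in Ioi (0 : ℝ), yukawaWeight s * Real.exp (-(‖x‖ ^ 2 / 4 * s)) ≤ 16 / ‖x‖ ^ 4 := by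
    rw [← h]
    have h3 := integrableOn_rpow_mul_exp (p := 2 - 1) (r := ‖x‖ ^ 2 / 4) (by norm_num)
      (by positivity)
    refine setIntegral_mono_on (integrableOn_yukawa hx) h3 measurableSet_Ioi fun s hs => ?_
    rw [show (2 - 1 : ℝ) = 1 by norm_num, Real.rpow_one]
    exact mul_le_mul_of_nonneg_right (yukawaWeight_le hs) (Real.exp_pos _).le
  have h4 : 0 ≤ ∫ s in Ioi (0 : ℝ), yukawaWeight s * Real.exp (-(‖x‖ ^ 2 / 4 * s)) :=
    setIntegral_nonneg measurableSet_Ioi fun s hs =>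
      mul_nonneg (yukawaWeight_nonneg hs) (Real.exp_pos _).le
  calc yukawa x ≤ 1 * (16 / ‖x‖ ^ 4) := by
        unfold yukawa
        exact mul_le_mul h1 h2 h4 zero_le_one
    _ = _ := one_mul _

theorem integrableOn_sq_mul_exp_neg_inv {A : ℝ} (hA : 0 < A) :
    IntegrableOn (fun s : ℝ => s ^ (-2 : ℝ) * Real.exp (-(A * s⁻¹))) (Ioi 0) := by
  have h := (integrableOn_Ioi_comp_rpow_iff' (fun y => Real.exp (-(A * y)))
    (p := -1) (by norm_num)).mpr (by simpa using integrableOn_rpow_mul_exp (p := 0) (by norm_num) hA)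
  simpa [Real.rpow_neg_one, show (-1 - 1 : ℝ) = -2 by norm_num] using h

theorem integral_sq_mul_exp_neg_inv {A : ℝ} (hA : 0 < A) :
    ∫ s in Ioi (0 : ℝ), s ^ (-2 : ℝ) * Real.exp (-(A * s⁻¹)) = 1 / A := by
  have h := integral_comp_rpow_Ioi (fun y => Real.exp (-(A * y))) (p := -1) (by norm_num)
  have h2 := Real.integral_rpow_mul_exp_neg_mul_Ioi (a := 1) (r := A) (by norm_num) hA
  simp only [sub_self, Real.rpow_zero, one_mul, Real.rpow_one, Real.Gamma_one, mul_one] at h2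
  rw [h2] at h
  simpa [Real.rpow_neg_one, show (-1 - 1 : ℝ) = -2 by norm_num] using h

/-- The Fourier transform of a Gaussian at a point of the dual lattice. -/
theorem integral_exp_mul_wave (a b c : ℝ) (k : Fin 3 → ℤ) {s : ℝ} (hs : 0 < s) :
    ∫ x : E3, (Real.exp (-(‖x‖ ^ 2 / 4 * s)) : ℂ) * wave a b c k x =
      (((4 * Real.pi) ^ (3 / 2 : ℝ) * s ^ (-(3 / 2) : ℝ) *
        Real.exp (-(dualNormSq a b c k * s⁻¹)) : ℝ) : ℂ) := by
  have hpi := Real.pi_pos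
  have h := GaussianFourier.integral_cexp_neg_mul_sq_norm_add (V := E3) (b := ((s / 4 : ℝ) : ℂ))
    (by rw [Complex.ofReal_re]; positivity) Complex.I (freq a b c k)
  have e1 : ∀ x : E3, (Real.exp (-(‖x‖ ^ 2 / 4 * s)) : ℂ) * wave a b c k x =
      Complex.exp (-((s / 4 : ℝ) : ℂ) * ‖x‖ ^ 2 + Complex.I * (inner ℝ (freq a b c k) x : ℝ)) := by
    intro x
    rw [wave, Complex.ofReal_exp, ← Complex.exp_add]
    congr 1
    push_cast
    ring
  simp only [e1]
  rw [h]
  have e2 : (Real.pi : ℂ) / ((s / 4 : ℝ) : ℂ) = ((4 * Real.pi * s⁻¹ : ℝ) : ℂ) := by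
    push_cast; field_simp
  have e3 : ((Module.finrank ℝ E3 : ℕ) : ℂ) / 2 = ((3 / 2 : ℝ) : ℂ) := by
    simp
  rw [e2, e3, ← Complex.ofReal_cpow (by positivity), Real.mul_rpow (by positivity) (by positivity),
    Real.inv_rpow hs.le, ← Real.rpow_neg hs.le]
  have e4 : Complex.I ^ 2 * (‖freq a b c k‖ : ℂ) ^ 2 / (4 * ((s / 4 : ℝ) : ℂ)) =
      ((-(dualNormSq a b c k * s⁻¹) : ℝ) : ℂ) := by
    rw [← Complex.ofReal_pow, norm_freq_sq, Complex.I_sq]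
    push_cast
    field_simp
  rw [e4, ← Complex.ofReal_exp]
  push_cast
  ring

theorem integrable_exp_neg_sq {s : ℝ} (hs : 0 < s) :
    Integrable fun x : E3 => Real.exp (-(‖x‖ ^ 2 / 4 * s)) := by
  have h := GaussianFourier.integrable_cexp_neg_mul_sq_norm_add (V := E3) (b := ((s / 4 : ℝ) : ℂ))
    (by rw [Complex.ofReal_re]; positivity) 0 0
  have h2 := h.norm
  refine h2.congr (Eventually.of_forall fun x => ?_)
  simp only [Complex.norm_exp]
  congr 1
  simp [← Complex.ofReal_pow]
  norm_cast
  ring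

theorem integral_exp_neg_sq {s : ℝ} (hs : 0 < s) :
    ∫ x : E3, Real.exp (-(‖x‖ ^ 2 / 4 * s)) = (4 * Real.pi) ^ (3 / 2 : ℝ) * s ^ (-(3 / 2) : ℝ) := by
  have h := integral_exp_mul_wave 1 1 1 0 hs
  simp only [wave_zero, mul_one, dualNormSq_zero, zero_mul, neg_zero, Real.exp_zero] at h
  have e : ∫ x : E3, (Real.exp (-(‖x‖ ^ 2 / 4 * s)) : ℂ) =
      ((∫ x : E3, Real.exp (-(‖x‖ ^ 2 / 4 * s)) : ℝ) : ℂ) := integral_ofReal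
  rw [e] at h
  exact_mod_cast h

theorem yukawaWeight_mul_rpow {s : ℝ} (hs : 0 < s) :
    yukawaWeight s * s ^ (-(3 / 2) : ℝ) = s ^ (-2 : ℝ) * Real.exp (-s⁻¹) := by
  rw [yukawaWeight, mul_right_comm, ← Real.rpow_add hs]
  norm_num

theorem integrable_yukawa_prod :
    Integrable (fun p : ℝ × E3 => yukawaWeight p.1 * Real.exp (-(‖p.2‖ ^ 2 / 4 * p.1)))
      ((volume.restrict (Ioi 0)).prod volume) := by
  have hm : Measurable fun p : ℝ × E3 => yukawaWeight p.1 * Real.exp (-(‖p.2‖ ^ 2 / 4 * p.1)) :=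
    (measurable_yukawaWeight.comp measurable_fst).mul (by fun_prop)
  rw [integrable_prod_iff hm.aestronglyMeasurable]
  constructor
  · exact (ae_restrict_iff' measurableSet_Ioi).mpr (Eventually.of_forall fun s hs =>
      (integrable_exp_neg_sq hs).const_mul (yukawaWeight s))
  · have h := (integrableOn_sq_mul_exp_neg_inv one_pos).const_mul ((4 * Real.pi) ^ (3 / 2 : ℝ))
    refine IntegrableOn.congr_fun h (fun s hs => ?_) measurableSet_Ioi
    simp only [norm_mul, Real.norm_of_nonneg (Real.exp_pos _).le,
      Real.norm_of_nonneg (yukawaWeight_nonneg hs)]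
    rw [integral_const_mul, integral_exp_neg_sq hs, mul_left_comm (yukawaWeight s),
      yukawaWeight_mul_rpow hs, one_mul]

theorem integrable_yukawa : Integrable yukawa :=
  (integrable_yukawa_prod.integral_prod_right).const_mul _

theorem four_pi_rpow_mul : (4 * Real.pi) ^ (-(3 / 2) : ℝ) * (4 * Real.pi) ^ (3 / 2 : ℝ) = 1 := by
  have hpi := Real.pi_pos
  rw [← Real.rpow_add (by positivity)]
  norm_num

/-- The Fourier transform of the Yukawa potential. -/
theorem integral_yukawa_mul_wave (a b c : ℝ) (k : Fin 3 → ℤ) :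
    ∫ x : E3, (yukawa x : ℂ) * wave a b c k x = ((1 / (1 + dualNormSq a b c k) : ℝ) : ℂ) := by
  have hn := dualNormSq_nonneg a b c k
  have hint : Integrable (fun p : ℝ × E3 =>
      ((yukawaWeight p.1 * Real.exp (-(‖p.2‖ ^ 2 / 4 * p.1)) : ℝ) : ℂ) * wave a b c k p.2)
      ((volume.restrict (Ioi 0)).prod volume) :=
    integrable_yukawa_prod.ofReal.mul_bdd (c := 1)
      ((continuous_wave a b c k).comp continuous_snd).aestronglyMeasurable
      (Eventually.of_forall fun p => (norm_wave a b c k _).le)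
  have e1 : ∀ x : E3, (yukawa x : ℂ) * wave a b c k x =
      ((4 * Real.pi) ^ (-(3 / 2) : ℝ) : ℝ) * ∫ s in Ioi (0 : ℝ),
        ((yukawaWeight s * Real.exp (-(‖x‖ ^ 2 / 4 * s)) : ℝ) : ℂ) * wave a b c k x := by
    intro x
    rw [integral_mul_const, yukawa, Complex.ofReal_mul, mul_assoc]
    congr 2
    exact integral_ofReal.symm
  simp only [e1]
  rw [integral_const_mul, ← integral_integral_swap hint]
  have e2 : ∀ s ∈ Ioi (0 : ℝ), ∫ x : E3,
      ((yukawaWeight s * Real.exp (-(‖x‖ ^ 2 / 4 * s)) : ℝ) : ℂ) * wave a b c k x =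
      (((4 * Real.pi) ^ (3 / 2 : ℝ) *
        (s ^ (-2 : ℝ) * Real.exp (-((1 + dualNormSq a b c k) * s⁻¹))) : ℝ) : ℂ) := by
    intro s hs
    simp only [Complex.ofReal_mul, mul_assoc]
    rw [integral_const_mul]
    have := integral_exp_mul_wave a b c k hs
    rw [this, ← Complex.ofReal_mul, ← Complex.ofReal_mul, ← Complex.ofReal_mul]
    congr 1
    rw [show -((1 + dualNormSq a b c k) * s⁻¹) = -s⁻¹ + -(dualNormSq a b c k * s⁻¹) by ring,
      Real.exp_add]
    linear_combination ((4 * Real.pi) ^ (3 / 2 : ℝ) * Real.exp (-(dualNormSq a b c k * s⁻¹))) *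
      yukawaWeight_mul_rpow hs
  rw [setIntegral_congr_fun measurableSet_Ioi e2]
  have e3 : ∫ s in Ioi (0 : ℝ), (((4 * Real.pi) ^ (3 / 2 : ℝ) *
        (s ^ (-2 : ℝ) * Real.exp (-((1 + dualNormSq a b c k) * s⁻¹))) : ℝ) : ℂ) =
      ((∫ s in Ioi (0 : ℝ), (4 * Real.pi) ^ (3 / 2 : ℝ) *
        (s ^ (-2 : ℝ) * Real.exp (-((1 + dualNormSq a b c k) * s⁻¹))) : ℝ) : ℂ) := integral_ofReal
  rw [e3, integral_const_mul, integral_sq_mul_exp_neg_inv (by linarith), ← Complex.ofReal_mul,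
    ← mul_assoc, four_pi_rpow_mul, one_mul]

/-- The Yukawa potential is locally square integrable. -/
theorem integrableOn_yukawa_sq {R : ℝ} :
    IntegrableOn (fun x => yukawa x ^ 2) (Metric.ball 0 R) := by
  have h : IntegrableOn (fun x : E3 => (1 / ‖x‖) ^ 2) (Metric.ball 0 R) := by
    -- In polar coordinates the Jacobian `r²` cancels the square of the singularity.
    rw [integrableOn_fun_norm_addHaar volume (f := fun r => (1 / r) ^ 2)]
    have : IntegrableOn (fun _ : ℝ => (1 : ℝ)) (Ioo 0 R) := by simp
    refine this.congr_fun (fun r hr => ?_) measurableSet_Ioo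
    have : r ≠ 0 := hr.1.ne'
    simp
    field_simp
  refine Integrable.mono' h (integrable_yukawa.aestronglyMeasurable.restrict.pow 2) ?_
  refine ae_restrict_of_ae ?_
  filter_upwards [Measure.ae_ne volume (0 : E3)] with x hx
  have hx' : 0 < ‖x‖ := norm_pos_iff.mpr hx
  rw [Real.norm_of_nonneg (sq_nonneg _)]
  refine pow_le_pow_left₀ (yukawa_nonneg x) ((yukawa_le hx).trans ?_) 2
  refine one_div_le_one_div_of_le hx' ?_
  nlinarith [Real.pi_gt_three]

/-! ### Periodization of the Yukawa potential -/

/-- The periodization of the Yukawa potential. -/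
noncomputable def periodicYukawa (a b c : ℝ) (x : E3) : ℝ :=
  ∑' m : Fin 3 → ℤ, yukawa (x + (2 * Real.pi) • latticeVec a b c m)

theorem latticeVec_add (a b c : ℝ) (m l : Fin 3 → ℤ) :
    latticeVec a b c (m + l) = latticeVec a b c m + latticeVec a b c l := by
  ext i; fin_cases i <;> simp [latticeVec, add_mul]

theorem latticeVec_zero (a b c : ℝ) : latticeVec a b c 0 = 0 := by
  ext i; fin_cases i <;> simp [latticeVec]

theorem latticeVec_injective {a b c : ℝ} (ha : 0 < a) (hb : 0 < b) (hc : 0 < c) :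
    Function.Injective (latticeVec a b c) := by
  intro m l h
  have h0 : m 0 * a = l 0 * a := congrArg (fun v : E3 => v 0) h
  have h1 : m 1 * b = l 1 * b := congrArg (fun v : E3 => v 1) h
  have h2 : m 2 * c = l 2 * c := congrArg (fun v : E3 => v 2) h
  funext i
  fin_cases i
  · exact_mod_cast mul_right_cancel₀ ha.ne' h0
  · exact_mod_cast mul_right_cancel₀ hb.ne' h1
  · exact_mod_cast mul_right_cancel₀ hc.ne' h2

theorem torusMk_latticeVec {a b c : ℝ} (ha : 0 < a) (hb : 0 < b) (hc : 0 < c) (m : Fin 3 → ℤ) :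
    torusMk a b c ((2 * Real.pi) • latticeVec a b c m) = 0 := by
  have hpi := Real.pi_pos
  have h : ∀ (n : ℤ) (L : ℝ), 0 < L →
      ((2 * Real.pi * (n * L) / (2 * Real.pi * L) : ℝ) : UnitAddCircle) = 0 := by
    intro n L hL
    rw [show 2 * Real.pi * (n * L) / (2 * Real.pi * L) = (n : ℝ) by field_simp]
    exact (AddCircle.coe_eq_zero_iff 1).mpr ⟨n, by simp⟩
  funext i
  fin_cases i
  · exact h (m 0) a ha
  · exact h (m 1) b hb
  · exact h (m 2) c hc

theorem periodicYukawa_add (a b c : ℝ) (l : Fin 3 → ℤ) (x : E3) :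
    periodicYukawa a b c (x + (2 * Real.pi) • latticeVec a b c l) = periodicYukawa a b c x := by
  unfold periodicYukawa
  rw [← (Equiv.addLeft l).tsum_eq fun m => yukawa (x + (2 * Real.pi) • latticeVec a b c m)]
  refine tsum_congr fun m => ?_
  rw [Equiv.coe_addLeft, latticeVec_add, smul_add, add_assoc]

/-- Unfolding of an integral over `ℝ³` into integrals over the cell. -/
theorem hasSum_integral_cell {E : Type*} [NormedAddCommGroup E] [NormedSpace ℝ E] {a b c : ℝ}
    (ha : 0 < a) (hb : 0 < b) (hc : 0 < c) {g : E3 → E} (hg : Integrable g) :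
    HasSum (fun m => ∫ x in cell a b c, g (x + (2 * Real.pi) • latticeVec a b c m)) (∫ x, g x) := by
  set S : (Fin 3 → ℤ) → Set E3 := fun m =>
    (fun x => x + -((2 * Real.pi) • latticeVec a b c m)) ⁻¹' cell a b c with hS
  have hneg : ∀ m, -((2 * Real.pi) • latticeVec a b c m) =
      (2 * Real.pi) • latticeVec a b c (-m) := by
    intro m
    rw [← smul_neg]
    congr 1
    rw [neg_eq_iff_add_eq_zero, ← latticeVec_add, add_neg_cancel, latticeVec_zero]
  have hmk : ∀ m x, torusMk a b c (x + -((2 * Real.pi) • latticeVec a b c m)) =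
      torusMk a b c x := by
    intro m x
    rw [hneg, torusMk_add, torusMk_latticeVec ha hb hc, add_zero]
  have hmeas : ∀ m, MeasurableSet (S m) := fun m =>
    (measurable_add_const _) (measurableSet_cell a b c)
  have hdisj : Pairwise (Function.onFun Disjoint S) := by
    intro m l hml
    refine Set.disjoint_left.mpr fun x hm hl => hml ?_
    have e1 := cellPoint_torusMk ha hb hc hm
    have e2 := cellPoint_torusMk ha hb hc hl
    rw [hmk] at e1 e2
    have e3 := neg_inj.mp (add_left_cancel (e1.symm.trans e2))
    exact latticeVec_injective ha hb hc
      (smul_right_injective E3 (by have := Real.pi_pos; positivity : (2 * Real.pi) ≠ 0) e3)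
  have hun : ⋃ m, S m = univ := by
    refine eq_univ_of_forall fun x => ?_
    obtain ⟨m, hm⟩ := exists_cellPoint_torusMk ha hb hc x
    refine mem_iUnion.mpr ⟨m, ?_⟩
    show x + -((2 * Real.pi) • latticeVec a b c m) ∈ cell a b c
    rw [← sub_eq_add_neg, sub_eq_of_eq_add hm]
    exact cellPoint_mem ha hb hc _
  have h := hasSum_integral_iUnion hmeas hdisj hg.integrableOn
  rw [hun, Measure.restrict_univ] at h
  convert! h using 1
  funext m
  have hmp := measurePreserving_add_right (volume : Measure E3)
    (-((2 * Real.pi) • latticeVec a b c m))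
  have := hmp.setIntegral_preimage_emb (measurableEmbedding_addRight _)
    (fun x => g (x + (2 * Real.pi) • latticeVec a b c m)) (cell a b c)
  rw [← this]
  simp only [neg_add_cancel_right, hS]

theorem dualNormSq_neg (a b c : ℝ) (k : Fin 3 → ℤ) : dualNormSq a b c (-k) = dualNormSq a b c k := by
  simp [dualNormSq, neg_div]

theorem integrable_restrict_translate {g : E3 → ℂ} (hg : Integrable g) (s : Set E3) (v : E3) :
    Integrable (fun x => g (x + v)) (volume.restrict s) :=
  (hg.comp_add_right v).restrict

/-- The waves are lattice periodic, so the integral of the periodization over the cell unfolds to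
the Fourier integral over `ℝ³`. -/
theorem coeff_periodicYukawa {a b c : ℝ} (ha : 0 < a) (hb : 0 < b) (hc : 0 < c)
    (k : Fin 3 → ℤ) : coeff a b c (fun x => (periodicYukawa a b c x : ℂ)) k =
      ((1 / (1 + dualNormSq a b c k) : ℝ) : ℂ) := by
  have hY : Integrable fun x => (yukawa x : ℂ) := integrable_yukawa.ofReal
  have hYw : Integrable fun x => (yukawa x : ℂ) * wave a b c (-k) x :=
    hY.mul_bdd (c := 1) (continuous_wave a b c _).aestronglyMeasurable
      (Eventually.of_forall fun x => (norm_wave a b c _ x).le)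
  have h1 := hasSum_integral_of_summable_integral_norm (μ := volume.restrict (cell a b c))
    (F := fun m x => (yukawa (x + (2 * Real.pi) • latticeVec a b c m) : ℂ) *
      wave a b c (-k) (x + (2 * Real.pi) • latticeVec a b c m))
    (fun m => integrable_restrict_translate hYw _ _)
    (hasSum_integral_cell ha hb hc hYw.norm).summable
  have h2 := (hasSum_integral_cell ha hb hc hYw).unique h1
  rw [integral_yukawa_mul_wave, dualNormSq_neg] at h2
  rw [h2, coeff]
  congr 1
  funext x
  simp only [wave_apply_add, wave_latticeVec ha hb hc, mul_one]
  rw [tsum_mul_right, periodicYukawa, Complex.ofReal_tsum]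

/-- The closed cell centred at the origin. -/
def centredCell (a b c : ℝ) : Set E3 :=
  {x | |x 0| ≤ Real.pi * a ∧ |x 1| ≤ Real.pi * b ∧ |x 2| ≤ Real.pi * c}

/-- In each coordinate with `n ≠ 0`, `|y| ≤ πL` gives `|y + 2πnL| ≥ 2π|n|L - πL ≥ π|n|L`. With
inverted parameters, `dualNormSq` is the squared length in the lattice itself. -/
theorem sq_le_norm_add_latticeVec_sq {a b c : ℝ} (ha : 0 < a) (hb : 0 < b) (hc : 0 < c) {x : E3}
    (hx : x ∈ centredCell a b c) (m : Fin 3 → ℤ) :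
    Real.pi ^ 2 * dualNormSq a⁻¹ b⁻¹ c⁻¹ m ≤ ‖x + (2 * Real.pi) • latticeVec a b c m‖ ^ 2 := by
  have hpi := Real.pi_pos
  have h : ∀ (y L : ℝ) (n : ℤ), 0 < L → |y| ≤ Real.pi * L →
      Real.pi ^ 2 * (n * L) ^ 2 ≤ (y + 2 * Real.pi * (n * L)) ^ 2 := by
    intro y L n hL hy
    rcases eq_or_ne n 0 with rfl | hn
    · simp; positivity
    have h1 : (1 : ℝ) ≤ |(n : ℝ)| := by exact_mod_cast Int.one_le_abs hn
    rw [← mul_pow, sq_le_sq, abs_mul, abs_mul, abs_of_pos hpi, abs_of_pos hL]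
    have h2 := abs_sub_abs_le_abs_sub (2 * Real.pi * (n * L)) (-y)
    rw [sub_neg_eq_add, abs_neg, abs_mul, abs_mul, abs_mul, abs_of_pos hpi, abs_of_pos hL, abs_two,
      add_comm (2 * Real.pi * (n * L)) y] at h2
    nlinarith [mul_pos hpi hL]
  rw [EuclideanSpace.norm_sq_eq, Fin.sum_univ_three]
  simp only [Real.norm_eq_abs, sq_abs]
  have h0 := h (x 0) a (m 0) ha hx.1
  have h1 := h (x 1) b (m 1) hb hx.2.1
  have h2 := h (x 2) c (m 2) hc hx.2.2
  have e0 : (x + (2 * Real.pi) • latticeVec a b c m) 0 = x 0 + 2 * Real.pi * (m 0 * a) := rfl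
  have e1 : (x + (2 * Real.pi) • latticeVec a b c m) 1 = x 1 + 2 * Real.pi * (m 1 * b) := rfl
  have e2 : (x + (2 * Real.pi) • latticeVec a b c m) 2 = x 2 + 2 * Real.pi * (m 2 * c) := rfl
  rw [e0, e1, e2]
  simp only [dualNormSq, div_inv_eq_mul]
  linarith

/-- Nonzero `m` have `1 ≤ D N`, so `1 + N` is comparable with `N` and thus bounded by a multiple of
the squared distance; the decay of order four then gives a bound uniform in `x`. -/
theorem exists_yukawa_add_latticeVec_le {a b c : ℝ} (ha : 0 < a) (hb : 0 < b) (hc : 0 < c) :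
    ∃ C, ∀ x ∈ centredCell a b c, ∀ m ≠ 0, x + (2 * Real.pi) • latticeVec a b c m ≠ 0 ∧
      yukawa (x + (2 * Real.pi) • latticeVec a b c m) ≤
        C * (1 / (1 + dualNormSq a⁻¹ b⁻¹ c⁻¹ m) ^ 2) := by
  have hpi := Real.pi_pos
  set D := (a⁻¹ + b⁻¹ + c⁻¹) ^ 2 with hD
  have hD0 : 0 ≤ D := sq_nonneg _
  refine ⟨16 * ((1 + D) / Real.pi ^ 2) ^ 2, fun x hx m hm => ?_⟩
  set N := dualNormSq a⁻¹ b⁻¹ c⁻¹ m with hN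
  have hN0 : 0 ≤ N := dualNormSq_nonneg _ _ _ _
  have h1 : 1 ≤ D * N := by
    obtain ⟨i, hi⟩ := Function.ne_iff.mp hm
    refine le_trans ?_ (sq_coord_le (inv_pos.mpr ha) (inv_pos.mpr hb) (inv_pos.mpr hc) m i)
    have : (1 : ℤ) ≤ (m i) ^ 2 := by
      have : 0 < (m i) ^ 2 := by
        have := sq_pos_of_ne_zero hi
        simpa using this
      omega
    exact_mod_cast this
  have h2 := sq_le_norm_add_latticeVec_sq ha hb hc hx m
  set v := x + (2 * Real.pi) • latticeVec a b c m
  have hNpos : 0 < N := by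
    rcases hN0.eq_or_lt with h | h
    · rw [← h, mul_zero] at h1; linarith
    · exact h
  have hv : 0 < ‖v‖ ^ 2 := lt_of_lt_of_le (by positivity) h2
  have hv0 : v ≠ 0 := by
    intro h; rw [h] at hv; simp at hv
  refine ⟨hv0, (yukawa_le_pow hv0).trans ?_⟩
  have h3 : Real.pi ^ 2 * (1 + N) ≤ (1 + D) * ‖v‖ ^ 2 := by nlinarith [sq_nonneg Real.pi]
  have h4 : (1 / ‖v‖ ^ 2) ≤ (1 + D) / Real.pi ^ 2 * (1 / (1 + N)) := by
    rw [div_mul_div_comm, mul_one, div_le_div_iff₀ hv (by positivity)]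
    linarith
  calc 16 / ‖v‖ ^ 4 = 16 * (1 / ‖v‖ ^ 2) ^ 2 := by rw [div_pow, one_pow, ← pow_mul]; ring
    _ ≤ 16 * ((1 + D) / Real.pi ^ 2 * (1 / (1 + N))) ^ 2 := by gcongr
    _ = _ := by rw [mul_pow, div_pow 1 (1 + N), one_pow]; ring

theorem continuousOn_yukawa : ContinuousOn yukawa {0}ᶜ := by
  have h : ContinuousOn (fun x : E3 => 1 / (4 * Real.pi * ‖x‖) - yukawaDefect x) {0}ᶜ := by
    refine ContinuousOn.sub (continuousOn_const.div (by fun_prop) fun x hx => ?_)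
      continuous_yukawaDefect.continuousOn
    have hpi := Real.pi_pos
    have : 0 < ‖x‖ := norm_pos_iff.mpr hx
    positivity
  exact h.congr fun x hx => yukawa_eq hx

theorem measurable_yukawa : Measurable yukawa := by
  have : StronglyMeasurable fun p : E3 × ℝ =>
      yukawaWeight p.2 * Real.exp (-(‖p.1‖ ^ 2 / 4 * p.2)) :=
    ((measurable_yukawaWeight.comp measurable_snd).mul (by fun_prop)).stronglyMeasurable
  exact (this.integral_prod_right' (ν := volume.restrict (Ioi 0))).measurable.const_mul _

theorem measurable_periodicYukawa (a b c : ℝ) : Measurable (periodicYukawa a b c) := by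
  have e : periodicYukawa a b c = fun x => (∑' m : Fin 3 → ℤ,
      ENNReal.ofReal (yukawa (x + (2 * Real.pi) • latticeVec a b c m))).toReal := by
    funext x
    rw [ENNReal.tsum_toReal_eq fun _ => ENNReal.ofReal_ne_top]
    exact tsum_congr fun m => (ENNReal.toReal_ofReal (yukawa_nonneg _)).symm
  rw [e]
  exact (Measurable.tsum fun m =>
    (measurable_yukawa.comp (measurable_add_const _)).ennreal_ofReal).ennreal_toReal

/-- Near the origin the periodization differs from the Yukawa potential by a bounded continuous
function. -/
theorem exists_periodicYukawa_eq {a b c : ℝ} (ha : 0 < a) (hb : 0 < b) (hc : 0 < c) :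
    ∃ R : E3 → ℝ, ContinuousOn R (centredCell a b c) ∧ (∃ C, ∀ x ∈ centredCell a b c, |R x| ≤ C) ∧
      ∀ x ∈ centredCell a b c, periodicYukawa a b c x = yukawa x + R x := by
  obtain ⟨C, hC⟩ := exists_yukawa_add_latticeVec_le ha hb hc
  have hsum := (summable_inv_one_add_dualNormSq_sq (inv_pos.mpr ha) (inv_pos.mpr hb)
    (inv_pos.mpr hc)).mul_left C
  set F : (Fin 3 → ℤ) → E3 → ℝ := fun m x =>
    if m = 0 then 0 else yukawa (x + (2 * Real.pi) • latticeVec a b c m) with hF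
  set u : (Fin 3 → ℤ) → ℝ := fun m => |C * (1 / (1 + dualNormSq a⁻¹ b⁻¹ c⁻¹ m) ^ 2)| with hu
  have hbound : ∀ m, ∀ x ∈ centredCell a b c, ‖F m x‖ ≤ u m := by
    intro m x hx
    simp only [hF, hu]
    split_ifs with hm
    · rw [norm_zero]
      exact abs_nonneg _
    · rw [Real.norm_of_nonneg (yukawa_nonneg _)]
      exact (hC x hx m hm).2.trans (le_abs_self _)
  refine ⟨fun x => ∑' m, F m x, continuousOn_tsum (fun m => ?_) hsum.abs hbound,
    ⟨∑' m, u m, fun x hx => ?_⟩, fun x hx => ?_⟩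
  · by_cases hm : m = 0
    · simp only [hF, hm, if_true]
      exact continuousOn_const
    · simp only [hF, hm, if_false]
      exact continuousOn_yukawa.comp (by fun_prop) fun x hx => (hC x hx m hm).1
  · exact tsum_of_norm_bounded hsum.abs.hasSum fun m => hbound m x hx
  · have hs : Summable fun m => yukawa (x + (2 * Real.pi) • latticeVec a b c m) := by
      have h1 : Summable fun m => F m x :=
        Summable.of_norm_bounded hsum.abs fun m => hbound m x hx
      refine (summable_congr_cofinite ?_).mp h1
      filter_upwards [(Set.finite_singleton (0 : Fin 3 → ℤ)).compl_mem_cofinite] with m hm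
      have : m ≠ 0 := hm
      simp [hF, this]
    rw [periodicYukawa, hs.tsum_eq_add_tsum_ite 0, latticeVec_zero, smul_zero, add_zero]

theorem isL2OnTorus_periodicYukawa {a b c : ℝ} (ha : 0 < a) (hb : 0 < b) (hc : 0 < c) :
    IsL2OnTorus a b c (fun x => (periodicYukawa a b c x : ℂ)) := by
  have hper : IsTorusFunction a b c (fun x => (periodicYukawa a b c x : ℂ)) :=
    (isTorusFunction_iff a b c _).mpr fun m x => by rw [periodicYukawa_add]
  refine ⟨hper, ?_⟩
  obtain ⟨R, -, ⟨C, hC⟩, hR⟩ := exists_periodicYukawa_eq ha hb hc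
  -- Shifting by half periods moves the cell into the centred cell, where only the term `m = 0` is
  -- singular.
  set h : E3 := !₂[-(Real.pi * a), -(Real.pi * b), -(Real.pi * c)] with hh
  rw [← hper.memLp_add_iff ha hb hc h]
  have hcell : ∀ x ∈ cell a b c, x + h ∈ centredCell a b c := by
    rintro x ⟨h0, h1, h2⟩
    have key : ∀ y L : ℝ, y ∈ Ico 0 (2 * Real.pi * L) → |y + -(Real.pi * L)| ≤ Real.pi * L := by
      intro y L hy
      rw [abs_le]
      constructor <;> linarith [hy.1, hy.2]
    exact ⟨key _ _ h0, key _ _ h1, key _ _ h2⟩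
  have := isFiniteMeasure_restrict_cell ha hb hc
  set r := 2 * Real.pi * a + 2 * Real.pi * b + 2 * Real.pi * c + ‖h‖ + 1 with hr
  have hball : cell a b c ⊆ (fun x => x + h) ⁻¹' Metric.ball 0 r := by
    intro x hx
    have h1 := cell_subset_closedBall a b c hx
    rw [mem_closedBall_zero_iff] at h1
    rw [mem_preimage, mem_ball_zero_iff]
    have := norm_add_le x h
    linarith
  have hY : MemLp (fun x => yukawa (x + h)) 2 (volume.restrict (cell a b c)) := by
    have hm : AEStronglyMeasurable (fun x => yukawa (x + h)) (volume.restrict (cell a b c)) :=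
      (measurable_yukawa.comp (measurable_add_const h)).aestronglyMeasurable
    rw [memLp_two_iff_integrable_sq hm]
    have hmp := measurePreserving_add_right (volume : Measure E3) h
    have h2 := (hmp.integrableOn_comp_preimage (measurableEmbedding_addRight h)
      (f := fun x => yukawa x ^ 2) (s := Metric.ball 0 r)).mpr integrableOn_yukawa_sq
    exact h2.mono_set hball
  have hb := hY.norm.add (memLp_const C)
  refine hb.mono (Complex.measurable_ofReal.comp ((measurable_periodicYukawa a b c).comp
    (measurable_add_const h))).aestronglyMeasurable ?_
  refine (ae_restrict_iff' (measurableSet_cell a b c)).mpr (Eventually.of_forall fun x hx => ?_)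
  rw [hR _ (hcell x hx), Complex.norm_real]
  refine (norm_add_le _ _).trans (le_trans ?_ (le_abs_self _))
  exact add_le_add le_rfl (hC _ (hcell x hx))

theorem exists_tendsto_periodicYukawa_sub {a b c : ℝ} (ha : 0 < a) (hb : 0 < b) (hc : 0 < c) :
    ∃ β : ℝ, Tendsto (fun x : E3 => periodicYukawa a b c x - 1 / (4 * Real.pi * ‖x‖))
      (𝓝[≠] 0) (𝓝 β) := by
  obtain ⟨R, hcont, -, hR⟩ := exists_periodicYukawa_eq ha hb hc
  have hpi := Real.pi_pos
  have hnhds : centredCell a b c ∈ 𝓝 (0 : E3) := by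
    have h : ∀ (i : Fin 3) (L : ℝ), 0 < L → ∀ᶠ x : E3 in 𝓝 0, |x i| ≤ Real.pi * L := by
      intro i L hL
      have hc : Continuous fun x : E3 => |x i| := by fun_prop
      have := hc.continuousAt (x := 0)
      exact (this.eventually_lt continuousAt_const (by simpa using by positivity)).mono
        fun x hx => hx.le
    filter_upwards [h 0 a ha, h 1 b hb, h 2 c hc] with x h0 h1 h2
    exact ⟨h0, h1, h2⟩
  refine ⟨R 0 - yukawaDefect 0, ?_⟩
  have h1 : Tendsto (fun x => R x - yukawaDefect x) (𝓝[≠] 0) (𝓝 (R 0 - yukawaDefect 0)) :=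
    ((hcont.continuousAt hnhds).sub continuous_yukawaDefect.continuousAt).tendsto.mono_left
      nhdsWithin_le_nhds
  refine h1.congr' ?_
  filter_upwards [nhdsWithin_le_nhds hnhds, self_mem_nhdsWithin] with x hx hx0
  rw [hR x hx, yukawa_eq hx0]
  ring

/-! ### The Green's function and the spectral equation -/

theorem laplacian_wave (a b c : ℝ) (k : Fin 3 → ℤ) (x : E3) :
    Laplacian.laplacian (wave a b c k) x = -(dualNormSq a b c k : ℂ) * wave a b c k x := by
  rw [laplacian_apply (contDiff_wave a b c k)]
  have hd := ((contDiff_wave a b c k).differentiable (by simp)) x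
  have e : ∀ i : Fin 3, fderiv ℝ (fun y => fderiv ℝ (wave a b c k) y
      (EuclideanSpace.basisFun (Fin 3) ℝ i)) x (EuclideanSpace.basisFun (Fin 3) ℝ i) =
        -((freq a b c k i : ℝ) : ℂ) ^ 2 * wave a b c k x := by
    intro i
    simp only [fderiv_wave]
    have e3 : (inner ℝ (freq a b c k) (EuclideanSpace.basisFun (Fin 3) ℝ i) : ℝ) =
        freq a b c k i := by
      rw [EuclideanSpace.basisFun_apply, EuclideanSpace.inner_single_right]
      simp
    rw [fderiv_mul_const hd, smul_apply, fderiv_wave, e3, smul_eq_mul]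
    linear_combination ((freq a b c k i : ℝ) : ℂ) ^ 2 * wave a b c k x * Complex.I_sq
  simp only [e, ← norm_freq_sq, EuclideanSpace.norm_sq_eq, Real.norm_eq_abs, sq_abs]
  rw [← Finset.sum_mul]
  push_cast
  simp

/-- A solution of `-Δf + Aδ = μf` has the Fourier coefficients `-A e_{-k}(x₀)/(n_k - μ)`. -/
theorem DistributionalEq.coeff_mul {a b c : ℝ} (ha : 0 < a) (hb : 0 < b) (hc : 0 < c) {x₀ : E3}
    {A : ℂ} {μ : ℝ} {f : E3 → ℂ} (h : DistributionalEq a b c x₀ A f fun x => (μ : ℂ) * f x)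
    (k : Fin 3 → ℤ) :
    coeff a b c f k * ((dualNormSq a b c k - μ : ℝ) : ℂ) = -A * wave a b c (-k) x₀ := by
  have h1 := h _ (isSmoothOnTorus_wave ha hb hc (-k))
  simp only [laplacian_wave, dualNormSq_neg] at h1
  have e1 : ∫ x in cell a b c, f x * -(-(dualNormSq a b c k : ℂ) * wave a b c (-k) x) =
      (dualNormSq a b c k : ℂ) * coeff a b c f k := by
    rw [coeff, ← integral_const_mul]
    congr 1
    funext x
    ring
  have e2 : ∫ x in cell a b c, (μ : ℂ) * f x * wave a b c (-k) x = (μ : ℂ) * coeff a b c f k := by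
    simp only [mul_assoc, integral_const_mul, coeff]
  rw [e1, e2] at h1
  push_cast
  linear_combination h1

/-- Parseval expresses the pairings of `f` with `ψ` and `Δψ` through coefficients; the hypothesis
turns their combination into the Fourier series of `ψ` at `x₀`. -/
theorem distributionalEq_of_coeff {a b c : ℝ} (ha : 0 < a) (hb : 0 < b) (hc : 0 < c) {x₀ : E3}
    {A : ℂ} {μ : ℝ} {f : E3 → ℂ} (hf : IsL2OnTorus a b c f)
    (h : ∀ k, coeff a b c f k * ((dualNormSq a b c k - μ : ℝ) : ℂ) = -A * wave a b c (-k) x₀) :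
    DistributionalEq a b c x₀ A f fun x => (μ : ℂ) * f x := by
  intro ψ hψ
  have hV : (cellVol a b c : ℂ) ≠ 0 := Complex.ofReal_ne_zero.mpr (cellVol_pos ha hb hc).ne'
  have hl := hψ.laplacian
  have h1 := hasSum_coeff_neg_mul ha hb hc hf.2
    (memLp_of_continuous ha hb hc hl.1 hl.2.continuous 2)
  have h2 := hasSum_coeff_neg_mul ha hb hc hf.2
    (memLp_of_continuous ha hb hc hψ.1 hψ.2.continuous 2)
  have h3 := (hψ.hasSum_coeff ha hb hc x₀).mul_left (cellVol a b c * A)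
  have h4 := (h1.add (h2.mul_left (μ : ℂ))).unique (h3.congr_fun fun k => by
    have := h (-k)
    rw [dualNormSq_neg, neg_neg] at this
    rw [coeff_laplacian ha hb hc hψ]
    push_cast at this
    field_simp
    linear_combination (-coeff a b c ψ k) * this)
  simp only [mul_neg, integral_neg, mul_assoc, integral_const_mul]
  apply mul_left_cancel₀ hV
  linear_combination -h4

/-- The Green's function `(Δ + μ)⁻¹ δ_{x₀}`. -/
noncomputable def green (a b c : ℝ) (x₀ : E3) (μ : ℝ) (x : E3) : ℂ :=
  (-1) * (periodicYukawa a b c (x + -x₀) : ℂ) + ∑' k, ((-((cellVol a b c)⁻¹ *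
    (1 / (dualNormSq a b c k - μ) - 1 / (dualNormSq a b c k + 1))) : ℝ) : ℂ) *
      wave a b c k (x + -x₀)

section Green

variable {a b c : ℝ} (ha : 0 < a) (hb : 0 < b) (hc : 0 < c) (x₀ : E3) {μ : ℝ}
  (hμ : μ ∉ range (dualNormSq a b c))

include ha hb hc hμ

/-- Removing `1/(n + 1)`, which the periodized Yukawa potential accounts for, leaves coefficients
that are absolutely summable. The rest of the Green's function is therefore continuous. -/
theorem summable_norm_green_series : Summable fun k => ‖((-((cellVol a b c)⁻¹ *
    (1 / (dualNormSq a b c k - μ) - 1 / (dualNormSq a b c k + 1))) : ℝ) : ℂ)‖ := by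
  simp only [Complex.norm_real, Real.norm_eq_abs]
  exact ((summable_resolvent_sub ha hb hc hμ).mul_left _).neg.abs

theorem isL2OnTorus_green : IsL2OnTorus a b c (green a b c x₀ μ) := by
  have h1 := (isL2OnTorus_periodicYukawa ha hb hc).shift ha hb hc (-x₀)
  have hs := summable_norm_green_series ha hb hc hμ
  have ht := isTorusFunction_tsum_wave ha hb hc (fun k => ((-((cellVol a b c)⁻¹ *
    (1 / (dualNormSq a b c k - μ) - 1 / (dualNormSq a b c k + 1))) : ℝ) : ℂ))
  have h2 := IsL2OnTorus.shift ha hb hc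
    ⟨ht, memLp_of_continuous ha hb hc ht (continuous_tsum_wave a b c hs) 2⟩ (-x₀)
  refine ⟨fun l hl x => ?_, (h1.2.const_mul (-1)).add h2.2⟩
  exact congrArg₂ (fun y z => (-1) * y + z) (h1.1 l hl x) (h2.1 l hl x)

theorem coeff_green (k : Fin 3 → ℤ) : coeff a b c (green a b c x₀ μ) k =
    -1 * wave a b c (-k) x₀ / ((dualNormSq a b c k - μ : ℝ) : ℂ) := by
  have hV : cellVol a b c ≠ 0 := (cellVol_pos ha hb hc).ne'
  have h0 := isL2OnTorus_periodicYukawa ha hb hc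
  have h1 := h0.shift ha hb hc (-x₀)
  have hs := summable_norm_green_series ha hb hc hμ
  have ht := isTorusFunction_tsum_wave ha hb hc (fun k => ((-((cellVol a b c)⁻¹ *
    (1 / (dualNormSq a b c k - μ) - 1 / (dualNormSq a b c k + 1))) : ℝ) : ℂ))
  have h2 := IsL2OnTorus.shift ha hb hc
    ⟨ht, memLp_of_continuous ha hb hc ht (continuous_tsum_wave a b c hs) 2⟩ (-x₀)
  have h3 := coeff_add ((integrable_of_memLp ha hb hc h1.2).const_mul (-1))
    (integrable_of_memLp ha hb hc h2.2) k
  rw [coeff_const_mul, coeff_shift ha hb hc h0.1, coeff_shift ha hb hc ht,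
    coeff_periodicYukawa ha hb hc, coeff_tsum_wave ha hb hc hs, wave_apply_neg] at h3
  refine h3.trans ?_
  have hn := dualNormSq_nonneg a b c k
  have hk : dualNormSq a b c k - μ ≠ 0 := fun h => hμ ⟨k, sub_eq_zero.mp h⟩
  have e : (-1 * (1 / (1 + dualNormSq a b c k)) + cellVol a b c * (-((cellVol a b c)⁻¹ *
    (1 / (dualNormSq a b c k - μ) - 1 / (dualNormSq a b c k + 1)))) : ℝ) =
      -1 / (dualNormSq a b c k - μ) := by
    rw [mul_neg, mul_inv_cancel_left₀ hV, add_comm 1 (dualNormSq a b c k)]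
    ring
  have e' := congrArg (fun r : ℝ => (r : ℂ)) e
  simp only [Complex.ofReal_add, Complex.ofReal_mul, Complex.ofReal_neg, Complex.ofReal_one,
    Complex.ofReal_div _ (dualNormSq a b c k - μ)] at e'
  rw [mul_comm (-1 : ℂ) (wave a b c (-k) x₀), mul_div_assoc, ← e']
  push_cast
  ring

/-- All waves equal one at the origin, so the continuous part takes there a multiple of
`resolventSum` as its value. This links the boundary condition with the eigenvalue equation. -/
theorem tendsto_green_add {β : ℝ} (hβ : Tendsto (fun x : E3 => periodicYukawa a b c x -
    1 / (4 * Real.pi * ‖x‖)) (𝓝[≠] 0) (𝓝 β)) :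
    Tendsto (fun x => green a b c x₀ μ x + ((1 / (4 * Real.pi * ‖x - x₀‖) : ℝ) : ℂ)) (𝓝[≠] x₀)
      (𝓝 ((-(β + (cellVol a b c)⁻¹ * resolventSum a b c μ) : ℝ) : ℂ)) := by
  have hs := summable_norm_green_series ha hb hc hμ
  have hshift : Tendsto (fun x : E3 => x + -x₀) (𝓝[≠] x₀) (𝓝[≠] 0) := by
    refine tendsto_nhdsWithin_iff.mpr ⟨?_, ?_⟩
    · have : Tendsto (fun x : E3 => x + -x₀) (𝓝 x₀) (𝓝 (x₀ + -x₀)) :=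
        (continuous_add_const _).tendsto _
      rw [add_neg_cancel] at this
      exact this.mono_left nhdsWithin_le_nhds
    · filter_upwards [self_mem_nhdsWithin] with x hx h
      exact hx (by simpa [add_neg_eq_zero] using h)
  have h1 := (Complex.continuous_ofReal.tendsto β).comp (hβ.comp hshift)
  have h2 : Tendsto (fun x => ∑' k, ((-((cellVol a b c)⁻¹ *
      (1 / (dualNormSq a b c k - μ) - 1 / (dualNormSq a b c k + 1))) : ℝ) : ℂ) *
      wave a b c k (x + -x₀)) (𝓝[≠] x₀)
      (𝓝 ((-((cellVol a b c)⁻¹ * resolventSum a b c μ) : ℝ) : ℂ)) := by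
    have := ((continuous_tsum_wave a b c hs).tendsto 0).comp
      (hshift.mono_right nhdsWithin_le_nhds)
    convert! this using 2
    simp only [wave_apply_zero, mul_one]
    rw [← Complex.ofReal_tsum, tsum_neg, tsum_mul_left, resolventSum]
  have h3 := (h1.const_mul (-1)).add h2
  convert! h3 using 1
  · funext x
    simp only [green, Function.comp_apply, sub_eq_add_neg]
    push_cast
    ring
  · push_cast
    ring_nf

end Green

/-- Neighbourhoods have positive measure and points have none. This makes limits that disregard null
sets unique. -/
theorem neBot_nhdsNE_inf_ae (x : E3) : (𝓝[≠] x ⊓ ae (volume : Measure E3)).NeBot := by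
  refine ⟨fun h => ?_⟩
  obtain ⟨U, hU, W, hW, hUW⟩ := Filter.inf_eq_bot_iff.mp h
  have h1 : U ∪ {x} ∈ 𝓝 x := by
    filter_upwards [mem_nhdsWithin_iff_eventually.mp hU] with y hy
    by_cases hyx : y = x
    · exact Or.inr hyx
    · exact Or.inl (hy hyx)
  have h2 : volume (U ∪ {x}) = 0 := by
    have hsub : U ⊆ Wᶜ := fun y hy hyW =>
      (hUW ▸ (⟨hy, hyW⟩ : y ∈ U ∩ W) : y ∈ (∅ : Set E3))
    exact measure_union_null (measure_mono_null hsub (mem_ae_iff.mp hW)) (measure_singleton x)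
  exact (Measure.measure_pos_of_mem_nhds volume h1).ne' h2

/-- At a point of norm `μ` the coefficient relation would read `0 = -A` times a number of modulus
one. -/
theorem notMem_range_of_distributionalEq {a b c : ℝ} (ha : 0 < a) (hb : 0 < b) (hc : 0 < c)
    {x₀ : E3} {A : ℂ} {μ : ℝ} {f : E3 → ℂ} (hA : A ≠ 0)
    (h : DistributionalEq a b c x₀ A f fun x => (μ : ℂ) * f x) :
    μ ∉ range (dualNormSq a b c) := by
  rintro ⟨k, rfl⟩
  have h1 := h.coeff_mul ha hb hc k
  rw [sub_self, Complex.ofReal_zero, mul_zero] at h1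
  exact mul_ne_zero (neg_ne_zero.mpr hA) (wave_ne_zero a b c _ _) h1.symm

theorem DistributionalEq.coeff_eq {a b c : ℝ} (ha : 0 < a) (hb : 0 < b) (hc : 0 < c)
    {x₀ : E3} {A : ℂ} {μ : ℝ} {f : E3 → ℂ} (hA : A ≠ 0)
    (h : DistributionalEq a b c x₀ A f fun x => (μ : ℂ) * f x) (k : Fin 3 → ℤ) :
    coeff a b c f k = -A * wave a b c (-k) x₀ / ((dualNormSq a b c k - μ : ℝ) : ℂ) := by
  have hμ := notMem_range_of_distributionalEq ha hb hc hA h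
  have hk : ((dualNormSq a b c k - μ : ℝ) : ℂ) ≠ 0 :=
    Complex.ofReal_ne_zero.mpr fun h => hμ ⟨k, sub_eq_zero.mp h⟩
  rw [eq_div_iff hk, h.coeff_mul ha hb hc]

theorem cos_half_pos {φ : ℝ} (hφ : φ ∈ Set.Ioo (-Real.pi) Real.pi) : 0 < Real.cos (φ / 2) :=
  Real.cos_pos_of_mem_Ioo ⟨by linarith [hφ.1], by linarith [hφ.2]⟩

/-- The perturbed eigenvalues form a level set of `resolventSum`. -/
theorem perturbedEigenvalues_eq {a b c : ℝ} (ha : 0 < a) (hb : 0 < b) (hc : 0 < c) (x₀ : E3)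
    {φ : ℝ} (hφ : φ ∈ Set.Ioo (-Real.pi) Real.pi) :
    ∃ κ, perturbedEigenvalues a b c x₀ φ =
      {μ | μ ∉ range (dualNormSq a b c) ∧ resolventSum a b c μ = κ} := by
  have hcos := cos_half_pos hφ
  have hV := cellVol_pos ha hb hc
  obtain ⟨β, hβ⟩ := exists_tendsto_periodicYukawa_sub ha hb hc
  have := neBot_nhdsNE_inf_ae x₀
  -- The level results from matching constant terms: `cos(φ/2)` times the regular value of the
  -- Green's function must be `sin(φ/2)`.
  set κ := -(cellVol a b c * (β + Real.sin (φ / 2) / Real.cos (φ / 2))) with hκ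
  have hiff : ∀ r : ℝ, r = κ ↔
      Real.cos (φ / 2) * -(β + (cellVol a b c)⁻¹ * r) = Real.sin (φ / 2) := by
    intro r
    rw [hκ]
    constructor
    · rintro rfl
      field_simp
      ring
    · intro h
      field_simp at h ⊢
      linarith
  refine ⟨κ, Set.ext fun μ => ⟨?_, ?_⟩⟩
  · rintro ⟨f, s, hs, hf⟩
    have hA : s * (Real.cos (φ / 2) : ℂ) ≠ 0 :=
      mul_ne_zero hs (Complex.ofReal_ne_zero.mpr hcos.ne')
    have hμ := notMem_range_of_distributionalEq ha hb hc hA hf.equation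
    refine ⟨hμ, (hiff _).mpr ?_⟩
    have hG := isL2OnTorus_green ha hb hc x₀ hμ
    -- Fourier coefficients determine `f` up to a null set, so its boundary behaviour is that of the
    -- explicit Green's function.
    have hae : f =ᵐ[volume] fun x => s * (Real.cos (φ / 2) : ℂ) * green a b c x₀ μ x := by
      refine ae_eq_of_restrict_cell ha hb hc hf.memL2.1 (fun l hl x => ?_)
        (ae_eq_of_coeff_eq ha hb hc hf.memL2.2 (hG.2.const_mul _) fun k => ?_)
      · show _ * green a b c x₀ μ _ = _
        rw [hG.1 l hl]
      · rw [hf.equation.coeff_eq ha hb hc hA, coeff_const_mul, coeff_green ha hb hc x₀ hμ]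
        ring
    have h1 := ((tendsto_green_add ha hb hc x₀ hμ hβ).mono_left
      (inf_le_left : 𝓝[≠] x₀ ⊓ ae volume ≤ 𝓝[≠] x₀)).const_mul (s * (Real.cos (φ / 2) : ℂ))
    have h2 := hf.boundary.add_const (s * (Real.sin (φ / 2) : ℂ))
    rw [zero_add] at h2
    have h3 : (fun x => f x - s * ((Real.cos (φ / 2) * (-1 / (4 * Real.pi * ‖x - x₀‖)) +
        Real.sin (φ / 2) : ℝ) : ℂ) + s * (Real.sin (φ / 2) : ℂ)) =ᶠ[𝓝[≠] x₀ ⊓ ae volume]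
        fun x => s * (Real.cos (φ / 2) : ℂ) * (green a b c x₀ μ x +
          ((1 / (4 * Real.pi * ‖x - x₀‖) : ℝ) : ℂ)) := by
      filter_upwards [Filter.mem_inf_of_right hae] with x hx
      have hx' : f x = s * (Real.cos (φ / 2) : ℂ) * green a b c x₀ μ x := hx
      rw [hx']
      push_cast
      ring
    have h4 := tendsto_nhds_unique (h2.congr' h3) h1
    rw [mul_assoc, mul_right_inj' hs] at h4
    exact_mod_cast h4.symm
  · rintro ⟨hμ, hr⟩
    have hr' := (hiff _).mp hr
    have hG := isL2OnTorus_green ha hb hc x₀ hμ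
    have hf : IsL2OnTorus a b c fun x => (Real.cos (φ / 2) : ℂ) * green a b c x₀ μ x := by
      refine ⟨fun l hl x => ?_, hG.2.const_mul _⟩
      show _ * green a b c x₀ μ _ = _
      rw [hG.1 l hl]
    -- Scaling by `cos(φ/2)` makes the boundary coefficient `s` equal to one.
    refine ⟨fun x => (Real.cos (φ / 2) : ℂ) * green a b c x₀ μ x, 1, one_ne_zero, hf, ?_, ?_, ?_⟩
    · refine ⟨fun l hl x => ?_, hf.2.const_mul _⟩
      exact congrArg _ (hf.1 l hl x)
    · have h1 := ((tendsto_green_add ha hb hc x₀ hμ hβ).mono_left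
        (inf_le_left : 𝓝[≠] x₀ ⊓ ae volume ≤ 𝓝[≠] x₀)).const_mul ((Real.cos (φ / 2) : ℂ))
      have h2 := h1.sub_const (Real.sin (φ / 2) : ℂ)
      rw [← Complex.ofReal_mul, hr', sub_self] at h2
      refine h2.congr fun x => ?_
      push_cast
      ring
    · refine distributionalEq_of_coeff ha hb hc hf fun k => ?_
      have hk : ((dualNormSq a b c k - μ : ℝ) : ℂ) ≠ 0 :=
        Complex.ofReal_ne_zero.mpr fun h => hμ ⟨k, sub_eq_zero.mp h⟩
      rw [coeff_const_mul, coeff_green ha hb hc x₀ hμ]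
      field_simp

/-! ### From overlaps to equidistribution -/

theorem coeff_wave_mul (a b c : ℝ) (f : E3 → ℂ) (ζ k : Fin 3 → ℤ) :
    coeff a b c (fun x => wave a b c ζ x * f x) k = coeff a b c f (k + -ζ) := by
  simp only [coeff, neg_add, neg_neg, wave_add]
  congr 1
  funext x
  ring

theorem integrable_norm_sq {a b c : ℝ} {f : E3 → ℂ}
    (hf : MemLp f 2 (volume.restrict (cell a b c))) :
    Integrable (fun x => ((‖f x‖ ^ 2 : ℝ) : ℂ)) (volume.restrict (cell a b c)) :=
  (hf.norm.integrable_sq).ofReal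

/-- The matrix elements of the waves in a normalized multiple of the Green's function are bounded
by the overlaps. -/
theorem norm_integral_wave_mul_le_overlap {a b c : ℝ} (ha : 0 < a) (hb : 0 < b) (hc : 0 < c)
    {x₀ : E3} {B : ℂ} {μ : ℝ} {f : E3 → ℂ} (hf : IsL2OnTorus a b c f)
    (hcoeff : ∀ k, coeff a b c f k =
      B * wave a b c (-k) x₀ / ((dualNormSq a b c k - μ : ℝ) : ℂ))
    (hnorm : ∫ x in cell a b c, ‖f x‖ ^ 2 = 1) (ζ : Fin 3 → ℤ) :
    ‖∫ x in cell a b c, wave a b c ζ x * ((‖f x‖ ^ 2 : ℝ) : ℂ)‖ ≤ overlap a b c μ (-ζ) := by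
  have hV := cellVol_pos ha hb hc
  have hcn : ∀ k, ‖coeff a b c f k‖ = ‖B‖ * |1 / (dualNormSq a b c k - μ)| := by
    intro k
    rw [hcoeff, norm_div, norm_mul, norm_wave, mul_one, Complex.norm_real, Real.norm_eq_abs,
      abs_div, abs_one]
    ring
  have hwf : MemLp (fun x => wave a b c ζ x * f x) 2 (volume.restrict (cell a b c)) :=
    hf.2.mono ((continuous_wave a b c ζ).aestronglyMeasurable.mul hf.2.1)
      (Eventually.of_forall fun x => by rw [norm_mul, norm_wave, one_mul])
  have h1 := hasSum_norm_coeff_sq ha hb hc hf.2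
  rw [hnorm, mul_one] at h1
  simp only [hcn, mul_pow, sq_abs] at h1
  -- The normalization fixes the modulus of `B` and thereby produces the denominator of the overlap.
  have hden : ‖B‖ ^ 2 * ∑' k, (1 / (dualNormSq a b c k - μ)) ^ 2 = cellVol a b c := by
    rw [← tsum_mul_left]
    exact h1.tsum_eq
  -- Parseval is applied to `f` and `wave · f`; multiplication by the wave translates the
  -- coefficients by `-ζ`.
  have h2 := hasSum_conj_coeff_mul ha hb hc hf.2 hwf
  have e : ∀ x, (starRingEnd ℂ) (f x) * (wave a b c ζ x * f x) =
      wave a b c ζ x * ((‖f x‖ ^ 2 : ℝ) : ℂ) := by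
    intro x
    rw [mul_left_comm, ← Complex.normSq_eq_conj_mul_self, Complex.normSq_eq_norm_sq]
  simp only [e, coeff_wave_mul] at h2
  have hterm : ∀ k, ‖(starRingEnd ℂ) (coeff a b c f k) * coeff a b c f (k + -ζ)‖ = ‖B‖ ^ 2 *
      |1 / (dualNormSq a b c k - μ) * (1 / (dualNormSq a b c (k + -ζ) - μ))| := by
    intro k
    rw [norm_mul, RCLike.norm_conj, hcn, hcn, abs_mul]
    ring
  have hs : Summable fun k =>
      ‖(starRingEnd ℂ) (coeff a b c f k) * coeff a b c f (k + -ζ)‖ := h2.summable.norm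
  have h3 := norm_tsum_le_tsum_norm hs
  rw [h2.tsum_eq, norm_mul, Complex.norm_real, Real.norm_of_nonneg hV.le] at h3
  simp only [hterm] at h3
  rw [tsum_mul_left] at h3
  have hB : 0 < ‖B‖ ^ 2 := by
    rcases (sq_nonneg ‖B‖).eq_or_lt with h | h
    · rw [← h, zero_mul] at hden
      exact absurd hden hV.ne
    · exact h
  have hD : 0 < ∑' k, (1 / (dualNormSq a b c k - μ)) ^ 2 :=
    pos_of_mul_pos_right (hden ▸ hV) hB.le
  rw [overlap, le_div_iff₀ hD]
  rw [← hden] at h3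
  refine le_of_mul_le_mul_left ?_ hB
  linarith

/-- Equidistribution along a set of energies on which all overlaps tend to zero. -/
theorem tendsto_integral_mul_norm_sq {a b c : ℝ} (ha : 0 < a) (hb : 0 < b) (hc : 0 < c)
    {x₀ : E3} {S : Set ℝ}
    (hS : ∀ ζ : Fin 3 → ℤ, ζ ≠ 0 → Tendsto (fun μ => overlap a b c μ ζ) (atTop ⊓ 𝓟 S) (𝓝 0))
    {g : ℝ → E3 → ℂ} (hg : ∀ μ ∈ S, IsL2OnTorus a b c (g μ) ∧
      (∃ B : ℂ, ∀ k, coeff a b c (g μ) k =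
        B * wave a b c (-k) x₀ / ((dualNormSq a b c k - μ : ℝ) : ℂ)) ∧
      ∫ x in cell a b c, ‖g μ x‖ ^ 2 = 1) {u : E3 → ℂ} (hu : IsSmoothOnTorus a b c u) :
    Tendsto (fun μ : ℝ => ∫ x in cell a b c, u x * ((‖g μ x‖ ^ 2 : ℝ) : ℂ)) (atTop ⊓ 𝓟 S)
      (𝓝 (((volume (cell a b c)).toReal : ℂ)⁻¹ * ∫ x in cell a b c, u x)) := by
  have hV := cellVol_pos ha hb hc
  set d : (Fin 3 → ℤ) → ℂ := fun ζ => (cellVol a b c : ℂ)⁻¹ * coeff a b c u ζ with hd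
  have hds : Summable fun ζ => ‖d ζ‖ := by
    simp only [hd, norm_mul]
    exact (hu.summable_norm_coeff ha hb hc).mul_left _
  have hmem : ∀ᶠ μ in atTop ⊓ 𝓟 S, μ ∈ S := mem_inf_of_right (mem_principal_self S)
  have hone : ∀ μ ∈ S, ∫ x in cell a b c, ((‖g μ x‖ ^ 2 : ℝ) : ℂ) = 1 := by
    intro μ hμ
    have : ∫ x in cell a b c, ((‖g μ x‖ ^ 2 : ℝ) : ℂ) =
        ((∫ x in cell a b c, ‖g μ x‖ ^ 2 : ℝ) : ℂ) := integral_ofReal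
    rw [this, (hg μ hμ).2.2, Complex.ofReal_one]
  have hexp : (fun μ : ℝ => ∑' ζ, d ζ * ∫ x in cell a b c,
      wave a b c ζ x * ((‖g μ x‖ ^ 2 : ℝ) : ℂ)) =ᶠ[atTop ⊓ 𝓟 S]
      fun μ : ℝ => ∫ x in cell a b c, u x * ((‖g μ x‖ ^ 2 : ℝ) : ℂ) := by
    filter_upwards [hmem] with μ hμ
    rw [(hasSum_integral_tsum_wave hds (integrable_norm_sq (hg μ hμ).1.2)).tsum_eq]
    congr 1
    funext x
    rw [(hu.hasSum_coeff ha hb hc x).tsum_eq]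
  refine Tendsto.congr' hexp ?_
  have hlim : ((volume (cell a b c)).toReal : ℂ)⁻¹ * ∫ x in cell a b c, u x =
      ∑' ζ : Fin 3 → ℤ, if ζ = 0 then d 0 else 0 := by
    rw [tsum_ite_eq, volume_cell ha hb hc, ENNReal.toReal_ofReal hV.le]
    simp only [hd, coeff, neg_zero, wave_zero, mul_one]
  rw [hlim]
  -- The matrix elements are at most one in modulus, so the coefficients of `u` dominate. The term
  -- `ζ = 0` is the mean of `u`; all others tend to zero.
  refine tendsto_tsum_of_dominated_convergence (G := ℂ) (bound := fun ζ => ‖d ζ‖) hds (fun ζ => ?_) ?_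
  · by_cases hζ : ζ = 0
    · subst hζ
      rw [if_pos rfl]
      refine tendsto_const_nhds.congr' ?_
      filter_upwards [hmem] with μ hμ
      simp only [wave_zero, one_mul]
      rw [hone μ hμ, mul_one]
    · rw [if_neg hζ]
      have h0 : Tendsto (fun μ => ∫ x in cell a b c,
          wave a b c ζ x * ((‖g μ x‖ ^ 2 : ℝ) : ℂ)) (atTop ⊓ 𝓟 S) (𝓝 0) := by
        refine squeeze_zero_norm' ?_ (hS (-ζ) (neg_ne_zero.mpr hζ))
        filter_upwards [hmem] with μ hμ
        obtain ⟨hL2, ⟨B, hB⟩, hn⟩ := hg μ hμ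
        exact norm_integral_wave_mul_le_overlap ha hb hc hL2 hB hn ζ
      simpa using h0.const_mul (d ζ)
  · filter_upwards [hmem] with μ hμ ζ
    rw [norm_mul]
    refine mul_le_of_le_one_right (norm_nonneg _) ?_
    refine (norm_integral_le_integral_norm _).trans_eq ?_
    rw [← (hg μ hμ).2.2]
    congr 1
    funext x
    rw [norm_mul, norm_wave, one_mul, Complex.norm_real, Real.norm_of_nonneg (sq_nonneg _)]

theorem IsNormalizedPerturbedEigenfunction.exists_coeff {a b c : ℝ} (ha : 0 < a) (hb : 0 < b)
    (hc : 0 < c) {x₀ : E3} {φ μ : ℝ} (hφ : φ ∈ Set.Ioo (-Real.pi) Real.pi) {g : E3 → ℂ}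
    (hg : IsNormalizedPerturbedEigenfunction a b c x₀ φ μ g) :
    IsL2OnTorus a b c g ∧ (∃ B : ℂ, ∀ k, coeff a b c g k =
        B * wave a b c (-k) x₀ / ((dualNormSq a b c k - μ : ℝ) : ℂ)) ∧
      ∫ x in cell a b c, ‖g x‖ ^ 2 = 1 := by
  obtain ⟨⟨s, hs, hf⟩, hn⟩ := hg
  have hA : s * (Real.cos (φ / 2) : ℂ) ≠ 0 :=
    mul_ne_zero hs (Complex.ofReal_ne_zero.mpr (cos_half_pos hφ).ne')
  exact ⟨hf.memL2, ⟨_, hf.equation.coeff_eq ha hb hc hA⟩, hn⟩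

theorem IsNormalizedGreenFunction.exists_coeff {a b c : ℝ} (ha : 0 < a) (hb : 0 < b)
    (hc : 0 < c) {x₀ : E3} {μ : ℝ} {g : E3 → ℂ}
    (hg : IsNormalizedGreenFunction a b c x₀ μ g) :
    IsL2OnTorus a b c g ∧ (∃ B : ℂ, ∀ k, coeff a b c g k =
        B * wave a b c (-k) x₀ / ((dualNormSq a b c k - μ : ℝ) : ℂ)) ∧
      ∫ x in cell a b c, ‖g x‖ ^ 2 = 1 := by
  obtain ⟨G, ⟨hL2, hG⟩, hgG⟩ := hg
  set r := Real.sqrt (∫ y in cell a b c, ‖G y‖ ^ 2) with hr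
  have hcoeff := hG.coeff_eq ha hb hc one_ne_zero
  have hμ := notMem_range_of_distributionalEq ha hb hc one_ne_zero hG
  -- A vanishing norm would make the quotient zero by convention; the nonzero coefficient at `k = 0`
  -- excludes this.
  have hpos : 0 < ∫ y in cell a b c, ‖G y‖ ^ 2 := by
    have h1 := hasSum_norm_coeff_sq ha hb hc hL2.2
    have h0 : coeff a b c G 0 ≠ 0 := by
      rw [hcoeff]
      exact div_ne_zero (mul_ne_zero (by simp) (wave_ne_zero a b c _ _))
        (Complex.ofReal_ne_zero.mpr fun h => hμ ⟨0, sub_eq_zero.mp h⟩)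
    have h2 := le_hasSum h1 0 fun k _ => sq_nonneg _
    have h3 : 0 < ‖coeff a b c G 0‖ ^ 2 := by
      have := norm_pos_iff.mpr h0
      positivity
    exact pos_of_mul_pos_right (h3.trans_le h2) (cellVol_pos ha hb hc).le
  have hrpos : 0 < r := Real.sqrt_pos.mpr hpos
  have e : g = fun x => ((r⁻¹ : ℝ) : ℂ) * G x := by
    funext x
    rw [hgG x, div_eq_inv_mul, Complex.ofReal_inv]
  refine ⟨?_, ⟨((r⁻¹ : ℝ) : ℂ) * -1, fun k => ?_⟩, ?_⟩
  · rw [e]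
    refine ⟨fun l hl x => ?_, hL2.2.const_mul _⟩
    exact congrArg _ (hL2.1 l hl x)
  · rw [e, coeff_const_mul, hcoeff]
    ring
  · have e2 : ∀ x, ‖g x‖ ^ 2 = (r⁻¹) ^ 2 * ‖G x‖ ^ 2 := by
      intro x
      rw [e, norm_mul, Complex.norm_real, Real.norm_of_nonneg (inv_nonneg.mpr hrpos.le), mul_pow]
    simp only [e2, integral_const_mul]
    rw [inv_pow, hr, Real.sq_sqrt hpos.le, inv_mul_cancel₀ hpos.ne']

/-- Both parts of the theorem are instances: only the level and the way in which the functions are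
described differ. The set of density one is built from overlaps alone, hence independent of `g` and
`u`. -/
theorem almostAllEquidistribute_of_level_set {a b c : ℝ} (ha : 0 < a) (hb : 0 < b) (hc : 0 < c)
    (hind : LinearIndependent ℚ ![1 / a ^ 2, 1 / b ^ 2, 1 / c ^ 2])
    (htype : IsIrrationalOfFiniteType (b ^ 2 / a ^ 2) ∨
      IsIrrationalOfFiniteType (c ^ 2 / a ^ 2) ∨ IsIrrationalOfFiniteType (c ^ 2 / b ^ 2))
    {x₀ : E3} {Λ : Set ℝ}
    (hΛ : ∃ κ, Λ = {μ | μ ∉ range (dualNormSq a b c) ∧ resolventSum a b c μ = κ})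
    {P : ℝ → (E3 → ℂ) → Prop} (hP : ∀ μ g, P μ g → IsL2OnTorus a b c g ∧
      (∃ B : ℂ, ∀ k, coeff a b c g k =
        B * wave a b c (-k) x₀ / ((dualNormSq a b c k - μ : ℝ) : ℂ)) ∧
      ∫ x in cell a b c, ‖g x‖ ^ 2 = 1) :
    AlmostAllEquidistribute a b c Λ P := by
  obtain ⟨κ, rfl⟩ := hΛ
  obtain ⟨S, hS, hdens, hover⟩ :=
    (interlaces_resolventSum ha hb hc κ).exists_density_one ha hb hc hind htype
  exact ⟨S, hS, hdens, fun g hg u hu =>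
    tendsto_integral_mul_norm_sq ha hb hc hover (fun μ hμ => hP _ _ (hg μ (hS hμ))) hu⟩

end PointScatterer

theorem theorem2 (a b c : ℝ) (ha : 0 < a) (hb : 0 < b) (hc : 0 < c)
    (hind : LinearIndependent ℚ ![1 / a ^ 2, 1 / b ^ 2, 1 / c ^ 2])
    (htype : IsIrrationalOfFiniteType (b ^ 2 / a ^ 2) ∨
      IsIrrationalOfFiniteType (c ^ 2 / a ^ 2) ∨ IsIrrationalOfFiniteType (c ^ 2 / b ^ 2))
    (x₀ : PointScatterer.E3) (φ : ℝ) (hφ : φ ∈ Set.Ioo (-Real.pi) Real.pi) :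
    PointScatterer.AlmostAllEquidistribute a b c
        (PointScatterer.perturbedEigenvalues a b c x₀ φ)
        (PointScatterer.IsNormalizedPerturbedEigenfunction a b c x₀ φ) ∧
      PointScatterer.AlmostAllEquidistribute a b c
        (PointScatterer.secularEigenvalues a b c φ)
        (PointScatterer.IsNormalizedGreenFunction a b c x₀) :=
  ⟨PointScatterer.almostAllEquidistribute_of_level_set ha hb hc hind htype
      (PointScatterer.perturbedEigenvalues_eq ha hb hc x₀ hφ)
      fun _ _ hg => hg.exists_coeff ha hb hc hφ,
    PointScatterer.almostAllEquidistribute_of_level_set ha hb hc hind htype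
      (PointScatterer.secularEigenvalues_eq ha hb hc φ)
      fun _ _ hg => hg.exists_coeff ha hb hc⟩
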